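/- Let $n\ge 1$ and let $\Delta^n=\{z\in\mathbb C^n: |z_j|<1 \text{ for } j=1,\dots,n\}$ be the unit polydisc, with Lebesgue measure. There is a constant $C>0$, depending only on $n$, such that the following holds. Let $f=\sum_{j=1}^n f_j\,d\bar z_j$ be a $(0,1)$-form with $L^\infty(\Delta^n)$ coefficients that is $\bar\partial$-closed, i.e. $\partial f_j/\partial\bar z_k=\partial f_k/\partial\bar z_j$ for all $j,k$ in the sense of distributions on $\Delta^n$. Then $\bar\partial u=f$ has a canonical solution on $\Delta^n$, that is, a function $u\in L^2(\Delta^n)$, unique up to equality almost everywhere, such that $\partial u/\partial\bar z_j=f_j$ for all $j$ in the sense of distributions and $\int_{\Delta^n}u\,\overline g\,dV=0$ for every holomorphic $g\in L^2(\Delta^n)$; and it satisfies $$\|u\|_{L^\infty(\Delta^n)}\le C\,\|f\|_{L^\infty(\Delta^n)},$$ where $\|f\|_{L^\infty(\Delta^n)}$ is the essential supremum of $|f(z)|=\big(\sum_{j=1}^n|f_j(z)|^2\big)^{1/2}$. In particular, every bounded $\bar\partial$-closed $(0,1)$-form on $\Delta^n$ admits a bounded solution of $\bar\partial u=f$ (Kerzman's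 question). -/

import Mathlib

open MeasureTheory Set
open scoped ENNReal NNReal ContDiff ComplexConjugate

noncomputable section

/-- The open unit polydisc in `ℂⁿ`, the product of `n` copies of the open unit disc. -/
def polydisc (n : ℕ) : Set (Fin n → ℂ) :=
  {z | ∀ j, ‖z j‖ < 1}

/-- The Wirtinger derivative `∂φ/∂z̄ⱼ = (∂φ/∂xⱼ + i ∂φ/∂yⱼ) / 2`, where `zⱼ = xⱼ + i yⱼ`. -/
def wirtingerBar {n : ℕ} (j : Fin n) (φ : (Fin n → ℂ) → ℂ) (z : Fin n → ℂ) : ℂ :=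
  (1 / 2 : ℂ) *
    (fderiv ℝ φ z (Pi.single j 1) + Complex.I * fderiv ℝ φ z (Pi.single j Complex.I))

/-- Complex-valued test functions on `Ω`: smooth (in the real sense) with compact support
contained in `Ω`. -/
structure IsTestFunction {n : ℕ} (Ω : Set (Fin n → ℂ)) (φ : (Fin n → ℂ) → ℂ) : Prop where
  smooth : ContDiff ℝ ∞ φ
  compactSupport : HasCompactSupport φ
  tsupport_subset : tsupport φ ⊆ Ω

/-- A `(0,1)`-form `f = ∑ⱼ fⱼ dz̄ⱼ` is given by its coefficients `fⱼ`, with the Euclidean pointwise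
norm `|f|² = ∑ⱼ |fⱼ|²`. It is `∂̄`-closed on `Ω` if `∂fⱼ/∂z̄ₖ = ∂fₖ/∂z̄ⱼ` for all `j`, `k`, in the
sense of distributions. -/
def IsDbarClosed {n : ℕ} (Ω : Set (Fin n → ℂ))
    (f : (Fin n → ℂ) → EuclideanSpace ℂ (Fin n)) : Prop :=
  ∀ j k : Fin n, ∀ φ : (Fin n → ℂ) → ℂ, IsTestFunction Ω φ →
    ∫ z in Ω, f z j * wirtingerBar k φ z = ∫ z in Ω, f z k * wirtingerBar j φ z

/-- `∂̄u = f` on `Ω`, i.e. `∂u/∂z̄ⱼ = fⱼ` for all `j`, in the sense of distributions. -/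
def IsDbarSolution {n : ℕ} (Ω : Set (Fin n → ℂ))
    (f : (Fin n → ℂ) → EuclideanSpace ℂ (Fin n)) (u : (Fin n → ℂ) → ℂ) : Prop :=
  ∀ j : Fin n, ∀ φ : (Fin n → ℂ) → ℂ, IsTestFunction Ω φ →
    ∫ z in Ω, u z * wirtingerBar j φ z = -∫ z in Ω, f z j * φ z

/-- `u` represents the canonical solution of `∂̄u = f` on `Ω`: it is a square-integrable solution
that is orthogonal in `L²(Ω)` to all square-integrable holomorphic functions on `Ω`. -/
structure IsCanonicalSolution {n : ℕ} (Ω : Set (Fin n → ℂ))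
    (f : (Fin n → ℂ) → EuclideanSpace ℂ (Fin n)) (u : (Fin n → ℂ) → ℂ) : Prop where
  memLp : MemLp u 2 (volume.restrict Ω)
  solution : IsDbarSolution Ω f u
  orthogonal : ∀ g : (Fin n → ℂ) → ℂ, DifferentiableOn ℂ g Ω →
    MemLp g 2 (volume.restrict Ω) → ∫ z in Ω, u z * conj (g z) = 0

end

/-! In one variable the canonical solution operator T of the disc is explicit, with kernel (1 -
|w|²) / (π (z - w)(1 - z w̄)). Partial fractions split it into the Cauchy kernel and a term
holomorphic in z, so ∂̄T = 1. A residue computation on circles shows that its range is orthogonal to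
the holomorphic functions.

Let Tᵢ be this operator in the i-th variable. For smooth closed f put u = Σᵢ Tᵢ ∏ₖ (1 - Tₖ∂̄ₖ) fᵢ,
where k runs over the variables after i in a fixed order (`canSol`). Since ∂̄ₖTₖ = 1 and ∂̄ₖ
commutes with the other Tᵢ, the sum telescopes to ∂̄ₖu = fₖ. Orthogonality holds because every
summand lies in the range of some Tᵢ.

Expanding the products, u is a signed sum of terms ∏_{i ∈ p} Tᵢ applied to an iterated derivative
which, by closedness, equals ∂̄^{p∖j} fⱼ for every choice of j ∈ p. These derivatives must be
integrated by parts away, but a derivative of the kernel has size 1/|z - w|², just short of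
integrable. The remedy is to regularize the kernel at scale ε. Differentiating then costs ε^(-τ),
for τ as small as desired, whereas passing from one scale to a finer one in a single variable j
gains ε^(1/2). In the telescoping sum over scales, each difference is supported by one variable j;
that variable keeps fⱼ undifferentiated, and the at most n - 1 others are integrated by parts. With
τ = 1/(2n) the gain beats the losses geometrically (`exists_opList_canKernel_le`).

The estimate uses nothing but Schur's test, so it holds verbatim for the sup norm and the L¹ norm
(`IsOpNorm`). A bounded form is approximated by dilating and mollifying. The approximations converge
in L¹ but in general not uniformly: the sup estimate bounds their solutions, and the L¹ estimate
makes them Cauchy.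

Uniqueness needs no regularity theory. The difference of two canonical solutions is weakly
holomorphic, its dilated mollifications are holomorphic and square-integrable, and they converge to
it in L²; orthogonality to them forces it to vanish (`ae_eq_zero_of_weak_holomorphic`). -/

/-! ### One complex variable: the `∂̄` operator on the unit disc -/

/-- The operator `∂/∂w̄` in one complex variable. -/
noncomputable def dbar (F : ℂ → ℂ) (w : ℂ) : ℂ :=
  (1 / 2 : ℂ) * (fderiv ℝ F w 1 + Complex.I * fderiv ℝ F w Complex.I)

/-- `F` is real differentiable at `w` with `∂F/∂w̄ = d`. -/
def HasDbarAt (F : ℂ → ℂ) (d w : ℂ) : Prop :=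
  ∃ L : ℂ →L[ℝ] ℂ, HasFDerivAt F L w ∧ (1 / 2 : ℂ) * (L 1 + Complex.I * L Complex.I) = d

namespace HasDbarAt

variable {F G : ℂ → ℂ} {d e w : ℂ}

theorem dbar_eq (h : HasDbarAt F d w) : dbar F w = d := by
  obtain ⟨L, hL, rfl⟩ := h
  rw [dbar, hL.fderiv]

theorem of_differentiableAt (h : DifferentiableAt ℝ F w) : HasDbarAt F (dbar F w) w :=
  ⟨_, h.hasFDerivAt, rfl⟩

theorem of_holomorphic (h : DifferentiableAt ℂ F w) : HasDbarAt F 0 w := by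
  refine ⟨_, h.hasFDerivAt.restrictScalars ℝ, ?_⟩
  have : fderiv ℂ F w Complex.I = Complex.I * fderiv ℂ F w 1 := by
    rw [← smul_eq_mul, ← map_smul]; simp
  simp only [ContinuousLinearMap.coe_restrictScalars']
  rw [this, ← mul_assoc, Complex.I_mul_I]; ring

theorem conj_id : HasDbarAt (fun w => conj w) 1 w := by
  refine ⟨(Complex.conjCLE : ℂ →L[ℝ] ℂ), (Complex.conjCLE : ℂ →L[ℝ] ℂ).hasFDerivAt, ?_⟩
  simp; norm_num

theorem congr_val (h : HasDbarAt F d w) (hd : d = e) : HasDbarAt F e w := hd ▸ h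

theorem add (hF : HasDbarAt F d w) (hG : HasDbarAt G e w) :
    HasDbarAt (fun w => F w + G w) (d + e) w := by
  obtain ⟨L, hL, rfl⟩ := hF
  obtain ⟨M, hM, rfl⟩ := hG
  refine ⟨_, hL.add hM, ?_⟩
  simp; ring

theorem sub (hF : HasDbarAt F d w) (hG : HasDbarAt G e w) :
    HasDbarAt (fun w => F w - G w) (d - e) w := by
  obtain ⟨L, hL, rfl⟩ := hF
  obtain ⟨M, hM, rfl⟩ := hG
  refine ⟨_, hL.sub hM, ?_⟩
  simp; ring

theorem mul (hF : HasDbarAt F d w) (hG : HasDbarAt G e w) :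
    HasDbarAt (fun w => F w * G w) (d * G w + F w * e) w := by
  obtain ⟨L, hL, rfl⟩ := hF
  obtain ⟨M, hM, rfl⟩ := hG
  refine ⟨_, hL.mul hM, ?_⟩
  simp; ring

theorem inv (hF : HasDbarAt F d w) (h : F w ≠ 0) :
    HasDbarAt (fun w => (F w)⁻¹) (-d / F w ^ 2) w := by
  obtain ⟨L, hL, rfl⟩ := hF
  have h1 := (hasDerivAt_inv h).hasFDerivAt.restrictScalars ℝ
  refine ⟨_, h1.comp w hL, ?_⟩
  simp; field_simp; ring

end HasDbarAt

/-- Hypothesis `hp` describes a unit-speed line at distance |c| from the origin, with x = 0 the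
nearest point. It meets the disc in the chord x² < 1 - c², whose endpoints lie on the circle where F
vanishes, so the fundamental theorem of calculus applies. The indicator form is what Fubini
produces. -/
theorem integral_indicator_fderiv_line_eq_zero {F : ℂ → ℂ}
    (hF : ∀ w ∈ Metric.closedBall (0 : ℂ) 1, ContDiffAt ℝ 1 F w)
    (h0 : ∀ w ∈ Metric.sphere (0 : ℂ) 1, F w = 0) (p v : ℂ) (c : ℝ)
    (hp : ∀ x : ℝ, ‖p + x * v‖ ^ 2 = x ^ 2 + c ^ 2) :
    ∫ x : ℝ, (Metric.ball (0 : ℂ) 1).indicator (fun w => fderiv ℝ F w v) (p + x * v) = 0 := by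
  have hmem : ∀ x : ℝ, p + x * v ∈ Metric.ball (0 : ℂ) 1 ↔ x ^ 2 < 1 - c ^ 2 := by
    intro x
    rw [mem_ball_zero_iff, ← sq_lt_one_iff₀ (norm_nonneg _), hp]
    constructor <;> intro h <;> linarith
  rcases le_or_gt (1 - c ^ 2) 0 with hc | hc
  · refine integral_eq_zero_of_ae (.of_forall fun x => ?_)
    simp only
    rw [indicator_of_notMem, Pi.zero_apply]
    rw [hmem]; nlinarith [sq_nonneg x]
  set s := Real.sqrt (1 - c ^ 2) with hs
  have hs2 : s ^ 2 = 1 - c ^ 2 := Real.sq_sqrt hc.le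
  have hspos : 0 < s := Real.sqrt_pos.2 hc
  have hclosed : ∀ x ∈ Icc (-s) s, p + x * v ∈ Metric.closedBall (0 : ℂ) 1 := by
    intro x hx
    rw [mem_closedBall_zero_iff, ← sq_le_one_iff₀ (norm_nonneg _), hp]
    have := abs_le.2 hx
    have := sq_le_sq' (by linarith [hx.1]) hx.2
    linarith
  have hsph : ∀ x : ℝ, x ^ 2 = s ^ 2 → F (p + x * v) = 0 := by
    intro x hx
    apply h0
    rw [mem_sphere_zero_iff_norm, ← sq_eq_sq₀ (norm_nonneg _) zero_le_one, hp, hx, hs2]; ring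
  have key : ∫ x in (-s)..s, fderiv ℝ F (p + x * v) v = F (p + s * v) - F (p + (-s : ℝ) * v) := by
    have hder : ∀ x : ℝ, HasDerivAt (fun x : ℝ => p + x * v) v x := by
      intro x
      have := ((Complex.ofRealCLM.hasDerivAt (x := x)).mul_const v).const_add p
      simpa using this
    apply intervalIntegral.integral_eq_sub_of_hasDerivAt (f := fun x : ℝ => F (p + x * v))
    · intro x hx
      rw [uIcc_of_le (by linarith)] at hx
      exact ((hF _ (hclosed x hx)).differentiableAt (by norm_num)).hasFDerivAt.comp_hasDerivAt x
        (hder x)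
    · apply ContinuousOn.intervalIntegrable
      intro x hx
      rw [uIcc_of_le (by linarith)] at hx
      have h1 : ContinuousAt (fderiv ℝ F) (p + x * v) :=
        ((hF _ (hclosed x hx)).fderiv_right (m := 0) (by norm_num)).continuousAt
      have h2 : ContinuousAt (fun x : ℝ => fderiv ℝ F (p + x * v)) x :=
        ContinuousAt.comp (f := fun x : ℝ => p + x * v) h1 (hder x).continuousAt
      exact (h2.clm_apply continuousAt_const).continuousWithinAt
  rw [hsph s rfl, hsph (-s) (by ring), sub_zero,
    intervalIntegral.integral_of_le (by linarith), integral_Ioc_eq_integral_Ioo,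
    ← integral_indicator measurableSet_Ioo] at key
  refine Eq.trans (integral_congr_ae (.of_forall fun x => ?_)) key
  simp only
  have : x ∈ Ioo (-s) s ↔ x ^ 2 < 1 - c ^ 2 := by
    rw [← hs2, sq_lt_sq, abs_of_pos hspos, abs_lt]; rfl
  by_cases hx : x ^ 2 < 1 - c ^ 2
  · rw [indicator_of_mem ((hmem x).2 hx), indicator_of_mem (this.2 hx)]
  · rw [indicator_of_notMem (fun h => hx ((hmem x).1 h)),
      indicator_of_notMem (fun h => hx (this.1 h))]

/-- A `C¹` function on the closed unit disc vanishing on the unit circle has `∫ ∂̄F = 0`. -/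
theorem integral_dbar_eq_zero {F : ℂ → ℂ}
    (hF : ∀ w ∈ Metric.closedBall (0 : ℂ) 1, ContDiffAt ℝ 1 F w)
    (h0 : ∀ w ∈ Metric.sphere (0 : ℂ) 1, F w = 0) :
    ∫ w in Metric.ball (0 : ℂ) 1, dbar F w = 0 := by
  have hint : ∀ v : ℂ, IntegrableOn (fun w => fderiv ℝ F w v) (Metric.ball (0 : ℂ) 1) := by
    intro v
    refine IntegrableOn.mono_set ?_ Metric.ball_subset_closedBall
    apply ContinuousOn.integrableOn_compact (isCompact_closedBall _ _)
    intro w hw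
    have h1 : ContinuousAt (fderiv ℝ F) w :=
      ((hF _ hw).fderiv_right (m := 0) (by norm_num)).continuousAt
    exact (h1.clm_apply continuousAt_const).continuousWithinAt
  have hmp := Complex.volume_preserving_equiv_real_prod.symm
  have hI : ∀ v : ℂ, Integrable (fun p : ℝ × ℝ => (Metric.ball (0 : ℂ) 1).indicator
      (fun w => fderiv ℝ F w v) (Complex.measurableEquivRealProd.symm p)) := by
    intro v
    have := (integrable_indicator_iff Metric.isOpen_ball.measurableSet).2 (hint v)
    exact (hmp.integrable_comp_emb Complex.measurableEquivRealProd.symm.measurableEmbedding).2 this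
  have heq : ∀ v : ℂ, ∫ w in Metric.ball (0 : ℂ) 1, fderiv ℝ F w v =
      ∫ p : ℝ × ℝ, (Metric.ball (0 : ℂ) 1).indicator
      (fun w => fderiv ℝ F w v) (Complex.measurableEquivRealProd.symm p) := by
    intro v
    rw [← integral_indicator Metric.isOpen_ball.measurableSet]
    exact (hmp.integral_comp Complex.measurableEquivRealProd.symm.measurableEmbedding _).symm
  have hnorm : ∀ x y : ℝ, ‖(⟨x, y⟩ : ℂ)‖ ^ 2 = x ^ 2 + y ^ 2 := by
    intro x y
    rw [Complex.sq_norm, Complex.normSq_mk]; ring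
  have h1 : ∫ w in Metric.ball (0 : ℂ) 1, fderiv ℝ F w 1 = 0 := by
    rw [heq, Measure.volume_eq_prod, integral_prod_symm _ (hI 1)]
    refine integral_eq_zero_of_ae (.of_forall fun y => ?_)
    have e : ∀ x : ℝ, Complex.measurableEquivRealProd.symm (x, y) = (⟨0, y⟩ : ℂ) + x * 1 := by
      intro x; apply Complex.ext <;> simp [Complex.measurableEquivRealProd_symm_apply]
    simp only [e, Pi.zero_apply]
    refine integral_indicator_fderiv_line_eq_zero hF h0 _ _ y ?_
    intro x
    rw [← hnorm x y]; congr 2; apply Complex.ext <;> simp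
  have h2 : ∫ w in Metric.ball (0 : ℂ) 1, fderiv ℝ F w Complex.I = 0 := by
    rw [heq, Measure.volume_eq_prod, integral_prod _ (hI Complex.I)]
    refine integral_eq_zero_of_ae (.of_forall fun y => ?_)
    have e : ∀ x : ℝ, Complex.measurableEquivRealProd.symm (y, x) =
        (⟨y, 0⟩ : ℂ) + x * Complex.I := by
      intro x; apply Complex.ext <;> simp [Complex.measurableEquivRealProd_symm_apply]
    simp only [e, Pi.zero_apply]
    refine integral_indicator_fderiv_line_eq_zero hF h0 _ _ y ?_
    intro x
    rw [add_comm (x ^ 2), ← hnorm y x]; congr 2; apply Complex.ext <;> simp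
  simp only [dbar]
  rw [integral_const_mul, integral_add (hint 1) ((hint Complex.I).const_mul _),
    integral_const_mul, h1, h2]
  simp

theorem dbar_of_notMem_tsupport {F : ℂ → ℂ} {w : ℂ} (h : w ∉ tsupport F) : dbar F w = 0 := by
  rw [dbar, fderiv_of_notMem_tsupport ℝ h]; simp

/-- The Cauchy–Pompeiu formula for compactly supported functions. -/
theorem integral_dbar_div_sub {φ : ℂ → ℂ} (hφ : ContDiff ℝ 1 φ) (hc : HasCompactSupport φ)
    (x : ℂ) : ∫ w, dbar φ w / (w - x) = -Real.pi * φ x := by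
  have hfd : Continuous (fderiv ℝ φ) := hφ.continuous_fderiv (by norm_num)
  set e : ℝ → ℂ := fun θ => Complex.cos θ + Complex.sin θ * Complex.I with he
  have hecont : Continuous e := by fun_prop
  have henorm : ∀ θ, ‖e θ‖ = 1 := fun θ => by
    rw [he]; simp only; rw [← Complex.exp_mul_I, Complex.norm_exp_ofReal_mul_I]
  have hene : ∀ θ, e θ ≠ 0 := fun θ h => by have := henorm θ; simp [h] at this
  obtain ⟨R, hR0, hR⟩ : ∃ R : ℝ, 0 < R ∧ ∀ w, R ≤ ‖w - x‖ → w ∉ tsupport φ := by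
    obtain ⟨R, hR0, hR⟩ := hc.isBounded.subset_ball_lt 0 x
    exact ⟨R, hR0, fun w hw h => by have := hR h; rw [mem_ball_iff_norm] at this; linarith⟩
  have hRd : ∀ w, R ≤ ‖w - x‖ → fderiv ℝ φ w = 0 := fun w hw =>
    fderiv_of_notMem_tsupport ℝ (hR w hw)
  have hnorm : ∀ r θ : ℝ, 0 ≤ r → ‖x + r * e θ - x‖ = r := fun r θ hr => by
    rw [add_sub_cancel_left, norm_mul, henorm, Complex.norm_real, Real.norm_of_nonneg hr, mul_one]
  have hbig : ∀ r θ : ℝ, R ≤ r → fderiv ℝ φ (x + r * e θ) = 0 := fun r θ hr =>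
    hRd _ (by rw [hnorm r θ (hR0.le.trans hr)]; exact hr)
  -- In polar coordinates about x, A is the radial derivative of φ and r·B the angular one. The
  -- Jacobian r cancels the modulus of the denominator, leaving (A + iB)/2. The A-part integrates
  -- along rays to -2πφ(x) and the B-part vanishes on each circle by periodicity.
  set A : ℝ × ℝ → ℂ := fun p => fderiv ℝ φ (x + p.1 * e p.2) (e p.2) with hA
  set B : ℝ × ℝ → ℂ := fun p => fderiv ℝ φ (x + p.1 * e p.2) (Complex.I * e p.2) with hB
  have hAc : Continuous A := by fun_prop
  have hBc : Continuous B := by fun_prop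
  have hint : ∀ C : ℝ × ℝ → ℂ, Continuous C → (∀ p, R ≤ p.1 → C p = 0) →
      IntegrableOn C (Ioi 0 ×ˢ Ioo (-Real.pi) Real.pi) := by
    intro C hC h0
    have h1 : IntegrableOn C (Icc 0 R ×ˢ Icc (-Real.pi) Real.pi) :=
      hC.continuousOn.integrableOn_compact (isCompact_Icc.prod isCompact_Icc)
    refine h1.of_forall_sdiff_eq_zero (measurableSet_Ioi.prod measurableSet_Ioo) ?_
    rintro ⟨r, θ⟩ ⟨⟨h2, h3⟩, h4⟩
    apply h0
    by_contra h5
    push Not at h5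
    exact h4 ⟨⟨le_of_lt h2, h5.le⟩, ⟨h3.1.le, h3.2.le⟩⟩
  have hAi := hint A hAc (fun p hp => by simp [hA, hbig _ _ hp])
  have hBi := hint B hBc (fun p hp => by simp [hB, hbig _ _ hp])
  have hder : ∀ θ r : ℝ, HasDerivAt (fun r : ℝ => x + r * e θ) (e θ) r := by
    intro θ r
    simpa using ((Complex.ofRealCLM.hasDerivAt (x := r)).mul_const (e θ)).const_add x
  have hIA : ∫ p in Ioi 0 ×ˢ Ioo (-Real.pi) Real.pi, A p = -(2 * Real.pi) * φ x := by
    rw [Measure.volume_eq_prod] at hAi ⊢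
    rw [← setIntegral_prod_swap, setIntegral_prod]
    rotate_left
    · exact hAi.swap
    have h1 : ∀ θ : ℝ, ∫ r in Ioi 0, A (r, θ) = -φ x := by
      intro θ
      have h2 := integral_Ioi_of_hasDerivAt_of_tendsto (a := 0) (m := 0)
        (f := fun r : ℝ => φ (x + r * e θ)) (f' := fun r => A (r, θ)) ?_ ?_ ?_ ?_
      · simpa using h2
      · exact (hφ.continuous.comp (by fun_prop)).continuousWithinAt
      · intro r hr
        exact ((hφ.differentiable (by norm_num)) _).hasFDerivAt.comp_hasDerivAt r (hder θ r)
      · have h3 : IntegrableOn (fun r => A (r, θ)) (Icc 0 R) :=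
          (by fun_prop : Continuous fun r => A (r, θ)).continuousOn.integrableOn_compact isCompact_Icc
        refine h3.of_forall_sdiff_eq_zero measurableSet_Ioi ?_
        rintro r ⟨hr, hr'⟩
        have : R ≤ r := by
          by_contra h5; push Not at h5; exact hr' ⟨le_of_lt hr, h5.le⟩
        simp [hA, hbig _ _ this]
      · apply tendsto_const_nhds.congr'
        filter_upwards [Filter.eventually_ge_atTop R] with r hr
        exact (image_eq_zero_of_notMem_tsupport (hR _ (by
          rw [hnorm r θ (hR0.le.trans hr)]; exact hr))).symm
    simp only [Prod.swap_prod_mk, h1]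
    simp; ring_nf
    rw [max_eq_left (by positivity)]; push_cast; simp
  have hIB : ∫ p in Ioi 0 ×ˢ Ioo (-Real.pi) Real.pi, B p = 0 := by
    rw [Measure.volume_eq_prod] at hBi ⊢
    rw [setIntegral_prod _ hBi]
    rw [← integral_zero ℝ ℂ (μ := volume.restrict (Ioi 0))]
    refine setIntegral_congr_fun measurableSet_Ioi ?_
    intro r hr
    have hr' : (r : ℂ) ≠ 0 := by exact_mod_cast (ne_of_gt hr)
    have hed : ∀ θ : ℝ, HasDerivAt e (Complex.I * e θ) θ := by
      intro θ
      have h1 := (Complex.hasDerivAt_cos (θ : ℂ)).comp_ofReal.add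
        ((Complex.hasDerivAt_sin (θ : ℂ)).comp_ofReal.mul_const Complex.I)
      refine h1.congr_deriv ?_
      rw [he]
      linear_combination (-Complex.sin θ) * Complex.I_mul_I
    have h2 : ∫ θ in (-Real.pi)..Real.pi, r * B (r, θ) =
        φ (x + r * e Real.pi) - φ (x + r * e (-Real.pi)) := by
      apply intervalIntegral.integral_eq_sub_of_hasDerivAt
        (f := fun θ => φ (x + r * e θ))
      · intro θ _
        have h3 := ((hφ.differentiable (by norm_num)) (x + r * e θ)).hasFDerivAt.comp_hasDerivAt θ
          (((hed θ).const_mul (r : ℂ)).const_add x)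
        refine h3.congr_deriv ?_
        simp only [hB]
        rw [← Complex.real_smul, ← Complex.real_smul, map_smul]
        exact Complex.real_smul
      · apply Continuous.intervalIntegrable
        fun_prop
    have h4 : e Real.pi = e (-Real.pi) := by simp [he]
    rw [h4, sub_self, intervalIntegral.integral_const_mul, mul_eq_zero] at h2
    have h5 := h2.resolve_left hr'
    rw [intervalIntegral.integral_of_le (by linarith [Real.pi_pos]),
      integral_Ioc_eq_integral_Ioo] at h5
    exact h5
  have hshift : ∫ w, dbar φ w / (w - x) = ∫ v, dbar φ (x + v) / v := by
    rw [← integral_add_left_eq_self _ x]; simp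
  rw [hshift, ← Complex.integral_comp_polarCoord_symm]
  have hcongr : ∫ p in polarCoord.target, p.1 • (dbar φ (x + Complex.polarCoord.symm p) /
      Complex.polarCoord.symm p) = ∫ p in Ioi 0 ×ˢ Ioo (-Real.pi) Real.pi,
        (1 / 2 : ℂ) * (A p + Complex.I * B p) := by
    rw [polarCoord_target]
    refine setIntegral_congr_fun (measurableSet_Ioi.prod measurableSet_Ioo) ?_
    rintro ⟨r, θ⟩ ⟨hr, -⟩
    have hr' : (r : ℂ) ≠ 0 := by exact_mod_cast (ne_of_gt hr)
    have h1 : Complex.polarCoord.symm (r, θ) = r * e θ := by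
      rw [Complex.polarCoord_symm_apply, he]; simp
    -- Rotating the frame (1, i) by θ multiplies L 1 + i L i by e^(-iθ), which is exactly the phase
    -- of 1/v.
    have h2 : ∀ L : ℂ →L[ℝ] ℂ, L (e θ) + Complex.I * L (Complex.I * e θ) =
        (Complex.cos θ - Complex.sin θ * Complex.I) * (L 1 + Complex.I * L Complex.I) := by
      intro L
      have e1 : e θ = (Real.cos θ) • (1 : ℂ) + (Real.sin θ) • Complex.I := by
        rw [he]; simp
      have e2 : Complex.I * e θ = (-Real.sin θ) • (1 : ℂ) + (Real.cos θ) • Complex.I := by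
        rw [he]; simp; ring_nf; simp; ring
      rw [e2, e1, map_add, map_add, map_smul, map_smul, map_smul, map_smul]
      simp only [Complex.real_smul]
      push_cast
      linear_combination (Complex.sin θ * L Complex.I) * (Complex.I_mul_I)
    have h3 : (e θ)⁻¹ = Complex.cos θ - Complex.sin θ * Complex.I := by
      rw [inv_eq_iff_eq_inv, eq_comm, inv_eq_iff_eq_inv, eq_comm]
      apply inv_eq_of_mul_eq_one_right
      rw [he]
      linear_combination Complex.sin_sq_add_cos_sq (θ : ℂ) - Complex.sin θ ^ 2 * Complex.I_mul_I
    simp only [h1, hA, hB, h2, dbar, Complex.real_smul]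
    rw [← h3]
    have := hene θ
    field_simp
  rw [hcongr, integral_const_mul, integral_add hAi (hBi.const_mul _), integral_const_mul, hIA, hIB]
  ring

/-! ### The kernel of the canonical solution operator on the unit disc -/

/-- The kernel `(1 - |w|²) / (π (z - w) (1 - z w̄))` of the canonical solution operator of the
unit disc, with `1 / (z - w)` regularized to `conj (z - w) / (|z - w|² + ε²)`. -/
noncomputable def regKernel (ε : ℝ) (z w : ℂ) : ℂ :=
  (Real.pi : ℂ)⁻¹ * ((1 - w * conj w) * (1 - z * conj w)⁻¹ *
    (conj (z - w) * ((z - w) * conj (z - w) + (ε : ℂ) ^ 2)⁻¹))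

/-- The kernel `-∂/∂w̄` of `regKernel ε z w`. -/
noncomputable def regKernelDeriv (ε : ℝ) (z w : ℂ) : ℂ :=
  (Real.pi : ℂ)⁻¹ * ((1 - w * conj w) * (1 - z * conj w)⁻¹ *
      ((ε : ℂ) ^ 2 * (((z - w) * conj (z - w) + (ε : ℂ) ^ 2)⁻¹) ^ 2) -
    (z - w) * conj (z - w) * ((1 - z * conj w)⁻¹) ^ 2 *
      ((z - w) * conj (z - w) + (ε : ℂ) ^ 2)⁻¹)

/-! ### Pointwise bounds for the regularized kernels -/

theorem one_sub_mul_conj_ne_zero {z w : ℂ} (hz : ‖z‖ < 1) (hw : ‖w‖ ≤ 1) :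
    1 - z * conj w ≠ 0 := by
  intro h
  have h1 : ‖z * conj w‖ = 1 := by rw [← sub_eq_zero.1 h]; simp
  rw [norm_mul, RCLike.norm_conj] at h1
  nlinarith [norm_nonneg z, norm_nonneg w]

theorem sub_mul_conj_add_sq (ε : ℝ) (z w : ℂ) :
    (z - w) * conj (z - w) + (ε : ℂ) ^ 2 = ((‖z - w‖ ^ 2 + ε ^ 2 : ℝ) : ℂ) := by
  rw [Complex.mul_conj, Complex.normSq_eq_norm_sq]; push_cast; ring

theorem sub_mul_conj_add_sq_ne_zero {ε : ℝ} (hε : 0 < ε) (z w : ℂ) :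
    (z - w) * conj (z - w) + (ε : ℂ) ^ 2 ≠ 0 := by
  rw [sub_mul_conj_add_sq]
  exact_mod_cast (by positivity : ‖z - w‖ ^ 2 + ε ^ 2 ≠ 0)

/-- This follows from |1 - z w̄|² = |z - w|² + (1 - |z|²)(1 - |w|²). It absorbs the factor (1 - z
w̄)⁻² that appears when the kernel is differentiated. -/
theorem norm_sub_le_norm_one_sub_mul_conj {z w : ℂ} (hz : ‖z‖ < 1) (hw : ‖w‖ < 1) :
    ‖z - w‖ ≤ ‖1 - z * conj w‖ := by
  rw [← sq_le_sq₀ (norm_nonneg _) (norm_nonneg _)]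
  have h : ‖1 - z * conj w‖ ^ 2 = ‖z - w‖ ^ 2 + (1 - ‖z‖ ^ 2) * (1 - ‖w‖ ^ 2) := by
    simp only [Complex.sq_norm, Complex.normSq_apply]
    simp; ring
  rw [h]
  have h1 : ‖z‖ ^ 2 < 1 := by nlinarith [norm_nonneg z]
  have h2 : ‖w‖ ^ 2 < 1 := by nlinarith [norm_nonneg w]
  nlinarith [mul_pos (sub_pos.2 h1) (sub_pos.2 h2)]

/-- The denominator is at least 1 - |w|, which leaves 1 + |w|. Thus the reflected pole costs only a
constant, up to the boundary. -/
theorem norm_one_sub_mul_conj_mul_inv_le {z w : ℂ} (hz : ‖z‖ < 1) (hw : ‖w‖ < 1) :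
    ‖(1 - w * conj w) * (1 - z * conj w)⁻¹‖ ≤ 2 := by
  have h1 : ‖1 - w * conj w‖ = 1 - ‖w‖ ^ 2 := by
    rw [Complex.mul_conj, Complex.normSq_eq_norm_sq, ← Complex.ofReal_one, ← Complex.ofReal_sub,
      Complex.norm_real, Real.norm_of_nonneg]
    nlinarith [norm_nonneg w]
  have h2 : 1 - ‖w‖ ≤ ‖1 - z * conj w‖ := by
    have := norm_sub_norm_le (1 : ℂ) (z * conj w)
    rw [norm_mul, RCLike.norm_conj, norm_one] at this
    nlinarith [norm_nonneg z, norm_nonneg w]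
  rw [norm_mul, norm_inv, h1, ← div_eq_mul_inv, div_le_iff₀ (by linarith)]
  nlinarith [norm_nonneg w]

theorem norm_inv_pi_le : ‖(Real.pi : ℂ)⁻¹‖ ≤ 1 / 3 := by
  rw [norm_inv, Complex.norm_real, Real.norm_of_nonneg Real.pi_pos.le, one_div]
  exact inv_anti₀ (by norm_num) Real.pi_gt_three.le

theorem norm_regKernel_le {z w : ℂ} (hz : ‖z‖ < 1) (hw : ‖w‖ < 1) (ε : ℝ) :
    ‖regKernel ε z w‖ ≤ ‖z - w‖⁻¹ := by
  rcases eq_or_ne z w with rfl | hne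
  · simp [regKernel]
  have ht : 0 < ‖z - w‖ := norm_pos_iff.2 (sub_ne_zero.2 hne)
  have h1 : ‖conj (z - w) * ((z - w) * conj (z - w) + (ε : ℂ) ^ 2)⁻¹‖ ≤ ‖z - w‖⁻¹ := by
    rw [norm_mul, norm_inv, sub_mul_conj_add_sq, Complex.norm_real, RCLike.norm_conj,
      Real.norm_of_nonneg (by positivity), ← div_eq_mul_inv, div_le_iff₀ (by positivity)]
    field_simp
    nlinarith [sq_nonneg ε]
  rw [regKernel, norm_mul, norm_mul]
  have h2 := norm_one_sub_mul_conj_mul_inv_le hz hw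
  calc _ ≤ 1 / 3 * (2 * ‖z - w‖⁻¹) := by
        gcongr
        exact norm_inv_pi_le
    _ ≤ ‖z - w‖⁻¹ := by linarith [inv_pos.2 ht]

/-- Weighted arithmetic–geometric mean. It exchanges powers of the scale ε for powers of the
distance t, and both the gain and the loss exponents come from it. -/
theorem rpow_mul_rpow_le_sq_add_sq {ε t τ : ℝ} (hε : 0 ≤ ε) (ht : 0 ≤ t) (hτ : 0 ≤ τ)
    (hτ' : τ ≤ 2) : ε ^ τ * t ^ (2 - τ) ≤ t ^ 2 + ε ^ 2 := by
  have h := Real.geom_mean_le_arith_mean2_weighted (w₁ := τ / 2) (w₂ := 1 - τ / 2) (by linarith)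
    (by linarith) (sq_nonneg ε) (sq_nonneg t) (by ring)
  rw [← Real.rpow_natCast_mul hε, ← Real.rpow_natCast_mul ht] at h
  have e1 : ((2 : ℕ) : ℝ) * (τ / 2) = τ := by push_cast; ring
  have e2 : ((2 : ℕ) : ℝ) * (1 - τ / 2) = 2 - τ := by push_cast; ring
  rw [e1, e2] at h
  nlinarith [sq_nonneg ε, sq_nonneg t]

/-- The difference is of size ε² / (t (t² + ε²)) with t = |z - w|, and interpolation with τ = 3/2
turns this into a gain ε^(1/2) against the still integrable singularity t^(-3/2). The case ε' = 0
compares with the canonical kernel itself. -/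
theorem norm_regKernel_sub_le {z w : ℂ} (hz : ‖z‖ < 1) (hw : ‖w‖ < 1) (hne : z ≠ w)
    {ε ε' : ℝ} (h0 : 0 ≤ ε') (h : ε' ≤ ε) :
    ‖regKernel ε z w - regKernel ε' z w‖ ≤ ε ^ (1 / 2 : ℝ) * ‖z - w‖ ^ (-(3 / 2) : ℝ) := by
  have ht : 0 < ‖z - w‖ := norm_pos_iff.2 (sub_ne_zero.2 hne)
  set t := ‖z - w‖ with htdef
  rcases (h0.trans h).eq_or_lt with he | hε
  · have : ε' = 0 := by linarith
    subst this; subst he; simp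
  have e1 : regKernel ε z w - regKernel ε' z w = (Real.pi : ℂ)⁻¹ * ((1 - w * conj w) *
      (1 - z * conj w)⁻¹ * (conj (z - w) *
        (((t ^ 2 + ε ^ 2)⁻¹ - (t ^ 2 + ε' ^ 2)⁻¹ : ℝ) : ℂ))) := by
    rw [regKernel, regKernel, sub_mul_conj_add_sq, sub_mul_conj_add_sq]
    push_cast; ring
  have e2 : |(t ^ 2 + ε ^ 2)⁻¹ - (t ^ 2 + ε' ^ 2)⁻¹| ≤ ε ^ 2 / (t ^ 2 * (t ^ 2 + ε ^ 2)) := by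
    rw [abs_sub_comm, abs_of_nonneg (sub_nonneg.2 (inv_anti₀ (by positivity) (by gcongr)))]
    have : (t ^ 2 + ε' ^ 2)⁻¹ ≤ (t ^ 2)⁻¹ := inv_anti₀ (by positivity) (by nlinarith)
    calc _ ≤ (t ^ 2)⁻¹ - (t ^ 2 + ε ^ 2)⁻¹ := by linarith
      _ = _ := by field_simp; ring
  have e3 : ε ^ 2 / (t * (t ^ 2 + ε ^ 2)) ≤ ε ^ (1 / 2 : ℝ) * t ^ (-(3 / 2) : ℝ) := by
    have h1 := rpow_mul_rpow_le_sq_add_sq (τ := 3 / 2) hε.le ht.le (by norm_num) (by norm_num)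
    rw [div_le_iff₀ (by positivity)]
    calc ε ^ 2 = (ε ^ (1 / 2 : ℝ) * t ^ (-(3 / 2) : ℝ)) *
          (t * (ε ^ (3 / 2 : ℝ) * t ^ (2 - 3 / 2 : ℝ))) := by
          have a1 : ε ^ (1 / 2 : ℝ) * ε ^ (3 / 2 : ℝ) = ε ^ 2 := by
            rw [← Real.rpow_add hε]; norm_num
          have a2 : t ^ (-(3 / 2) : ℝ) * (t * t ^ (2 - 3 / 2 : ℝ)) = 1 := by
            nth_rewrite 2 [← Real.rpow_one t]
            rw [← Real.rpow_add ht, ← Real.rpow_add ht]; norm_num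
          calc ε ^ 2 = (ε ^ (1 / 2 : ℝ) * ε ^ (3 / 2 : ℝ)) * 
                (t ^ (-(3 / 2) : ℝ) * (t * t ^ (2 - 3 / 2 : ℝ))) := by rw [a1, a2, mul_one]
            _ = _ := by ring
      _ ≤ _ := by gcongr
  have h2 := norm_one_sub_mul_conj_mul_inv_le hz hw
  rw [e1, norm_mul, norm_mul, norm_mul _ ((_ : ℝ) : ℂ), Complex.norm_real, RCLike.norm_conj]
  calc _ ≤ 1 / 3 * (2 * (t * (ε ^ 2 / (t ^ 2 * (t ^ 2 + ε ^ 2))))) := by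
        gcongr
        · exact norm_inv_pi_le
        · exact e2
    _ = 2 / 3 * (ε ^ 2 / (t * (t ^ 2 + ε ^ 2))) := by field_simp
    _ ≤ 1 * (ε ^ 2 / (t * (t ^ 2 + ε ^ 2))) := by gcongr; norm_num
    _ ≤ _ := by rw [one_mul]; exact e3

/-- Both terms are controlled by 1 / (t² + ε²), which is not uniformly integrable as ε tends to 0.
Paying ε^(-τ) lowers the singularity to t^(-(2 - τ)). -/
theorem norm_regKernelDeriv_le {z w : ℂ} (hz : ‖z‖ < 1) (hw : ‖w‖ < 1) (hne : z ≠ w)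
    {ε τ : ℝ} (hε : 0 < ε) (hτ : 0 ≤ τ) (hτ' : τ ≤ 2) :
    ‖regKernelDeriv ε z w‖ ≤ ε ^ (-τ) * ‖z - w‖ ^ (-(2 - τ)) := by
  have ht : 0 < ‖z - w‖ := norm_pos_iff.2 (sub_ne_zero.2 hne)
  have hd := norm_sub_le_norm_one_sub_mul_conj hz hw
  have h2 := norm_one_sub_mul_conj_mul_inv_le hz hw
  set t := ‖z - w‖ with htdef
  have hq : ‖((z - w) * conj (z - w) + (ε : ℂ) ^ 2)⁻¹‖ = (t ^ 2 + ε ^ 2)⁻¹ := by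
    rw [sub_mul_conj_add_sq, norm_inv, Complex.norm_real, Real.norm_of_nonneg (by positivity)]
  have a1 : ‖(ε : ℂ) ^ 2 * (((z - w) * conj (z - w) + (ε : ℂ) ^ 2)⁻¹) ^ 2‖ ≤
      (t ^ 2 + ε ^ 2)⁻¹ := by
    rw [norm_mul, norm_pow, norm_pow, hq, Complex.norm_real, Real.norm_of_nonneg hε.le]
    field_simp
    nlinarith [sq_nonneg t]
  have a2 : ‖(z - w) * conj (z - w) * ((1 - z * conj w)⁻¹) ^ 2‖ ≤ 1 := by
    rw [norm_mul, norm_mul, RCLike.norm_conj, norm_pow, norm_inv, ← htdef]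
    have : 0 < ‖1 - z * conj w‖ := ht.trans_le hd
    rw [inv_pow, ← div_eq_mul_inv, div_le_one (by positivity)]
    nlinarith
  rw [regKernelDeriv, norm_mul]
  calc _ ≤ 1 / 3 * (2 * (t ^ 2 + ε ^ 2)⁻¹ + 1 * (t ^ 2 + ε ^ 2)⁻¹) := by
        gcongr
        · exact norm_inv_pi_le
        · refine (norm_sub_le _ _).trans (add_le_add ?_ ?_)
          · rw [norm_mul]; gcongr
          · rw [norm_mul, hq]; gcongr
    _ = (t ^ 2 + ε ^ 2)⁻¹ := by ring
    _ ≤ (ε ^ τ * t ^ (2 - τ))⁻¹ := inv_anti₀ (by positivity)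
        (rpow_mul_rpow_le_sq_add_sq hε.le ht.le hτ hτ')
    _ = _ := by rw [mul_inv, Real.rpow_neg hε.le, Real.rpow_neg ht.le]

/-! ### Differentiating the regularized kernel and integrating by parts -/

theorem contDiff_conj : ContDiff ℝ 1 (fun w : ℂ => conj w) := Complex.conjCLE.contDiff

theorem contDiffAt_regKernel {ε : ℝ} (hε : 0 < ε) {z w : ℂ} (hz : ‖z‖ < 1) (hw : ‖w‖ ≤ 1) :
    ContDiffAt ℝ 1 (regKernel ε z) w := by
  have h1 := one_sub_mul_conj_ne_zero hz hw
  have h2 := sub_mul_conj_add_sq_ne_zero hε z w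
  have hc : ContDiffAt ℝ 1 (fun w : ℂ => conj w) w := contDiff_conj.contDiffAt
  have hd : ContDiffAt ℝ 1 (fun w : ℂ => conj (z - w)) w := by
    simp only [map_sub]; exact contDiffAt_const.sub hc
  exact contDiffAt_const.mul (((contDiffAt_const.sub (contDiffAt_id.mul hc)).mul
    ((contDiffAt_const.sub (contDiffAt_const.mul hc)).inv h1)).mul
    (hd.mul ((((contDiffAt_const.sub contDiffAt_id).mul hd).add contDiffAt_const).inv h2)))

theorem hasDbarAt_regKernel {ε : ℝ} (hε : 0 < ε) {z w : ℂ} (hz : ‖z‖ < 1) (hw : ‖w‖ ≤ 1) :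
    HasDbarAt (regKernel ε z) (-regKernelDeriv ε z w) w := by
  have h1 := one_sub_mul_conj_ne_zero hz hw
  have h2 := sub_mul_conj_add_sq_ne_zero hε z w
  have hk : ∀ c : ℂ, HasDbarAt (fun _ : ℂ => c) 0 w := fun c =>
    .of_holomorphic (differentiableAt_const c)
  have hi : HasDbarAt (fun w : ℂ => w) 0 w := .of_holomorphic differentiableAt_id
  have hc := HasDbarAt.conj_id (w := w)
  have hd : HasDbarAt (fun w : ℂ => conj (z - w)) (-1) w := by
    simp only [map_sub]; exact ((hk (conj z)).sub hc).congr_val (by ring)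
  refine ((hk _).mul ((((hk 1).sub (hi.mul hc)).mul (((hk 1).sub ((hk z).mul hc)).inv h1)).mul
    (hd.mul (((((hk z).sub hi).mul hd).add (hk ((ε : ℂ) ^ 2))).inv h2)))).congr_val ?_
  simp only [regKernelDeriv]
  set q := (z - w) * conj (z - w) + (ε : ℂ) ^ 2 with hq
  set s := conj (z - w)
  have hs : s = conj z - conj w := map_sub _ _ _
  -- Eliminating ε² in favour of q turns the claim into an identity of rational functions.
  have hε2 : (ε : ℂ) ^ 2 = q - (z - w) * s := by rw [hq]; ring
  rw [hε2]
  field_simp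
  ring

theorem continuousAt_regKernelDeriv {ε : ℝ} (hε : 0 < ε) {z w : ℂ} (hz : ‖z‖ < 1)
    (hw : ‖w‖ ≤ 1) : ContinuousAt (regKernelDeriv ε z) w := by
  have h1 := one_sub_mul_conj_ne_zero hz hw
  have h2 := sub_mul_conj_add_sq_ne_zero hε z w
  have hc : ContinuousAt (fun w : ℂ => conj w) w := Complex.continuous_conj.continuousAt
  unfold regKernelDeriv
  have hd : ContinuousAt (fun w : ℂ => conj (z - w)) w := by fun_prop
  fun_prop (disch := assumption)

/-- Integration by parts against the regularized kernel, which vanishes on the unit circle. -/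
theorem integral_regKernel_mul_dbar {ε : ℝ} (hε : 0 < ε) {z : ℂ} (hz : ‖z‖ < 1) {a : ℂ → ℂ}
    (ha : ContDiff ℝ 1 a) :
    ∫ w in Metric.ball (0 : ℂ) 1, regKernel ε z w * dbar a w =
      ∫ w in Metric.ball (0 : ℂ) 1, regKernelDeriv ε z w * a w := by
  have hb : ∀ w ∈ Metric.closedBall (0 : ℂ) 1, ‖w‖ ≤ 1 := fun w hw => by simpa using hw
  have h0 := integral_dbar_eq_zero (F := fun w => regKernel ε z w * a w)
    (fun w hw => (contDiffAt_regKernel hε hz (hb w hw)).mul ha.contDiffAt) (by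
      intro w hw
      have : w * conj w = 1 := by
        rw [Complex.mul_conj, Complex.normSq_eq_norm_sq, mem_sphere_zero_iff_norm.1 hw]; simp
      simp [regKernel, this])
  have hac : Continuous (dbar a) := by
    have := ha.continuous_fderiv (by norm_num)
    unfold dbar; fun_prop
  have e1 : ∀ w ∈ Metric.ball (0 : ℂ) 1, dbar (fun w => regKernel ε z w * a w) w =
      regKernel ε z w * dbar a w - regKernelDeriv ε z w * a w := by
    intro w hw
    rw [((hasDbarAt_regKernel hε hz (hb w (Metric.ball_subset_closedBall hw))).mul
      (.of_differentiableAt (ha.differentiable (by norm_num) w))).dbar_eq]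
    ring
  rw [setIntegral_congr_fun Metric.isOpen_ball.measurableSet e1, integral_sub] at h0
  · exact sub_eq_zero.1 h0
  · refine IntegrableOn.mono_set ?_ Metric.ball_subset_closedBall
    refine ContinuousOn.integrableOn_compact (isCompact_closedBall _ _) fun w hw => ?_
    exact ((contDiffAt_regKernel hε hz (hb w hw)).continuousAt.mul
      hac.continuousAt).continuousWithinAt
  · refine IntegrableOn.mono_set ?_ Metric.ball_subset_closedBall
    refine ContinuousOn.integrableOn_compact (isCompact_closedBall _ _) fun w hw => ?_
    exact ((continuousAt_regKernelDeriv hε hz (hb w hw)).mul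
      ha.continuous.continuousAt).continuousWithinAt

/-- Partial fractions: the Cauchy kernel, responsible for ∂̄T = 1, plus a correction holomorphic in
z, which ∂̄ does not see and which achieves orthogonality. -/
theorem regKernel_zero_eq {z w : ℂ} (hz : ‖z‖ < 1) (hw : ‖w‖ ≤ 1) (hne : z ≠ w) :
    regKernel 0 z w = (Real.pi : ℂ)⁻¹ * (1 / (z - w) + conj w / (1 - z * conj w)) := by
  have h1 := one_sub_mul_conj_ne_zero hz hw
  have h2 : z - w ≠ 0 := sub_ne_zero.2 hne
  have h3 : conj (z - w) ≠ 0 := (map_ne_zero _).2 h2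
  simp only [regKernel]
  congr 1
  simp only [Complex.ofReal_zero, ne_eq, OfNat.ofNat_ne_zero, not_false_eq_true, zero_pow, add_zero]
  generalize conj (z - w) = s at h3 ⊢
  generalize conj w = v at h1 ⊢
  have h4 : 1 - v * z ≠ 0 := by rwa [mul_comm]
  field_simp
  ring

/-! ### Test functions on the disc and the kernel as a fundamental solution -/

theorem integrableOn_norm_rpow_ball {α : ℝ} (hα : α < 2) (R : ℝ) :
    IntegrableOn (fun ζ : ℂ => ‖ζ‖ ^ (-α)) (Metric.ball 0 R) := by
  rw [integrableOn_fun_norm_addHaar volume (f := fun t => t ^ (-α)), Complex.finrank_real_complex]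
  rcases le_or_gt R 0 with h | h
  · simp [Ioo_eq_empty_of_le h]
  have h1 : IntervalIntegrable (fun y : ℝ => y ^ (1 - α)) volume 0 R :=
    intervalIntegral.intervalIntegrable_rpow' (by linarith)
  rw [intervalIntegrable_iff_integrableOn_Ioo_of_le h.le] at h1
  refine h1.congr_fun (fun y hy => ?_) measurableSet_Ioo
  simp only [Nat.add_one_sub_one, pow_one, smul_eq_mul]
  rw [sub_eq_add_neg, Real.rpow_add hy.1, Real.rpow_one]

theorem integrableOn_inv_norm_sub_ball (x : ℂ) (R : ℝ) :
    IntegrableOn (fun w : ℂ => ‖w - x‖⁻¹) (Metric.ball 0 R) := by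
  have h1 := integrableOn_norm_rpow_ball (α := 1) (by norm_num) (R + ‖x‖)
  rw [← integrable_indicator_iff Metric.isOpen_ball.measurableSet] at h1
  have h2 := (h1.comp_sub_right x).integrableOn (s := Metric.ball 0 R)
  refine h2.congr_fun (fun w hw => ?_) Metric.isOpen_ball.measurableSet
  simp only
  rw [indicator_of_mem, Real.rpow_neg_one]
  rw [mem_ball_zero_iff] at hw ⊢
  exact (norm_sub_le _ _).trans_lt (by linarith)

/-- Smooth functions of one variable with compact support in the unit disc. -/
structure IsDiscTest (ψ : ℂ → ℂ) : Prop where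
  smooth : ContDiff ℝ ∞ ψ
  tsupport_subset : tsupport ψ ⊆ Metric.ball (0 : ℂ) 1

theorem IsDiscTest.hasCompactSupport {ψ : ℂ → ℂ} (h : IsDiscTest ψ) : HasCompactSupport ψ :=
  (isCompact_closedBall (0 : ℂ) 1).of_isClosed_subset (isClosed_tsupport ψ)
    (h.tsupport_subset.trans Metric.ball_subset_closedBall)

theorem IsDiscTest.apply_eq_zero {ψ : ℂ → ℂ} (h : IsDiscTest ψ) {w : ℂ}
    (hw : w ∉ Metric.ball (0 : ℂ) 1) : ψ w = 0 :=
  image_eq_zero_of_notMem_tsupport fun h' => hw (h.tsupport_subset h')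

theorem IsDiscTest.continuous_dbar {ψ : ℂ → ℂ} (h : IsDiscTest ψ) : Continuous (dbar ψ) := by
  have := h.smooth.continuous_fderiv (by norm_num)
  unfold dbar; fun_prop

theorem IsDiscTest.integral_mul_dbar {ψ : ℂ → ℂ} (h : IsDiscTest ψ) {a : ℂ → ℂ}
    (ha : ∀ w ∈ Metric.closedBall (0 : ℂ) 1, ContDiffAt ℝ 1 a w) :
    ∫ w in Metric.ball (0 : ℂ) 1, a w * dbar ψ w =
      -∫ w in Metric.ball (0 : ℂ) 1, dbar a w * ψ w := by
  have hψ : ContDiff ℝ 1 ψ := h.smooth.of_le (by norm_cast)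
  have h0 := integral_dbar_eq_zero (F := fun w => a w * ψ w)
    (fun w hw => (ha w hw).mul hψ.contDiffAt) (by
      intro w hw
      rw [h.apply_eq_zero, mul_zero]
      rw [mem_ball_zero_iff, mem_sphere_zero_iff_norm.1 hw]; simp)
  have e1 : ∀ w ∈ Metric.ball (0 : ℂ) 1, dbar (fun w => a w * ψ w) w =
      a w * dbar ψ w + dbar a w * ψ w := by
    intro w hw
    rw [((HasDbarAt.of_differentiableAt ((ha w
      (Metric.ball_subset_closedBall hw)).differentiableAt (by norm_num))).mul
      (.of_differentiableAt (hψ.differentiable (by norm_num) w))).dbar_eq]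
    ring
  rw [setIntegral_congr_fun Metric.isOpen_ball.measurableSet e1, integral_add] at h0
  · exact eq_neg_of_add_eq_zero_left h0
  · refine IntegrableOn.mono_set ?_ Metric.ball_subset_closedBall
    refine ContinuousOn.integrableOn_compact (isCompact_closedBall _ _) fun w hw => ?_
    exact ((ha w hw).continuousAt.mul h.continuous_dbar.continuousAt).continuousWithinAt
  · refine IntegrableOn.mono_set ?_ Metric.ball_subset_closedBall
    refine ContinuousOn.integrableOn_compact (isCompact_closedBall _ _) fun w hw => ?_
    have h1 : ContinuousAt (fderiv ℝ a) w :=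
      ((ha _ hw).fderiv_right (m := 0) (by norm_num)).continuousAt
    have h2 : ContinuousAt (dbar a) w := by unfold dbar; fun_prop
    exact (h2.mul hψ.continuous.continuousAt).continuousWithinAt

/-- The weak form of ∂̄K(·, x) = δₓ; the derivative falls on the first variable of the kernel. The
Cauchy part is the Cauchy–Pompeiu formula, and the correction, holomorphic near the closed disc,
disappears after integration by parts. -/
theorem IsDiscTest.integral_regKernel_mul_dbar {ψ : ℂ → ℂ} (h : IsDiscTest ψ) {x : ℂ}
    (hx : ‖x‖ < 1) :
    ∫ w in Metric.ball (0 : ℂ) 1, regKernel 0 w x * dbar ψ w = -ψ x := by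
  have hb : ∀ w ∈ Metric.closedBall (0 : ℂ) 1, ‖w‖ ≤ 1 := fun w hw => by simpa using hw
  have hne : ∀ w ∈ Metric.closedBall (0 : ℂ) 1, 1 - w * conj x ≠ 0 := by
    intro w hw h'
    apply one_sub_mul_conj_ne_zero hx (hb w hw)
    have := congrArg conj h'
    simpa [mul_comm] using this
  have hhol : ∀ w ∈ Metric.closedBall (0 : ℂ) 1,
      DifferentiableAt ℂ (fun w => conj x / (1 - w * conj x)) w := by
    intro w hw
    have := hne w hw
    fun_prop (disch := assumption)
  have hcd : ∀ w ∈ Metric.closedBall (0 : ℂ) 1,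
      ContDiffAt ℝ 1 (fun w => conj x / (1 - w * conj x)) w := by
    intro w hw
    simp only [div_eq_mul_inv]
    exact contDiffAt_const.mul
      ((contDiffAt_const.sub (contDiffAt_id.mul contDiffAt_const)).inv (hne w hw))
  have h1 := h.integral_mul_dbar hcd
  have h2 : ∫ w in Metric.ball (0 : ℂ) 1, dbar (fun w => conj x / (1 - w * conj x)) w * ψ w = 0 := by
    refine setIntegral_eq_zero_of_forall_eq_zero fun w hw => ?_
    rw [(HasDbarAt.of_holomorphic (hhol w (Metric.ball_subset_closedBall hw))).dbar_eq, zero_mul]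
  rw [h2, neg_zero] at h1
  have h3 := integral_dbar_div_sub (h.smooth.of_le (by norm_cast)) h.hasCompactSupport x
  have h4 : ∫ w in Metric.ball (0 : ℂ) 1, dbar ψ w / (w - x) = -Real.pi * ψ x := by
    rw [← h3]
    refine setIntegral_eq_integral_of_forall_compl_eq_zero fun w hw => ?_
    rw [dbar_of_notMem_tsupport (fun h' => hw (h.tsupport_subset h')), zero_div]
  have hpi : (Real.pi : ℂ) ≠ 0 := by exact_mod_cast Real.pi_ne_zero
  have h5 : -ψ x = ∫ w in Metric.ball (0 : ℂ) 1, ((Real.pi : ℂ)⁻¹ * (dbar ψ w / (w - x)) +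
      (Real.pi : ℂ)⁻¹ * (conj x / (1 - w * conj x) * dbar ψ w)) := by
    rw [integral_add, integral_const_mul, integral_const_mul, h1, h4]
    · field_simp; ring
    · obtain ⟨M, hM⟩ := (isCompact_closedBall (0 : ℂ) 1).exists_bound_of_continuousOn
        h.continuous_dbar.continuousOn
      refine Integrable.const_mul
        (((integrableOn_inv_norm_sub_ball x 1).const_mul M).mono' ?_ ?_) _
      · exact (h.continuous_dbar.measurable.div
          (measurable_id.sub measurable_const)).aestronglyMeasurable
      · filter_upwards [ae_restrict_mem Metric.isOpen_ball.measurableSet] with w hw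
        rw [div_eq_mul_inv, norm_mul, norm_inv]
        gcongr
        exact hM w (Metric.ball_subset_closedBall hw)
    · refine IntegrableOn.mono_set ?_ Metric.ball_subset_closedBall
      refine ContinuousOn.integrableOn_compact (isCompact_closedBall _ _) fun w hw => ?_
      exact (continuousAt_const.mul ((hcd w hw).continuousAt.mul
        h.continuous_dbar.continuousAt)).continuousWithinAt
  rw [h5]
  refine integral_congr_ae ?_
  filter_upwards [ae_restrict_mem Metric.isOpen_ball.measurableSet,
    ae_restrict_of_ae (Measure.ae_ne volume x)] with w hw hwx
  rw [regKernel_zero_eq (by simpa using hw) hx.le hwx]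
  ring

/-! ### Schur kernels on the disc -/

/-- A kernel on the unit disc whose integrals in either variable are at most `A`. -/
structure IsDiscKernel (A : ℝ≥0) (κ : ℂ → ℂ → ℂ) : Prop where
  measurable : Measurable (Function.uncurry κ)
  left : ∀ w, ∫⁻ z in Metric.ball (0 : ℂ) 1, ‖κ z w‖ₑ ≤ A
  right : ∀ z, ∫⁻ w in Metric.ball (0 : ℂ) 1, ‖κ z w‖ₑ ≤ A

/-- Restriction of a kernel to the product of two discs. -/
noncomputable def discKernel (κ : ℂ → ℂ → ℂ) (z w : ℂ) : ℂ :=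
  (Metric.ball (0 : ℂ) 1 ×ˢ Metric.ball (0 : ℂ) 1).indicator (Function.uncurry κ) (z, w)

theorem discKernel_of_mem {κ : ℂ → ℂ → ℂ} {z w : ℂ} (hz : ‖z‖ < 1) (hw : ‖w‖ < 1) :
    discKernel κ z w = κ z w := by
  rw [discKernel, indicator_of_mem]; · rfl
  simp [hz, hw]

theorem discKernel_of_notMem {κ : ℂ → ℂ → ℂ} {z : ℂ} (hz : ¬ ‖z‖ < 1) (w : ℂ) :
    discKernel κ z w = 0 := by
  rw [discKernel, indicator_of_notMem]
  simp [hz]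

theorem discKernel_of_notMem_right {κ : ℂ → ℂ → ℂ} {w : ℂ} (hz : ¬ ‖w‖ < 1) (z : ℂ) :
    discKernel κ z w = 0 := by
  rw [discKernel, indicator_of_notMem]
  simp [hz]

theorem measurable_discKernel {κ : ℂ → ℂ → ℂ} (h : Measurable (Function.uncurry κ)) :
    Measurable (Function.uncurry (discKernel κ)) :=
  h.indicator (Metric.isOpen_ball.measurableSet.prod Metric.isOpen_ball.measurableSet)

theorem measurable_regKernel (ε : ℝ) : Measurable (Function.uncurry (regKernel ε)) := by
  have hc : Measurable (fun z : ℂ => conj z) := Complex.continuous_conj.measurable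
  unfold regKernel Function.uncurry
  fun_prop

theorem measurable_regKernelDeriv (ε : ℝ) : Measurable (Function.uncurry (regKernelDeriv ε)) := by
  have hc : Measurable (fun z : ℂ => conj z) := Complex.continuous_conj.measurable
  unfold regKernelDeriv Function.uncurry
  fun_prop

/-- Distances in the disc are at most 2, so raising the exponent by at most 1 costs at most a factor
2. This lets a single exponent dominate all the kernels. -/
theorem rpow_neg_le_two_mul_rpow_neg {t s α : ℝ} (ht : 0 < t) (ht2 : t ≤ 2) (hs : 1 ≤ s)
    (hsα : s ≤ α) (hα : α ≤ 2) : t ^ (-s) ≤ 2 * t ^ (-α) := by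
  have h1 : t ^ (α - s) ≤ 2 := by
    calc t ^ (α - s) ≤ 2 ^ (α - s) := Real.rpow_le_rpow ht.le ht2 (by linarith)
      _ ≤ 2 ^ (1 : ℝ) := Real.rpow_le_rpow_of_exponent_le (by norm_num) (by linarith)
      _ = 2 := Real.rpow_one 2
  calc t ^ (-s) = t ^ (α - s) * t ^ (-α) := by rw [← Real.rpow_add ht]; ring_nf
    _ ≤ _ := by gcongr

/-- Domination by the integrable convolution kernel |ζ|^(-α) on |ζ| < 2, whose integral is the same
in both variables by translation invariance. The diagonal is a null set in each slice, so no bound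
is required there. -/
theorem exists_isDiscKernel_of_norm_le {α : ℝ} (hα : α < 2) :
    ∃ B : ℝ≥0, ∀ (c : ℝ≥0) (κ : ℂ → ℂ → ℂ), Measurable (Function.uncurry κ) →
      (∀ z w, ‖z‖ < 1 → ‖w‖ < 1 → z ≠ w → ‖κ z w‖ ≤ c * ‖z - w‖ ^ (-α)) →
      IsDiscKernel (c * B) (discKernel κ) := by
  set b : ℂ → ℝ := (Metric.ball (0 : ℂ) 2).indicator fun ζ => ‖ζ‖ ^ (-α) with hb
  have hbi : Integrable b :=
    (integrable_indicator_iff Metric.isOpen_ball.measurableSet).2 (integrableOn_norm_rpow_ball hα 2)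
  refine ⟨(∫⁻ ζ, ‖b ζ‖ₑ).toNNReal, fun c κ hm h => ?_⟩
  have hB : ((∫⁻ ζ, ‖b ζ‖ₑ).toNNReal : ℝ≥0∞) = ∫⁻ ζ, ‖b ζ‖ₑ :=
    ENNReal.coe_toNNReal hbi.2.ne
  have hle : ∀ z w, z ≠ w → ‖discKernel κ z w‖ₑ ≤ c * ‖b (z - w)‖ₑ := by
    intro z w hne
    by_cases hz : ‖z‖ < 1
    · by_cases hw : ‖w‖ < 1
      · rw [discKernel_of_mem hz hw]
        have : b (z - w) = ‖z - w‖ ^ (-α) := by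
          rw [hb, indicator_of_mem]
          rw [mem_ball_zero_iff]
          exact (norm_sub_le _ _).trans_lt (by linarith)
        rw [this, ← ofReal_norm, Real.enorm_of_nonneg (by positivity),
          ← ENNReal.ofReal_coe_nnreal, ← ENNReal.ofReal_mul c.coe_nonneg]
        exact ENNReal.ofReal_le_ofReal (h z w hz hw hne)
      · simp [discKernel_of_notMem_right hw]
    · simp [discKernel_of_notMem hz]
  refine ⟨measurable_discKernel hm, fun w => ?_, fun z => ?_⟩
  · calc ∫⁻ z in Metric.ball (0 : ℂ) 1, ‖discKernel κ z w‖ₑ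
        ≤ ∫⁻ z, ‖discKernel κ z w‖ₑ := setLIntegral_le_lintegral _ _
      _ ≤ ∫⁻ z, c * ‖b (z - w)‖ₑ := lintegral_mono_ae (by
          filter_upwards [Measure.ae_ne volume w] with z hz using hle z w hz)
      _ = c * ∫⁻ z, ‖b (z - w)‖ₑ := lintegral_const_mul' _ _ ENNReal.coe_ne_top
      _ = _ := by rw [lintegral_sub_right_eq_self (fun z => ‖b z‖ₑ) w, ENNReal.coe_mul, hB]
  · calc ∫⁻ w in Metric.ball (0 : ℂ) 1, ‖discKernel κ z w‖ₑ
        ≤ ∫⁻ w, ‖discKernel κ z w‖ₑ := setLIntegral_le_lintegral _ _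
      _ ≤ ∫⁻ w, c * ‖b (z - w)‖ₑ := lintegral_mono_ae (by
          filter_upwards [Measure.ae_ne volume z] with w hw using hle z w (Ne.symm hw))
      _ = c * ∫⁻ w, ‖b (z - w)‖ₑ := lintegral_const_mul' _ _ ENNReal.coe_ne_top
      _ = _ := by rw [lintegral_sub_left_eq_self (fun z => ‖b z‖ₑ) z, ENNReal.coe_mul, hB]

/-- All three bounds are taken with the exponent α = 2 - τ, so that one constant B serves for every
scale. The condition τ ≤ 1/2 ensures 3/2 ≤ α, as the difference estimate demands. -/
theorem exists_isDiscKernel_regKernel {τ : ℝ} (h0 : 0 < τ) (h1 : τ ≤ 1 / 2) :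
    ∃ B : ℝ≥0, (∀ ε, IsDiscKernel B (discKernel (regKernel ε))) ∧
      (∀ ε ε' : ℝ≥0, ε' ≤ ε → IsDiscKernel (B * ε ^ (1 / 2 : ℝ))
        (fun z w => discKernel (regKernel ε) z w - discKernel (regKernel ε') z w)) ∧
      (∀ ε : ℝ≥0, 0 < ε → IsDiscKernel (B * ε ^ (-τ)) (discKernel (regKernelDeriv ε))) := by
  obtain ⟨B, hB⟩ := exists_isDiscKernel_of_norm_le (α := 2 - τ) (by linarith)
  have hmono : ∀ {A A' : ℝ≥0} {κ : ℂ → ℂ → ℂ}, IsDiscKernel A κ → A ≤ A' → IsDiscKernel A' κ :=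
    fun h h' => ⟨h.1, fun w => (h.2 w).trans (by exact_mod_cast h'),
      fun w => (h.3 w).trans (by exact_mod_cast h')⟩
  have hlt : ∀ {z w : ℂ}, ‖z‖ < 1 → ‖w‖ < 1 → ‖z - w‖ ≤ 2 := fun hz hw =>
    (norm_sub_le _ _).trans (by linarith)
  have hpos : ∀ {z w : ℂ}, z ≠ w → 0 < ‖z - w‖ := fun h => norm_pos_iff.2 (sub_ne_zero.2 h)
  refine ⟨2 * B, fun ε => ?_, fun ε ε' h => ?_, fun ε hε => ?_⟩
  · refine hB 2 _ (measurable_regKernel ε) fun z w hz hw hne => ?_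
    refine (norm_regKernel_le hz hw ε).trans ?_
    rw [← Real.rpow_neg_one]
    exact rpow_neg_le_two_mul_rpow_neg (hpos hne) (hlt hz hw) le_rfl (by linarith) (by linarith)
  · have h2 := hB (2 * ε ^ (1 / 2 : ℝ)) (fun z w => regKernel ε z w - regKernel ε' z w)
      ((measurable_regKernel ε).sub (measurable_regKernel ε')) fun z w hz hw hne => ?_
    · convert h2 using 1
      · ring
      · ext z w
        simp only [discKernel, indicator, Function.uncurry]
        split_ifs <;> simp
    · refine (norm_regKernel_sub_le hz hw hne ε'.2 (by exact_mod_cast h)).trans ?_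
      have h3 := rpow_neg_le_two_mul_rpow_neg (s := 3 / 2) (α := 2 - τ) (hpos hne) (hlt hz hw)
        (by norm_num) (by linarith) (by linarith)
      push_cast
      calc _ ≤ (ε : ℝ) ^ (1 / 2 : ℝ) * (2 * ‖z - w‖ ^ (-(2 - τ))) := by gcongr
        _ = _ := by ring
  · refine hmono (hB (ε ^ (-τ)) _ (measurable_regKernelDeriv ε) fun z w hz hw hne => ?_) ?_
    · exact_mod_cast norm_regKernelDeriv_le hz hw hne (by exact_mod_cast hε) h0.le (by linarith)
    · rw [mul_comm (ε ^ (-τ))]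
      gcongr
      nth_rewrite 1 [← one_mul B]
      gcongr
      norm_num

/-! ### Orthogonality of the kernel to holomorphic functions -/

theorem integral_ball_eq_integral_polar {F : ℂ → ℂ} (hF : IntegrableOn F (Metric.ball 0 1))
    (hm : Measurable ((Metric.ball (0 : ℂ) 1).indicator F)) :
    ∫ w in Metric.ball (0 : ℂ) 1, F w =
      ∫ r in Ioo (0 : ℝ) 1, r * ∫ θ in (0 : ℝ)..(2 * Real.pi), F (circleMap 0 r θ) := by
  set G := (Metric.ball (0 : ℂ) 1).indicator F with hG
  have hGi : Integrable G := (integrable_indicator_iff Metric.isOpen_ball.measurableSet).2 hF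
  have hsymm : ∀ p : ℝ × ℝ, Complex.polarCoord.symm p = circleMap 0 p.1 p.2 := by
    intro p
    rw [Complex.polarCoord_symm_apply, circleMap, zero_add, Complex.exp_mul_I]; simp
  have hint : IntegrableOn (fun p : ℝ × ℝ => p.1 • G (Complex.polarCoord.symm p))
      (Ioi 0 ×ˢ Ioo (-Real.pi) Real.pi) := by
    constructor
    · refine Measurable.aestronglyMeasurable ?_
      have : Measurable fun p : ℝ × ℝ => Complex.polarCoord.symm p := by
        simp only [Complex.polarCoord_symm_apply]
        fun_prop
      exact measurable_fst.smul (hm.comp this)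
    · rw [hasFiniteIntegral_iff_enorm]
      have h1 := Complex.lintegral_comp_polarCoord_symm (fun w => ‖G w‖ₑ)
      rw [polarCoord_target] at h1
      refine lt_of_eq_of_lt ?_ hGi.2
      rw [← h1]
      refine setLIntegral_congr_fun (measurableSet_Ioi.prod measurableSet_Ioo) fun p hp => ?_
      have : (0 : ℝ) < p.1 := hp.1
      simp only [enorm_smul, smul_eq_mul]
      rw [Real.enorm_of_nonneg this.le]
  rw [← integral_indicator Metric.isOpen_ball.measurableSet, ← hG,
    ← Complex.integral_comp_polarCoord_symm, polarCoord_target]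
  rw [Measure.volume_eq_prod] at hint ⊢
  rw [setIntegral_prod _ hint]
  have hsub : Ioo (0 : ℝ) 1 ⊆ Ioi 0 := fun r hr => hr.1
  rw [setIntegral_eq_of_subset_of_forall_sdiff_eq_zero measurableSet_Ioi hsub]
  · refine setIntegral_congr_fun measurableSet_Ioo fun r hr => ?_
    simp only [hsymm]
    rw [integral_smul, Complex.real_smul]
    congr 1
    have hper : Function.Periodic (fun θ => F (circleMap 0 r θ)) (2 * Real.pi) := fun θ => by
      simp only [periodic_circleMap 0 r θ]
    have h2 := hper.intervalIntegral_add_eq (-Real.pi) 0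
    rw [zero_add, show -Real.pi + 2 * Real.pi = Real.pi by ring] at h2
    rw [← h2, intervalIntegral.integral_of_le (by linarith [Real.pi_pos]),
      integral_Ioc_eq_integral_Ioo]
    refine setIntegral_congr_fun measurableSet_Ioo fun θ _ => ?_
    rw [hG, indicator_of_mem]
    rw [mem_ball_zero_iff, norm_circleMap_zero, abs_of_pos hr.1]
    exact hr.2
  · intro r hr
    have h1 : (1 : ℝ) ≤ r := by
      by_contra h; exact hr.2 ⟨hr.1, not_le.1 h⟩
    refine setIntegral_eq_zero_of_forall_eq_zero fun θ _ => ?_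
    simp only [hsymm]
    rw [hG, indicator_of_notMem, smul_zero]
    rw [mem_ball_zero_iff, norm_circleMap_zero, abs_of_pos (by linarith)]
    exact not_lt.2 h1

theorem integral_circleMap_eq_circleIntegral_div (H : ℂ → ℂ) {r : ℝ} (hr : 0 < r) :
    ∫ θ in (0 : ℝ)..(2 * Real.pi), H (circleMap 0 r θ) =
      -Complex.I * ∮ w in C(0, r), H w / w := by
  rw [circleIntegral, ← intervalIntegral.integral_const_mul]
  refine intervalIntegral.integral_congr fun θ _ => ?_
  simp only [deriv_circleMap, smul_eq_mul]
  have := circleMap_ne_center (c := 0) (θ := θ) hr.ne'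
  field_simp
  rw [Complex.I_sq]; ring

/-- On |w| = r one has w̄ = r²/w, so the conjugated kernel becomes rational in w, with poles at r²x
and r²/x̄. The first always lies inside the circle and the second exactly when r < |x|; Cauchy's
formula gives the two values of g. -/
theorem integral_circleMap_regKernel {g : ℂ → ℂ} (hg : DifferentiableOn ℂ g (Metric.ball 0 1))
    {x : ℂ} (hx : ‖x‖ < 1) {r : ℝ} (hr : 0 < r) (hr1 : r < 1) (hrx : r ≠ ‖x‖) :
    ∫ θ in (0 : ℝ)..(2 * Real.pi),
      conj (regKernel 0 (circleMap 0 r θ) x) * g (circleMap 0 r θ) =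
      2 * (x * g (r ^ 2 * x) - if r < ‖x‖ then g (r ^ 2 / conj x) / conj x else 0) := by
  have hsub : Metric.closedBall (0 : ℂ) r ⊆ Metric.ball 0 1 :=
    Metric.closedBall_subset_ball hr1
  have hg' : DifferentiableOn ℂ g (Metric.closedBall 0 r) := hg.mono hsub
  have hr' : (r : ℂ) ≠ 0 := by exact_mod_cast hr.ne'
  have hpi : (Real.pi : ℂ) ≠ 0 := by exact_mod_cast Real.pi_ne_zero
  rw [integral_circleMap_eq_circleIntegral_div (fun w => conj (regKernel 0 w x) * g w) hr]
  have hrx2 : (r : ℂ) ^ 2 * x ∈ Metric.ball (0 : ℂ) r := by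
    rw [mem_ball_zero_iff, norm_mul, norm_pow, Complex.norm_real, Real.norm_of_nonneg hr.le]
    nlinarith [norm_nonneg x, mul_pos hr hr]
  have hsph : ∀ w ∈ Metric.sphere (0 : ℂ) r, w ≠ 0 ∧ conj w = r ^ 2 / w ∧ ‖w‖ = r := by
    intro w hw
    have hn : ‖w‖ = r := mem_sphere_zero_iff_norm.1 hw
    have hw0 : w ≠ 0 := by rw [← norm_pos_iff, hn]; exact hr
    refine ⟨hw0, ?_, hn⟩
    rw [eq_div_iff hw0, mul_comm, Complex.mul_conj, Complex.normSq_eq_norm_sq, hn]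
    push_cast; ring
  have hne1 : ∀ w, ‖w‖ = r → (r : ℂ) ^ 2 - conj x * w ≠ 0 := by
    intro w hw h
    have h1 : ‖conj x * w‖ = r ^ 2 := by
      rw [← sub_eq_zero.1 h, norm_pow, Complex.norm_real, Real.norm_of_nonneg hr.le]
    rw [norm_mul, RCLike.norm_conj, hw] at h1
    apply hrx
    have : r * (r - ‖x‖) = 0 := by linear_combination -h1
    rcases mul_eq_zero.1 this with h2 | h2 <;> linarith
  have hne2 : ∀ w, ‖w‖ = r → w - (r : ℂ) ^ 2 * x ≠ 0 := by
    intro w hw h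
    rw [mem_ball_zero_iff, ← sub_eq_zero.1 h, hw] at hrx2
    exact lt_irrefl _ hrx2
  have hcongr : ∀ w ∈ Metric.sphere (0 : ℂ) r, conj (regKernel 0 w x) * g w / w =
      (Real.pi : ℂ)⁻¹ * (g w / (r ^ 2 - conj x * w) + x * ((w - r ^ 2 * x)⁻¹ • g w)) := by
    intro w hw
    obtain ⟨hw0, hwc, hn⟩ := hsph w hw
    have hwx : w ≠ x := by rintro rfl; exact hrx hn.symm
    have h1 := hne1 w hn
    have h2 := hne2 w hn
    rw [regKernel_zero_eq (by rw [hn]; exact hr1) hx.le hwx]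
    simp only [map_mul, map_add, map_div₀, map_sub, map_one, map_inv₀, Complex.conj_conj,
      Complex.conj_ofReal, hwc, smul_eq_mul]
    have e1 : (r : ℂ) ^ 2 / w - conj x = (r ^ 2 - conj x * w) / w := by field_simp
    have e2 : 1 - (r : ℂ) ^ 2 / w * x = (w - r ^ 2 * x) / w := by field_simp
    rw [e1, e2]
    field_simp
  rw [circleIntegral.integral_congr hr.le hcongr, circleIntegral.integral_const_mul]
  have hgc : ContinuousOn g (Metric.sphere 0 r) :=
    hg'.continuousOn.mono Metric.sphere_subset_closedBall
  rw [circleIntegral.integral_add, circleIntegral.integral_const_mul,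
    hg'.circleIntegral_sub_inv_smul hrx2]
  rotate_left
  · refine ContinuousOn.circleIntegrable hr.le (hgc.div
      ((by fun_prop : Continuous fun w : ℂ => (r : ℂ) ^ 2 - conj x * w).continuousOn) fun w hw => ?_)
    exact hne1 w (mem_sphere_zero_iff_norm.1 hw)
  · refine ContinuousOn.circleIntegrable hr.le (continuousOn_const.mul (ContinuousOn.smul
      (ContinuousOn.inv₀ ((by fun_prop :
      Continuous fun w : ℂ => w - (r : ℂ) ^ 2 * x).continuousOn) fun w hw => ?_) hgc))
    exact hne2 w (mem_sphere_zero_iff_norm.1 hw)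
  have hfirst : ∮ w in C(0, r), g w / (r ^ 2 - conj x * w) =
      (2 * Real.pi * Complex.I) * -(if r < ‖x‖ then g (r ^ 2 / conj x) / conj x else 0) := by
    split_ifs with h
    · have hx0 : conj x ≠ 0 := by
        rw [map_ne_zero, ← norm_pos_iff]; exact hr.trans h
      have hmem : (r : ℂ) ^ 2 / conj x ∈ Metric.ball (0 : ℂ) r := by
        rw [mem_ball_zero_iff, norm_div, norm_pow, Complex.norm_real, Real.norm_of_nonneg hr.le,
          RCLike.norm_conj, div_lt_iff₀ (hr.trans h)]
        nlinarith
      have h3 : ∀ w ∈ Metric.sphere (0 : ℂ) r, g w / (r ^ 2 - conj x * w) =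
          (-(conj x)⁻¹) * ((w - r ^ 2 / conj x)⁻¹ • g w) := by
        intro w hw
        have h1 := hne1 w (mem_sphere_zero_iff_norm.1 hw)
        have e1 : w - (r : ℂ) ^ 2 / conj x = -((r ^ 2 - conj x * w) / conj x) := by
          field_simp; ring
        rw [e1, smul_eq_mul]
        field_simp
      rw [circleIntegral.integral_congr hr.le h3, circleIntegral.integral_const_mul,
        hg'.circleIntegral_sub_inv_smul hmem]
      simp only [smul_eq_mul]
      field_simp
    · have hlt : ‖x‖ < r := lt_of_le_of_ne (not_lt.1 h) (Ne.symm hrx)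
      have h4 : DifferentiableOn ℂ (fun w => g w / (r ^ 2 - conj x * w))
          (Metric.closedBall 0 r) := by
        refine hg'.div (by fun_prop) fun w hw h => ?_
        have h1 : ‖conj x * w‖ = r ^ 2 := by
          rw [← sub_eq_zero.1 h, norm_pow, Complex.norm_real, Real.norm_of_nonneg hr.le]
        rw [norm_mul, RCLike.norm_conj] at h1
        have h2 : ‖w‖ ≤ r := mem_closedBall_zero_iff.1 hw
        nlinarith [norm_nonneg x, norm_nonneg w]
      rw [(h4.mono Metric.closure_ball_subset_closedBall).diffContOnCl.circleIntegral_eq_zero hr.le]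
      simp
  rw [hfirst]
  simp only [smul_eq_mul]
  field_simp
  rw [Complex.I_sq]
  ring

theorem continuousOn_mul_comp_sq {g : ℂ → ℂ} (hg : ContinuousOn g (Metric.ball 0 1)) {c : ℂ}
    {b : ℝ} (h : ∀ r ∈ Icc 0 b, ‖(r : ℂ) ^ 2 * c‖ < 1) :
    ContinuousOn (fun r : ℝ => (r : ℂ) * g (r ^ 2 * c)) (Icc 0 b) := by
  refine ContinuousOn.mul (by fun_prop) (hg.comp (by fun_prop) fun r hr => ?_)
  rw [mem_ball_zero_iff]
  exact h r hr

/-- After integration over circles two radial integrals remain, of r g(r²x) over (0, 1) and of r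
g(r²/x̄) over (0, |x|). The substitution r = |x|s maps r²/x̄ to s²x and makes them cancel. At x = 0
the second interval is empty and the junk value of the inverse is harmless. -/
theorem integral_regKernel_mul_conj_eq_zero {g : ℂ → ℂ}
    (hg : DifferentiableOn ℂ g (Metric.ball 0 1)) {x : ℂ} (hx : ‖x‖ < 1)
    (hint : IntegrableOn (fun w => regKernel 0 w x * conj (g w)) (Metric.ball 0 1)) :
    ∫ w in Metric.ball (0 : ℂ) 1, regKernel 0 w x * conj (g w) = 0 := by
  have hconj : ∀ w, regKernel 0 w x * conj (g w) = conj (conj (regKernel 0 w x) * g w) := by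
    intro w; simp
  have hint' : IntegrableOn (fun w => conj (regKernel 0 w x) * g w) (Metric.ball 0 1) := by
    simp_rw [hconj] at hint
    have := (Complex.conjCLE : ℂ →L[ℝ] ℂ).integrable_comp hint
    simpa [IntegrableOn] using this
  simp_rw [hconj]
  rw [integral_conj, integral_ball_eq_integral_polar hint']
  rotate_left
  · have h1 : (Metric.ball (0 : ℂ) 1).indicator (fun w => conj (regKernel 0 w x) * g w) =
        fun w => conj (regKernel 0 w x) * (Metric.ball (0 : ℂ) 1).indicator g w := by
      ext w; simp only [indicator]; split_ifs <;> simp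
    rw [h1]
    have h2 : Measurable fun w => regKernel 0 w x :=
      Measurable.of_uncurry_right (measurable_regKernel 0)
    have h3 : Measurable ((Metric.ball (0 : ℂ) 1).indicator g) := by
      classical
      rw [← piecewise_eq_indicator]
      exact hg.continuousOn.measurable_piecewise continuousOn_const
        Metric.isOpen_ball.measurableSet
    exact (Complex.continuous_conj.measurable.comp h2).mul h3
  have hae : ∀ᵐ r : ℝ ∂volume.restrict (Ioo (0 : ℝ) 1),
      (r : ℂ) * ∫ θ in (0 : ℝ)..(2 * Real.pi),
        conj (regKernel 0 (circleMap 0 r θ) x) * g (circleMap 0 r θ) =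
      2 * (x * (r * g (r ^ 2 * x)) - (conj x)⁻¹ *
        (Ioo 0 ‖x‖).indicator (fun r : ℝ => r * g (r ^ 2 * (conj x)⁻¹)) r) := by
    filter_upwards [ae_restrict_mem measurableSet_Ioo,
      ae_restrict_of_ae (Measure.ae_ne volume ‖x‖)] with r hr hrx
    rw [integral_circleMap_regKernel hg hx hr.1 hr.2 hrx]
    by_cases h : r < ‖x‖
    · rw [if_pos h, indicator_of_mem (show r ∈ Ioo 0 ‖x‖ from ⟨hr.1, h⟩), div_eq_mul_inv, div_eq_mul_inv]; ring
    · rw [if_neg h, indicator_of_notMem (fun h' => h h'.2)]; ring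
  rw [integral_congr_ae hae]
  have hI1 : ContinuousOn (fun r : ℝ => (r : ℂ) * g (r ^ 2 * x)) (Icc 0 1) := by
    refine continuousOn_mul_comp_sq hg.continuousOn fun r hr => ?_
    rw [norm_mul, norm_pow, Complex.norm_real, Real.norm_of_nonneg hr.1]
    have : r ^ 2 ≤ 1 := pow_le_one₀ hr.1 hr.2
    nlinarith [norm_nonneg x]
  have hI2 : ContinuousOn (fun r : ℝ => (r : ℂ) * g (r ^ 2 * (conj x)⁻¹)) (Icc 0 ‖x‖) := by
    refine continuousOn_mul_comp_sq hg.continuousOn fun r hr => ?_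
    rw [norm_mul, norm_pow, Complex.norm_real, Real.norm_of_nonneg hr.1, norm_inv,
      RCLike.norm_conj]
    rcases (norm_nonneg x).eq_or_lt with h | h
    · rw [← h]; simp
    · rw [← div_eq_mul_inv, div_lt_one h]
      nlinarith [hr.1, hr.2]
  have hi1 : IntegrableOn (fun r : ℝ => (r : ℂ) * g (r ^ 2 * x)) (Ioo 0 1) :=
    (hI1.integrableOn_compact isCompact_Icc).mono_set Ioo_subset_Icc_self
  have hi2 : IntegrableOn (fun r : ℝ => (r : ℂ) * g (r ^ 2 * (conj x)⁻¹)) (Ioo 0 ‖x‖) :=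
    (hI2.integrableOn_compact isCompact_Icc).mono_set Ioo_subset_Icc_self
  have hi2' : IntegrableOn ((Ioo 0 ‖x‖).indicator
      (fun r : ℝ => (r : ℂ) * g (r ^ 2 * (conj x)⁻¹))) (Ioo 0 1) :=
    ((integrable_indicator_iff measurableSet_Ioo).2 hi2).integrableOn
  rw [integral_const_mul, integral_sub (hi1.const_mul _) (hi2'.const_mul _), integral_const_mul,
    integral_const_mul, setIntegral_indicator measurableSet_Ioo,
    inter_eq_right.2 (Ioo_subset_Ioo_right hx.le)]
  have hsubst : ∫ r in Ioo (0 : ℝ) ‖x‖, (r : ℂ) * g (r ^ 2 * (conj x)⁻¹) =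
      ‖x‖ ^ 2 * ∫ r in Ioo (0 : ℝ) 1, (r : ℂ) * g (r ^ 2 * x) := by
    rw [← integral_Ioc_eq_integral_Ioo, ← integral_Ioc_eq_integral_Ioo,
      ← intervalIntegral.integral_of_le (norm_nonneg x),
      ← intervalIntegral.integral_of_le zero_le_one]
    have h1 := intervalIntegral.smul_integral_comp_mul_left (a := 0) (b := 1)
      (fun r : ℝ => (r : ℂ) * g (r ^ 2 * (conj x)⁻¹)) ‖x‖
    rw [mul_zero, mul_one] at h1
    rw [← h1, Complex.real_smul, sq, mul_assoc]
    congr 1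
    rw [← intervalIntegral.integral_const_mul]
    refine intervalIntegral.integral_congr fun r _ => ?_
    rcases eq_or_ne x 0 with rfl | hx0
    · simp
    have hc : conj x ≠ 0 := (map_ne_zero _).2 hx0
    have h2 : ((‖x‖ : ℂ)) ^ 2 = x * conj x := by
      rw [Complex.mul_conj, Complex.normSq_eq_norm_sq]; push_cast; ring
    have h3 : (((‖x‖ * r : ℝ) : ℂ)) ^ 2 * (conj x)⁻¹ = (r : ℂ) ^ 2 * x := by
      push_cast
      rw [mul_pow, h2]; field_simp
    rw [h3]; push_cast; ring
  rw [hsubst]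
  have h2 : (conj x)⁻¹ * ((‖x‖ : ℂ)) ^ 2 = x := by
    rcases eq_or_ne x 0 with rfl | hx0
    · simp
    have hc : conj x ≠ 0 := (map_ne_zero _).2 hx0
    have h2 : ((‖x‖ : ℂ)) ^ 2 = x * conj x := by
      rw [Complex.mul_conj, Complex.normSq_eq_norm_sq]; push_cast; ring
    rw [h2]; field_simp
  rw [← mul_assoc, h2, sub_self, mul_zero, map_zero]

/-! ### Integral operators in one variable on the polydisc -/

section

variable {n : ℕ}

theorem polydisc_eq_pi (n : ℕ) :
    polydisc n = univ.pi fun _ : Fin n => Metric.ball (0 : ℂ) 1 := by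
  ext z; simp [polydisc]

theorem isOpen_polydisc (n : ℕ) : IsOpen (polydisc n) := by
  rw [polydisc_eq_pi]
  exact isOpen_set_pi finite_univ fun _ _ => Metric.isOpen_ball

theorem measurableSet_polydisc (n : ℕ) : MeasurableSet (polydisc n) :=
  (isOpen_polydisc n).measurableSet

theorem update_mem_polydisc {z : Fin n → ℂ} (hz : z ∈ polydisc n) (i : Fin n) {w : ℂ}
    (hw : ‖w‖ < 1) : Function.update z i w ∈ polydisc n := by
  intro j
  rcases eq_or_ne j i with rfl | h
  · simpa using hw
  · simpa [h] using hz j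

theorem volume_restrict_polydisc (n : ℕ) :
    (volume : Measure (Fin n → ℂ)).restrict (polydisc n) =
      Measure.pi fun _ => (volume : Measure ℂ).restrict (Metric.ball 0 1) := by
  rw [polydisc_eq_pi, volume_pi, Measure.restrict_pi_pi]

instance : IsFiniteMeasure ((volume : Measure ℂ).restrict (Metric.ball 0 1)) :=
  ⟨by rw [Measure.restrict_apply_univ]; exact measure_ball_lt_top⟩

instance : IsFiniteMeasure ((volume : Measure (Fin n → ℂ)).restrict (polydisc n)) := by
  rw [volume_restrict_polydisc]; infer_instance

theorem volume_ball_zero_one_ne_zero : volume (Metric.ball (0 : ℂ) 1) ≠ 0 :=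
  (Metric.measure_ball_pos volume _ one_pos).ne'

theorem volume_ball_zero_one_ne_top : volume (Metric.ball (0 : ℂ) 1) ≠ ⊤ :=
  measure_ball_lt_top.ne

theorem measurable_update_prod (i : Fin n) :
    Measurable fun p : (Fin n → ℂ) × ℂ => Function.update p.1 i p.2 := by
  refine measurable_pi_iff.2 fun j => ?_
  rcases eq_or_ne j i with rfl | h
  · simpa using measurable_snd
  · simp only [Function.update_of_ne h]
    exact (measurable_pi_apply j).comp measurable_fst

/-- Resampling one coordinate independently and uniformly preserves a product measure, up to the
area of the disc. This replaces splitting ℂⁿ as ℂ × ℂⁿ⁻¹: all coordinates are kept, one is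
integrated twice, and the area factor is divided out at the end. -/
theorem map_update_prod (i : Fin n) :
    Measure.map (fun p : (Fin n → ℂ) × ℂ => Function.update p.1 i p.2)
      ((volume.restrict (polydisc n)).prod (volume.restrict (Metric.ball 0 1))) =
      volume (Metric.ball (0 : ℂ) 1) • volume.restrict (polydisc n) := by
  set c := volume (Metric.ball (0 : ℂ) 1) with hc
  have hc0 : c ≠ 0 := volume_ball_zero_one_ne_zero
  have hct : c ≠ ⊤ := volume_ball_zero_one_ne_top
  rw [volume_restrict_polydisc]
  set μ := (volume : Measure ℂ).restrict (Metric.ball 0 1) with hμ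
  have hμu : μ univ = c := by rw [hμ, Measure.restrict_apply_univ]
  have key : Measure.pi (fun _ : Fin n => μ) = c⁻¹ • Measure.map
      (fun p : (Fin n → ℂ) × ℂ => Function.update p.1 i p.2)
      ((Measure.pi fun _ : Fin n => μ).prod μ) := by
    refine Measure.pi_eq fun s hs => ?_
    have hpre : (fun p : (Fin n → ℂ) × ℂ => Function.update p.1 i p.2) ⁻¹' univ.pi s =
        univ.pi (Function.update s i univ) ×ˢ s i := by
      ext p
      simp only [mem_preimage, mem_univ_pi, mem_prod]
      constructor
      · intro h
        refine ⟨fun j => ?_, by simpa using h i⟩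
        rcases eq_or_ne j i with rfl | hj
        · simp
        · simpa [hj] using h j
      · rintro ⟨h1, h2⟩ j
        rcases eq_or_ne j i with rfl | hj
        · simpa using h2
        · simpa [hj] using h1 j
    rw [Measure.smul_apply, Measure.map_apply (measurable_update_prod i)
      (MeasurableSet.univ_pi hs), hpre, Measure.prod_prod, Measure.pi_pi]
    have h1 : ∀ j, μ (Function.update s i univ j) =
        Function.update (fun j => μ (s j)) i (μ univ) j := fun j =>
      Function.apply_update (fun _ t => μ t) s i univ j
    simp only [h1]
    rw [Finset.prod_update_of_mem (Finset.mem_univ i), hμu, smul_eq_mul, mul_assoc, ← mul_assoc,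
      ENNReal.inv_mul_cancel hc0 hct, one_mul, mul_comm, ← Finset.prod_eq_mul_prod_sdiff_singleton_of_mem (Finset.mem_univ i) (fun j => μ (s j))]
  conv_rhs => rw [key]
  rw [smul_smul, ENNReal.mul_inv_cancel hc0 hct, one_smul]

theorem lintegral_lintegral_update (i : Fin n) {F : (Fin n → ℂ) → ℝ≥0∞} (hF : Measurable F) :
    ∫⁻ z in polydisc n, ∫⁻ w in Metric.ball (0 : ℂ) 1, F (Function.update z i w) =
      volume (Metric.ball (0 : ℂ) 1) * ∫⁻ z in polydisc n, F z := by
  rw [← smul_eq_mul, ← lintegral_smul_measure, ← map_update_prod i,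
    lintegral_map hF (measurable_update_prod i),
    lintegral_prod (fun p : (Fin n → ℂ) × ℂ => F (Function.update p.1 i p.2))
      (hF.comp (measurable_update_prod i)).aemeasurable]

theorem integrable_comp_update (i : Fin n) {F : (Fin n → ℂ) → ℂ}
    (hF : IntegrableOn F (polydisc n)) :
    Integrable (fun p : (Fin n → ℂ) × ℂ => F (Function.update p.1 i p.2))
      ((volume.restrict (polydisc n)).prod (volume.restrict (Metric.ball 0 1))) := by
  have h : Integrable F (volume (Metric.ball (0 : ℂ) 1) • volume.restrict (polydisc n)) :=
    hF.smul_measure volume_ball_zero_one_ne_top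
  rw [← map_update_prod i] at h
  exact h.comp_measurable (measurable_update_prod i)

theorem integral_integral_update (i : Fin n) {F : (Fin n → ℂ) → ℂ}
    (hF : IntegrableOn F (polydisc n)) :
    ∫ z in polydisc n, ∫ w in Metric.ball (0 : ℂ) 1, F (Function.update z i w) =
      (volume (Metric.ball (0 : ℂ) 1)).toReal • ∫ z in polydisc n, F z := by
  have h : Integrable F (volume (Metric.ball (0 : ℂ) 1) • volume.restrict (polydisc n)) :=
    hF.smul_measure volume_ball_zero_one_ne_top
  rw [← map_update_prod i] at h
  rw [← integral_smul_measure, ← map_update_prod i,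
    integral_map (measurable_update_prod i).aemeasurable h.aestronglyMeasurable,
    integral_prod _ (integrable_comp_update i hF)]

/-- Bounded measurable functions. -/
def IsBddMeas (a : (Fin n → ℂ) → ℂ) : Prop :=
  Measurable a ∧ ∃ C : ℝ, ∀ z, ‖a z‖ ≤ C

/-- The integral operator with kernel `κ` acting in the `i`-th variable. -/
noncomputable def discOp (i : Fin n) (κ : ℂ → ℂ → ℂ) (a : (Fin n → ℂ) → ℂ) (z : Fin n → ℂ) : ℂ :=
  ∫ w in Metric.ball (0 : ℂ) 1, κ (z i) w * a (Function.update z i w)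

theorem IsDiscKernel.integrable {A : ℝ≥0} {κ : ℂ → ℂ → ℂ} (h : IsDiscKernel A κ) (z : ℂ) :
    IntegrableOn (κ z) (Metric.ball 0 1) :=
  ⟨(Measurable.of_uncurry_left h.measurable).aestronglyMeasurable,
    (h.right z).trans_lt ENNReal.coe_lt_top⟩

theorem IsBddMeas.integrable_mul {α : Type*} [MeasurableSpace α] {μ : Measure α}
    {a : (Fin n → ℂ) → ℂ} (ha : IsBddMeas a) {f : α → ℂ} (hf : Integrable f μ)
    {u : α → Fin n → ℂ} (hu : Measurable u) : Integrable (fun x => f x * a (u x)) μ := by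
  obtain ⟨C, hC⟩ := ha.2
  exact hf.mul_bdd (c := C) (ha.1.comp hu).aestronglyMeasurable (.of_forall fun x => hC _)

theorem IsBddMeas.add {a b : (Fin n → ℂ) → ℂ} (ha : IsBddMeas a) (hb : IsBddMeas b) :
    IsBddMeas (fun z => a z + b z) := by
  obtain ⟨C, hC⟩ := ha.2
  obtain ⟨D, hD⟩ := hb.2
  exact ⟨ha.1.add hb.1, C + D, fun z => (norm_add_le _ _).trans (add_le_add (hC z) (hD z))⟩

theorem IsBddMeas.sub {a b : (Fin n → ℂ) → ℂ} (ha : IsBddMeas a) (hb : IsBddMeas b) :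
    IsBddMeas (fun z => a z - b z) := by
  obtain ⟨C, hC⟩ := ha.2
  obtain ⟨D, hD⟩ := hb.2
  exact ⟨ha.1.sub hb.1, C + D, fun z => (norm_sub_le _ _).trans (add_le_add (hC z) (hD z))⟩

theorem IsBddMeas.zero : IsBddMeas (fun _ : Fin n → ℂ => (0 : ℂ)) :=
  ⟨measurable_const, 0, fun _ => by simp⟩

theorem IsBddMeas.integrableOn {a : (Fin n → ℂ) → ℂ} (ha : IsBddMeas a) :
    IntegrableOn a (polydisc n) := by
  have := ha.integrable_mul (μ := volume.restrict (polydisc n)) (integrable_const (1 : ℂ))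
    measurable_id
  simpa [IntegrableOn] using this

theorem enorm_discOp_le (i : Fin n) (κ : ℂ → ℂ → ℂ) (a : (Fin n → ℂ) → ℂ) (z : Fin n → ℂ) :
    ‖discOp i κ a z‖ₑ ≤
      ∫⁻ w in Metric.ball (0 : ℂ) 1, ‖κ (z i) w‖ₑ * ‖a (Function.update z i w)‖ₑ := by
  refine (enorm_integral_le_lintegral_enorm _).trans_eq ?_
  simp only [enorm_mul]

theorem measurable_discOp (i : Fin n) {κ : ℂ → ℂ → ℂ} (hκ : Measurable (Function.uncurry κ))
    {a : (Fin n → ℂ) → ℂ} (ha : Measurable a) : Measurable (discOp i κ a) := by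
  have h1 : Measurable fun p : (Fin n → ℂ) × ℂ => κ (p.1 i) p.2 := by
    have : Measurable fun p : (Fin n → ℂ) × ℂ => (p.1 i, p.2) :=
      ((measurable_pi_apply i).comp measurable_fst).prodMk measurable_snd
    exact hκ.comp this
  have h2 : Measurable fun p : (Fin n → ℂ) × ℂ => κ (p.1 i) p.2 * a (Function.update p.1 i p.2) :=
    h1.mul (ha.comp (measurable_update_prod i))
  exact (h2.stronglyMeasurable.integral_prod_right'
    (ν := volume.restrict (Metric.ball (0 : ℂ) 1))).measurable

/-- The L^∞ half of Schur's test, using the integrals of the kernel over its second variable. -/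
theorem iSup_enorm_discOp_le (i : Fin n) {A : ℝ≥0} {κ : ℂ → ℂ → ℂ} (hκ : IsDiscKernel A κ)
    (a : (Fin n → ℂ) → ℂ) : ⨆ z, ‖discOp i κ a z‖ₑ ≤ A * ⨆ z, ‖a z‖ₑ := by
  refine iSup_le fun z => (enorm_discOp_le i κ a z).trans ?_
  calc _ ≤ ∫⁻ w in Metric.ball (0 : ℂ) 1, ‖κ (z i) w‖ₑ * ⨆ z, ‖a z‖ₑ := by
        gcongr with w
        exact le_iSup (fun z => ‖a z‖ₑ) _
    _ = (∫⁻ w in Metric.ball (0 : ℂ) 1, ‖κ (z i) w‖ₑ) * ⨆ z, ‖a z‖ₑ :=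
        lintegral_mul_const _ (Measurable.of_uncurry_left hκ.measurable).enorm
    _ ≤ _ := by gcongr; exact hκ.right _

/-- The L¹ half of Schur's test: once the i-th coordinate is resampled, Tonelli puts the integral
over the first variable of the kernel innermost. -/
theorem lintegral_enorm_discOp_le (i : Fin n) {A : ℝ≥0} {κ : ℂ → ℂ → ℂ} (hκ : IsDiscKernel A κ)
    {a : (Fin n → ℂ) → ℂ} (ha : Measurable a) :
    ∫⁻ z in polydisc n, ‖discOp i κ a z‖ₑ ≤ A * ∫⁻ z in polydisc n, ‖a z‖ₑ := by
  have h0 := volume_ball_zero_one_ne_zero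
  have ht := volume_ball_zero_one_ne_top
  rw [← ENNReal.mul_le_mul_iff_right h0 ht,
    ← lintegral_lintegral_update i (measurable_discOp i hκ.measurable ha).enorm,
    mul_left_comm, ← lintegral_lintegral_update i ha.enorm,
    ← lintegral_const_mul' _ _ ENNReal.coe_ne_top]
  refine lintegral_mono fun z => ?_
  have hau : Measurable fun x => ‖a (Function.update z i x)‖ₑ :=
    (ha.comp (measurable_update z)).enorm
  calc ∫⁻ w in Metric.ball (0 : ℂ) 1, ‖discOp i κ a (Function.update z i w)‖ₑ
      ≤ ∫⁻ w in Metric.ball (0 : ℂ) 1, ∫⁻ x in Metric.ball (0 : ℂ) 1,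
          ‖κ w x‖ₑ * ‖a (Function.update z i x)‖ₑ := by
        refine lintegral_mono fun w => (enorm_discOp_le i κ a _).trans_eq ?_
        simp
    _ = ∫⁻ x in Metric.ball (0 : ℂ) 1, ∫⁻ w in Metric.ball (0 : ℂ) 1,
          ‖κ w x‖ₑ * ‖a (Function.update z i x)‖ₑ := by
        refine lintegral_lintegral_swap (Measurable.aemeasurable ?_)
        exact hκ.measurable.enorm.mul (hau.comp measurable_snd)
    _ ≤ ∫⁻ x in Metric.ball (0 : ℂ) 1, A * ‖a (Function.update z i x)‖ₑ := by
        refine lintegral_mono fun x => ?_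
        simp only
        rw [lintegral_mul_const _ (Measurable.of_uncurry_right hκ.measurable).enorm]
        gcongr
        exact hκ.left x
    _ = _ := lintegral_const_mul' _ _ ENNReal.coe_ne_top

theorem IsBddMeas.discOp (i : Fin n) {A : ℝ≥0} {κ : ℂ → ℂ → ℂ} (hκ : IsDiscKernel A κ)
    {a : (Fin n → ℂ) → ℂ} (ha : IsBddMeas a) : IsBddMeas (discOp i κ a) := by
  refine ⟨measurable_discOp i hκ.measurable ha.1, ?_⟩
  obtain ⟨C, hC⟩ := ha.2
  refine ⟨(A * ⨆ z, ‖a z‖ₑ).toReal, fun z => ?_⟩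
  have h1 : (⨆ z, ‖a z‖ₑ) ≤ ENNReal.ofReal C := iSup_le fun z => by
    rw [← ofReal_norm]; exact ENNReal.ofReal_le_ofReal (hC z)
  rw [← toReal_enorm]
  refine ENNReal.toReal_mono ?_ ((le_iSup (fun z => ‖_root_.discOp i κ a z‖ₑ) z).trans
    (iSup_enorm_discOp_le i hκ a))
  exact ENNReal.mul_ne_top ENNReal.coe_ne_top (h1.trans_lt ENNReal.ofReal_lt_top).ne

theorem IsBddMeas.integrable_slice {a : (Fin n → ℂ) → ℂ} (ha : IsBddMeas a) {f : ℂ → ℂ}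
    (hf : IntegrableOn f (Metric.ball 0 1)) (i : Fin n) (z : Fin n → ℂ) :
    IntegrableOn (fun w => f w * a (Function.update z i w)) (Metric.ball 0 1) :=
  ha.integrable_mul hf (measurable_update z)

theorem discOp_sub (i : Fin n) {A : ℝ≥0} {κ : ℂ → ℂ → ℂ} (hκ : IsDiscKernel A κ)
    {a b : (Fin n → ℂ) → ℂ} (ha : IsBddMeas a) (hb : IsBddMeas b) :
    discOp i κ (fun z => a z - b z) = fun z => discOp i κ a z - discOp i κ b z := by
  ext z
  simp only [discOp, mul_sub]
  exact integral_sub (ha.integrable_slice (hκ.integrable _) i z)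
    (hb.integrable_slice (hκ.integrable _) i z)

theorem discOp_kernel_sub (i : Fin n) {A A' : ℝ≥0} {κ κ' : ℂ → ℂ → ℂ} (hκ : IsDiscKernel A κ)
    (hκ' : IsDiscKernel A' κ') {a : (Fin n → ℂ) → ℂ} (ha : IsBddMeas a) :
    discOp i (fun z w => κ z w - κ' z w) a = fun z => discOp i κ a z - discOp i κ' a z := by
  ext z
  simp only [discOp, sub_mul]
  exact integral_sub (ha.integrable_slice (hκ.integrable _) i z)
    (ha.integrable_slice (hκ'.integrable _) i z)

theorem discOp_comm {i k : Fin n} (hik : i ≠ k) {A A' : ℝ≥0} {κ κ' : ℂ → ℂ → ℂ}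
    (hκ : IsDiscKernel A κ) (hκ' : IsDiscKernel A' κ') {a : (Fin n → ℂ) → ℂ} (ha : IsBddMeas a) :
    discOp i κ (discOp k κ' a) = discOp k κ' (discOp i κ a) := by
  ext z
  have h1 := ha.integrable_mul ((hκ.integrable (z i)).mul_prod (hκ'.integrable (z k)))
    (u := fun p : ℂ × ℂ => Function.update (Function.update z i p.1) k p.2)
    ((measurable_update_prod k).comp
      (((measurable_update z).comp measurable_fst).prodMk measurable_snd))
  simp only [discOp, Function.update_of_ne hik, Function.update_of_ne hik.symm,
    ← integral_const_mul]
  have h2 := integral_integral_swap (f := fun w x => κ (z i) w * κ' (z k) x *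
    a (Function.update (Function.update z i w) k x)) h1
  simp only [mul_assoc] at h2
  rw [h2]
  refine integral_congr_ae (.of_forall fun x => integral_congr_ae (.of_forall fun w => ?_))
  simp only
  rw [Function.update_comm hik]
  ring

/-! ### Slicewise weak `∂̄`-derivatives -/

/-- `∂a/∂z̄ₖ = b` in the weak sense on every slice of the polydisc in the `k`-th direction. -/
def HasSliceDbar (k : Fin n) (a b : (Fin n → ℂ) → ℂ) : Prop :=
  ∀ z ∈ polydisc n, ∀ ψ : ℂ → ℂ, IsDiscTest ψ →
    ∫ w in Metric.ball (0 : ℂ) 1, a (Function.update z k w) * dbar ψ w =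
      -∫ w in Metric.ball (0 : ℂ) 1, b (Function.update z k w) * ψ w

theorem Continuous.integrableOn_ball_zero_one {η : ℂ → ℂ} (h : Continuous η) :
    IntegrableOn η (Metric.ball 0 1) :=
  (h.continuousOn.integrableOn_compact (isCompact_closedBall _ _)).mono_set
    Metric.ball_subset_closedBall

theorem IsBddMeas.integrable_slice_mul {a : (Fin n → ℂ) → ℂ} (ha : IsBddMeas a) {η : ℂ → ℂ}
    (hη : Continuous η) (k : Fin n) (z : Fin n → ℂ) :
    IntegrableOn (fun w => a (Function.update z k w) * η w) (Metric.ball 0 1) := by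
  simp only [mul_comm _ (η _)]
  exact ha.integrable_slice hη.integrableOn_ball_zero_one k z

theorem HasSliceDbar.zero (k : Fin n) : HasSliceDbar k (fun _ => 0) (fun _ => 0) := by
  intro z _ ψ _
  simp

theorem HasSliceDbar.add {k : Fin n} {a b a' b' : (Fin n → ℂ) → ℂ} (h : HasSliceDbar k a b)
    (h' : HasSliceDbar k a' b') (ha : IsBddMeas a) (hb : IsBddMeas b) (ha' : IsBddMeas a')
    (hb' : IsBddMeas b') : HasSliceDbar k (fun z => a z + a' z) (fun z => b z + b' z) := by
  intro z hz ψ hψ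
  simp only [add_mul]
  rw [integral_add (ha.integrable_slice_mul hψ.continuous_dbar k z)
    (ha'.integrable_slice_mul hψ.continuous_dbar k z), integral_add
    (hb.integrable_slice_mul hψ.smooth.continuous k z)
    (hb'.integrable_slice_mul hψ.smooth.continuous k z), h z hz ψ hψ, h' z hz ψ hψ]
  ring

theorem HasSliceDbar.sub {k : Fin n} {a b a' b' : (Fin n → ℂ) → ℂ} (h : HasSliceDbar k a b)
    (h' : HasSliceDbar k a' b') (ha : IsBddMeas a) (hb : IsBddMeas b) (ha' : IsBddMeas a')
    (hb' : IsBddMeas b') : HasSliceDbar k (fun z => a z - a' z) (fun z => b z - b' z) := by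
  intro z hz ψ hψ
  simp only [sub_mul]
  rw [integral_sub (ha.integrable_slice_mul hψ.continuous_dbar k z)
    (ha'.integrable_slice_mul hψ.continuous_dbar k z), integral_sub
    (hb.integrable_slice_mul hψ.smooth.continuous k z)
    (hb'.integrable_slice_mul hψ.smooth.continuous k z), h z hz ψ hψ, h' z hz ψ hψ]
  ring

theorem IsBddMeas.integral_discOp_slice {i k : Fin n} (hik : i ≠ k) {A : ℝ≥0} {κ : ℂ → ℂ → ℂ}
    (hκ : IsDiscKernel A κ) {a : (Fin n → ℂ) → ℂ} (ha : IsBddMeas a) {η : ℂ → ℂ}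
    (hη : Continuous η) (z : Fin n → ℂ) :
    ∫ w in Metric.ball (0 : ℂ) 1, _root_.discOp i κ a (Function.update z k w) * η w =
      ∫ x in Metric.ball (0 : ℂ) 1, κ (z i) x *
        ∫ w in Metric.ball (0 : ℂ) 1, a (Function.update (Function.update z i x) k w) * η w := by
  have h1 := ha.integrable_mul (hη.integrableOn_ball_zero_one.mul_prod (hκ.integrable (z i)))
    (u := fun p : ℂ × ℂ => Function.update (Function.update z i p.2) k p.1)
    ((measurable_update_prod k).comp
      (((measurable_update z).comp measurable_snd).prodMk measurable_fst))
  have h2 := integral_integral_swap (f := fun w x => η w * κ (z i) x *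
    a (Function.update (Function.update z i x) k w)) h1
  simp only [_root_.discOp, Function.update_of_ne hik, ← integral_const_mul, ← integral_mul_const]
  refine Eq.trans (integral_congr_ae (.of_forall fun w => integral_congr_ae
    (.of_forall fun x => ?_))) (h2.trans (integral_congr_ae (.of_forall fun x => integral_congr_ae
    (.of_forall fun w => ?_))))
  · simp only
    rw [Function.update_comm hik]; ring
  · simp only
    ring

/-- Tᵢ and ∂̄ₖ act in different variables, so they commute by Fubini. -/
theorem HasSliceDbar.discOp_of_ne {i k : Fin n} (hik : i ≠ k) {A : ℝ≥0} {κ : ℂ → ℂ → ℂ}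
    (hκ : IsDiscKernel A κ) {a b : (Fin n → ℂ) → ℂ} (ha : IsBddMeas a) (hb : IsBddMeas b)
    (h : HasSliceDbar k a b) : HasSliceDbar k (discOp i κ a) (discOp i κ b) := by
  intro z hz ψ hψ
  rw [ha.integral_discOp_slice hik hκ hψ.continuous_dbar,
    hb.integral_discOp_slice hik hκ hψ.smooth.continuous, ← integral_neg]
  refine setIntegral_congr_fun Metric.isOpen_ball.measurableSet fun x hx => ?_
  rw [h _ (update_mem_polydisc hz i (by simpa using hx)) ψ hψ, mul_neg]

theorem IsDiscKernel.integrable_mul_fst {A : ℝ≥0} {κ : ℂ → ℂ → ℂ} (hκ : IsDiscKernel A κ)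
    {f : ℂ → ℂ} (hf : IntegrableOn f (Metric.ball 0 1)) :
    Integrable (fun p : ℂ × ℂ => κ p.1 p.2 * f p.1)
      ((volume.restrict (Metric.ball 0 1)).prod (volume.restrict (Metric.ball 0 1))) := by
  have hm : AEStronglyMeasurable (fun p : ℂ × ℂ => κ p.1 p.2 * f p.1)
      ((volume.restrict (Metric.ball 0 1)).prod (volume.restrict (Metric.ball 0 1))) :=
    hκ.measurable.aestronglyMeasurable.mul hf.aestronglyMeasurable.comp_fst
  refine ⟨hm, ?_⟩
  rw [hasFiniteIntegral_iff_enorm, lintegral_prod _ hm.enorm]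
  calc _ ≤ ∫⁻ w in Metric.ball (0 : ℂ) 1, A * ‖f w‖ₑ := by
        refine lintegral_mono fun w => ?_
        simp only [enorm_mul]
        rw [lintegral_mul_const _ (Measurable.of_uncurry_left hκ.measurable).enorm]
        gcongr
        exact hκ.right w
    _ = A * ∫⁻ w in Metric.ball (0 : ℂ) 1, ‖f w‖ₑ := lintegral_const_mul' _ _ ENNReal.coe_ne_top
    _ < ⊤ := ENNReal.mul_lt_top ENNReal.coe_lt_top hf.2

theorem IsBddMeas.integral_discOp_slice_self {k : Fin n} {A : ℝ≥0} {κ : ℂ → ℂ → ℂ}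
    (hκ : IsDiscKernel A κ) {a : (Fin n → ℂ) → ℂ} (ha : IsBddMeas a) {η : ℂ → ℂ}
    (hη : IntegrableOn η (Metric.ball 0 1)) (z : Fin n → ℂ) :
    ∫ w in Metric.ball (0 : ℂ) 1, _root_.discOp k κ a (Function.update z k w) * η w =
      ∫ x in Metric.ball (0 : ℂ) 1, a (Function.update z k x) *
        ∫ w in Metric.ball (0 : ℂ) 1, κ w x * η w := by
  have h1 := ha.integrable_mul (hκ.integrable_mul_fst hη)
    (u := fun p : ℂ × ℂ => Function.update z k p.2) ((measurable_update z).comp measurable_snd)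
  have h2 := integral_integral_swap (f := fun w x => κ w x * η w * a (Function.update z k x)) h1
  simp only [_root_.discOp, Function.update_self, Function.update_idem, ← integral_const_mul,
    ← integral_mul_const]
  refine Eq.trans (integral_congr_ae (.of_forall fun w => integral_congr_ae
    (.of_forall fun x => ?_))) (h2.trans (integral_congr_ae (.of_forall fun x => integral_congr_ae
    (.of_forall fun w => ?_))))
  · simp only
    ring
  · simp only
    ring

/-- This is ∂̄ₖTₖ = 1: Fubini moves the kernel onto the test function, where
`IsDiscTest.integral_regKernel_mul_dbar` evaluates the inner integral. -/
theorem HasSliceDbar.discOp_self (k : Fin n) {A : ℝ≥0}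
    (hκ : IsDiscKernel A (discKernel (regKernel 0))) {a : (Fin n → ℂ) → ℂ} (ha : IsBddMeas a) :
    HasSliceDbar k (discOp k (discKernel (regKernel 0)) a) a := by
  intro z hz ψ hψ
  rw [ha.integral_discOp_slice_self hκ hψ.continuous_dbar.integrableOn_ball_zero_one,
    ← integral_neg]
  refine setIntegral_congr_fun Metric.isOpen_ball.measurableSet fun x hx => ?_
  have hx' : ‖x‖ < 1 := by simpa using hx
  have h1 : ∫ w in Metric.ball (0 : ℂ) 1, discKernel (regKernel 0) w x * dbar ψ w = -ψ x := by
    rw [← hψ.integral_regKernel_mul_dbar hx']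
    refine setIntegral_congr_fun Metric.isOpen_ball.measurableSet fun w hw => ?_
    rw [discKernel_of_mem (by simpa using hw) hx']
  rw [h1, mul_neg]

theorem hasFDerivAt_comp_update {φ : (Fin n → ℂ) → ℂ} {z : Fin n → ℂ} {k : Fin n} {w : ℂ}
    (h : DifferentiableAt ℝ φ (Function.update z k w)) :
    HasDbarAt (fun w => φ (Function.update z k w)) (wirtingerBar k φ (Function.update z k w)) w := by
  refine ⟨_, h.hasFDerivAt.comp w (hasFDerivAt_update z w), ?_⟩
  have e : ∀ v : ℂ, (ContinuousLinearMap.pi (Pi.single k (ContinuousLinearMap.id ℝ ℂ))) v =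
      (Pi.single k v : Fin n → ℂ) := by
    intro v
    ext j
    rcases eq_or_ne j k with rfl | hj
    · simp
    · simp [hj]
  simp only [ContinuousLinearMap.comp_apply]
  rw [wirtingerBar]
  erw [e, e]

theorem IsTestFunction.isDiscTest_update {φ : (Fin n → ℂ) → ℂ}
    (h : IsTestFunction (polydisc n) φ) (z : Fin n → ℂ) (k : Fin n) :
    IsDiscTest fun w => φ (Function.update z k w) := by
  refine ⟨h.smooth.comp (contDiff_update _ z k), fun w hw => ?_⟩
  have h1 : Function.update z k w ∈ tsupport φ := by
    have hc : Continuous fun w : ℂ => Function.update z k w :=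
      continuous_const.update k continuous_id
    exact tsupport_comp_subset_preimage φ hc hw
  have := h.tsupport_subset h1 k
  simpa using this

theorem IsTestFunction.continuous_wirtingerBar {Ω : Set (Fin n → ℂ)} {φ : (Fin n → ℂ) → ℂ}
    (h : IsTestFunction Ω φ) (k : Fin n) : Continuous (wirtingerBar k φ) := by
  have := h.smooth.continuous_fderiv (by norm_num)
  unfold wirtingerBar; fun_prop

theorem tsupport_wirtingerBar_subset (φ : (Fin n → ℂ) → ℂ) (k : Fin n) :
    tsupport (wirtingerBar k φ) ⊆ tsupport φ := by
  refine closure_minimal (fun z hz => ?_) (isClosed_tsupport φ)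
  by_contra h
  apply hz
  rw [wirtingerBar, fderiv_of_notMem_tsupport ℝ h]; simp

theorem IsBddMeas.integrableOn_mul_continuous {a : (Fin n → ℂ) → ℂ} (ha : IsBddMeas a)
    {η : (Fin n → ℂ) → ℂ} (hη : Continuous η) (hc : HasCompactSupport η) :
    IntegrableOn (fun z => a z * η z) (polydisc n) := by
  simp only [mul_comm _ (η _)]
  exact ha.integrable_mul (hη.integrable_of_hasCompactSupport hc).integrableOn measurable_id

/-- A test function on the polydisc restricts to a test function on every slice, so the slicewise
identity integrates to the distributional one. -/
theorem HasSliceDbar.integral_mul_wirtingerBar {k : Fin n} {a b : (Fin n → ℂ) → ℂ}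
    (ha : IsBddMeas a) (hb : IsBddMeas b) (h : HasSliceDbar k a b) {φ : (Fin n → ℂ) → ℂ}
    (hφ : IsTestFunction (polydisc n) φ) :
    ∫ z in polydisc n, a z * wirtingerBar k φ z = -∫ z in polydisc n, b z * φ z := by
  have hc : (volume (Metric.ball (0 : ℂ) 1)).toReal ≠ 0 :=
    ENNReal.toReal_ne_zero.2 ⟨volume_ball_zero_one_ne_zero, volume_ball_zero_one_ne_top⟩
  refine smul_right_injective ℂ hc ?_
  simp only [smul_neg]
  rw [← integral_integral_update k (ha.integrableOn_mul_continuous (hφ.continuous_wirtingerBar k)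
    (hφ.compactSupport.of_isClosed_subset (isClosed_tsupport _) (tsupport_wirtingerBar_subset φ k))),
    ← integral_integral_update k (hb.integrableOn_mul_continuous hφ.smooth.continuous
      hφ.compactSupport), ← integral_neg]
  refine setIntegral_congr_fun (measurableSet_polydisc n) fun z hz => ?_
  have h1 := h z hz _ (hφ.isDiscTest_update z k)
  rw [← h1]
  refine integral_congr_ae (.of_forall fun w => ?_)
  simp only
  rw [(hasFDerivAt_comp_update (hφ.smooth.differentiable (by norm_num) _)).dbar_eq]

/-- The image of the canonical kernel operator is orthogonal to the Bergman space. -/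
theorem integral_discOp_mul_conj_eq_zero (i : Fin n) {A : ℝ≥0}
    (hκ : IsDiscKernel A (discKernel (regKernel 0))) {a : (Fin n → ℂ) → ℂ} (ha : IsBddMeas a)
    {g : (Fin n → ℂ) → ℂ} (hg : DifferentiableOn ℂ g (polydisc n))
    (hgi : IntegrableOn g (polydisc n)) :
    ∫ z in polydisc n, discOp i (discKernel (regKernel 0)) a z * conj (g z) = 0 := by
  have hc : (volume (Metric.ball (0 : ℂ) 1)).toReal ≠ 0 :=
    ENNReal.toReal_ne_zero.2 ⟨volume_ball_zero_one_ne_zero, volume_ball_zero_one_ne_top⟩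
  have hgc : IntegrableOn (fun z => conj (g z)) (polydisc n) :=
    (Complex.conjCLE : ℂ →L[ℝ] ℂ).integrable_comp hgi
  have hint : IntegrableOn (fun z => discOp i (discKernel (regKernel 0)) a z * conj (g z))
      (polydisc n) := by
    simp only [mul_comm _ (conj (g _))]
    exact (ha.discOp i hκ).integrable_mul hgc measurable_id
  refine smul_right_injective ℂ hc ?_
  simp only [smul_zero]
  rw [← integral_integral_update i hint]
  refine integral_eq_zero_of_ae ?_
  -- An L¹ function is integrable only on almost every slice. A second application of Fubini, for
  -- almost every x, makes the kernel times the conjugate of g integrable on the disc.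
  filter_upwards [(integrable_comp_update i hgc).prod_right_ae,
    ae_restrict_mem (measurableSet_polydisc n)] with z hz hzm
  simp only [Pi.zero_apply]
  rw [ha.integral_discOp_slice_self hκ hz]
  refine integral_eq_zero_of_ae ?_
  filter_upwards [(hκ.integrable_mul_fst hz).prod_left_ae,
    ae_restrict_mem Metric.isOpen_ball.measurableSet] with x hx hxm
  have hx' : ‖x‖ < 1 := by simpa using hxm
  have hcongr : ∀ w ∈ Metric.ball (0 : ℂ) 1,
      discKernel (regKernel 0) w x * conj (g (Function.update z i w)) =
      regKernel 0 w x * conj (g (Function.update z i w)) := fun w hw => by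
    rw [discKernel_of_mem (by simpa using hw) hx']
  have hd : DifferentiableOn ℂ (fun w => g (Function.update z i w)) (Metric.ball 0 1) := by
    intro w hw
    have h1 : DifferentiableAt ℂ g (Function.update z i w) :=
      hg.differentiableAt ((isOpen_polydisc n).mem_nhds
        (update_mem_polydisc hzm i (by simpa using hw)))
    exact (h1.hasFDerivAt.comp w
      (hasFDerivAt_update z w)).differentiableAt.differentiableWithinAt
  simp only [Pi.zero_apply]
  rw [setIntegral_congr_fun Metric.isOpen_ball.measurableSet hcongr,
    integral_regKernel_mul_conj_eq_zero hd hx', mul_zero]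
  exact IntegrableOn.congr_fun hx hcongr Metric.isOpen_ball.measurableSet

theorem HasSliceDbar.of_contDiff (k : Fin n) {G : (Fin n → ℂ) → ℂ} (hG : ContDiff ℝ ∞ G) :
    HasSliceDbar k ((polydisc n).indicator G) ((polydisc n).indicator (wirtingerBar k G)) := by
  intro z hz ψ hψ
  have h1 := hψ.integral_mul_dbar (a := fun w => G (Function.update z k w)) fun w _ =>
    ((hG.of_le (by norm_cast)).comp (contDiff_update _ z k)).contDiffAt
  have hmem : ∀ w ∈ Metric.ball (0 : ℂ) 1, Function.update z k w ∈ polydisc n := fun w hw =>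
    update_mem_polydisc hz k (by simpa using hw)
  rw [setIntegral_congr_fun Metric.isOpen_ball.measurableSet (g := fun w =>
    G (Function.update z k w) * dbar ψ w) fun w hw => by
      simp only; rw [indicator_of_mem (hmem w hw)], h1]
  congr 1
  refine setIntegral_congr_fun Metric.isOpen_ball.measurableSet fun w hw => ?_
  rw [(hasFDerivAt_comp_update (hG.differentiable (by norm_num) _)).dbar_eq,
    indicator_of_mem (hmem w hw)]

theorem mem_polydisc_of_update_mem {z : Fin n → ℂ} {i : Fin n} {w : ℂ} (hz : ‖z i‖ < 1)
    (h : Function.update z i w ∈ polydisc n) : z ∈ polydisc n := by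
  have := update_mem_polydisc h i hz
  simpa using this

/-- Integration by parts for the regularized operators. -/
theorem discOp_regKernel_wirtingerBar (i : Fin n) {ε : ℝ} (hε : 0 < ε) {G : (Fin n → ℂ) → ℂ}
    (hG : ContDiff ℝ ∞ G) :
    discOp i (discKernel (regKernel ε)) ((polydisc n).indicator (wirtingerBar i G)) =
      discOp i (discKernel (regKernelDeriv ε)) ((polydisc n).indicator G) := by
  ext z
  by_cases hzi : ‖z i‖ < 1
  · by_cases hz : z ∈ polydisc n
    · have h1 := integral_regKernel_mul_dbar hε hzi (a := fun w => G (Function.update z i w))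
        ((hG.of_le (by norm_cast)).comp (contDiff_update _ z i))
      have hmem : ∀ w ∈ Metric.ball (0 : ℂ) 1, Function.update z i w ∈ polydisc n := fun w hw =>
        update_mem_polydisc hz i (by simpa using hw)
      refine Eq.trans (setIntegral_congr_fun Metric.isOpen_ball.measurableSet fun w hw => ?_)
        (h1.trans (setIntegral_congr_fun Metric.isOpen_ball.measurableSet fun w hw => ?_))
      · rw [(hasFDerivAt_comp_update (hG.differentiable (by norm_num) _)).dbar_eq,
          indicator_of_mem (hmem w hw), discKernel_of_mem hzi (by simpa using hw)]
      · rw [indicator_of_mem (hmem w hw), discKernel_of_mem hzi (by simpa using hw)]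
    · have h0 : ∀ w, Function.update z i w ∉ polydisc n := fun w h =>
        hz (mem_polydisc_of_update_mem hzi h)
      simp [discOp, indicator_of_notMem (h0 _)]
  · simp [discOp, discKernel_of_notMem hzi]

/-! ### The canonical solution for smooth data -/

/-- A `∂̄`-closed form on the polydisc whose coefficients are smooth on the whole space. -/
structure IsSmoothClosed (f : Fin n → (Fin n → ℂ) → ℂ) : Prop where
  smooth : ∀ j, ContDiff ℝ ∞ (f j)
  closed : ∀ j k, ∀ z ∈ polydisc n, wirtingerBar k (f j) z = wirtingerBar j (f k) z

/-- The iterated derivative `∂̄_{i₁} ⋯ ∂̄_{iₘ} f_j` for the list `[i₁, …, iₘ, j]`. -/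
noncomputable def dbarIter (f : Fin n → (Fin n → ℂ) → ℂ) : List (Fin n) → (Fin n → ℂ) → ℂ
  | [] => fun _ => 0
  | [j] => f j
  | i :: k :: l => wirtingerBar i (dbarIter f (k :: l))

theorem ContDiff.wirtingerBar {G : (Fin n → ℂ) → ℂ} (hG : ContDiff ℝ ∞ G) (k : Fin n) :
    ContDiff ℝ ∞ (wirtingerBar k G) := by
  have h : ContDiff ℝ ∞ (fderiv ℝ G) := hG.fderiv_right (by norm_cast)
  unfold _root_.wirtingerBar
  fun_prop

theorem fderiv_wirtingerBar {G : (Fin n → ℂ) → ℂ} (hG : ContDiff ℝ ∞ G) (k : Fin n)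
    (z v : Fin n → ℂ) : fderiv ℝ (wirtingerBar k G) z v = (1 / 2 : ℂ) *
      (fderiv ℝ (fderiv ℝ G) z v (Pi.single k 1) +
        Complex.I * fderiv ℝ (fderiv ℝ G) z v (Pi.single k Complex.I)) := by
  have h : ContDiff ℝ ∞ (fderiv ℝ G) := hG.fderiv_right (by norm_cast)
  have h1 : HasFDerivAt (fderiv ℝ G) (fderiv ℝ (fderiv ℝ G) z) z :=
    (h.differentiable (by norm_num) z).hasFDerivAt
  have h2 : ∀ u : Fin n → ℂ, HasFDerivAt (fun z => fderiv ℝ G z u)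
      ((fderiv ℝ (fderiv ℝ G) z).flip u) z := fun u => by
    simpa using h1.clm_apply (hasFDerivAt_const u z)
  have h3 := ((h2 (Pi.single k 1)).add
    ((h2 (Pi.single k Complex.I)).const_mul Complex.I)).const_mul (1 / 2 : ℂ)
  have h4 : HasFDerivAt (wirtingerBar k G) _ z := h3
  rw [h4.fderiv]
  simp
  ring

theorem wirtingerBar_comm {G : (Fin n → ℂ) → ℂ} (hG : ContDiff ℝ ∞ G) (j k : Fin n) :
    wirtingerBar j (wirtingerBar k G) = wirtingerBar k (wirtingerBar j G) := by
  ext z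
  have hs : IsSymmSndFDerivAt ℝ G z :=
    (hG.contDiffAt.of_le (m := 2) (by norm_cast)).isSymmSndFDerivAt (by simp)
  rw [wirtingerBar, wirtingerBar, fderiv_wirtingerBar hG, fderiv_wirtingerBar hG,
    fderiv_wirtingerBar hG, fderiv_wirtingerBar hG, hs.eq (Pi.single j 1) (Pi.single k 1),
    hs.eq (Pi.single j 1) (Pi.single k Complex.I), hs.eq (Pi.single j Complex.I) (Pi.single k 1),
    hs.eq (Pi.single j Complex.I) (Pi.single k Complex.I)]
  ring

theorem wirtingerBar_eqOn {G H : (Fin n → ℂ) → ℂ} {U : Set (Fin n → ℂ)} (hU : IsOpen U)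
    (h : EqOn G H U) (k : Fin n) : EqOn (wirtingerBar k G) (wirtingerBar k H) U := by
  intro z hz
  have : G =ᶠ[nhds z] H := Filter.eventually_of_mem (hU.mem_nhds hz) h
  rw [wirtingerBar, wirtingerBar, this.fderiv_eq]

theorem dbarIter_cons (f : Fin n → (Fin n → ℂ) → ℂ) (i : Fin n) {l : List (Fin n)} (hl : l ≠ []) :
    dbarIter f (i :: l) = wirtingerBar i (dbarIter f l) := by
  cases l with
  | nil => exact absurd rfl hl
  | cons k l => rfl

namespace IsSmoothClosed

variable {f : Fin n → (Fin n → ℂ) → ℂ}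

theorem contDiff_dbarIter (hf : IsSmoothClosed f) : ∀ l, ContDiff ℝ ∞ (dbarIter f l)
  | [] => contDiff_const
  | [j] => hf.smooth j
  | i :: k :: l => (contDiff_dbarIter hf (k :: l)).wirtingerBar i

/-- Closedness exchanges the last two indices, where the coefficient is chosen, and symmetry of
second derivatives exchanges the others. This is the only use of closedness in the smooth case, and
it holds only on the polydisc. -/
theorem dbarIter_perm (hf : IsSmoothClosed f) {l l' : List (Fin n)} (h : l.Perm l') :
    EqOn (dbarIter f l) (dbarIter f l') (polydisc n) := by
  induction h with
  | nil => exact fun _ _ => rfl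
  | @cons x l l' h ih =>
    rcases eq_or_ne l [] with rfl | hl
    · rw [h.nil_eq]; exact fun _ _ => rfl
    · have hl' : l' ≠ [] := fun h' => hl (by subst h'; exact h.eq_nil)
      rw [dbarIter_cons f x hl, dbarIter_cons f x hl']
      exact wirtingerBar_eqOn (isOpen_polydisc n) ih x
  | swap x y l =>
    rcases eq_or_ne l [] with rfl | hl
    · exact fun z hz => hf.closed x y z hz
    · rw [dbarIter_cons f y (List.cons_ne_nil _ _), dbarIter_cons f x hl,
        dbarIter_cons f x (List.cons_ne_nil _ _), dbarIter_cons f y hl,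
        wirtingerBar_comm (hf.contDiff_dbarIter l)]
      exact fun _ _ => rfl
  | trans _ _ ih1 ih2 => exact ih1.trans ih2

end IsSmoothClosed

theorem isBddMeas_indicator {G : (Fin n → ℂ) → ℂ} (hG : Continuous G) :
    IsBddMeas ((polydisc n).indicator G) := by
  refine ⟨hG.measurable.indicator (measurableSet_polydisc n), ?_⟩
  have hc : IsCompact (univ.pi fun _ : Fin n => Metric.closedBall (0 : ℂ) 1) :=
    isCompact_univ_pi fun _ => isCompact_closedBall _ _
  obtain ⟨C, hC⟩ := hc.exists_bound_of_continuousOn hG.continuousOn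
  refine ⟨max C 0, fun z => ?_⟩
  by_cases hz : z ∈ polydisc n
  · rw [indicator_of_mem hz]
    refine (hC z fun j _ => ?_).trans (le_max_left _ _)
    simpa using (hz j).le
  · rw [indicator_of_notMem hz]; simp

/-- The kernel of the canonical solution operator of the unit disc. -/
noncomputable def canKernel : ℂ → ℂ → ℂ := discKernel (regKernel 0)

theorem exists_isDiscKernel_canKernel : ∃ A, IsDiscKernel A canKernel := by
  obtain ⟨B, hB, -⟩ := exists_isDiscKernel_regKernel (τ := 1 / 2) (by norm_num) le_rfl
  exact ⟨B, hB 0⟩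

/-- For `p ≠ []` this is `∏_{i ∈ l} (1 - Tᵢ ∂̄ᵢ)` applied to the iterated derivative indexed by
`p`, where `Tᵢ` is the canonical solution operator in the `i`-th variable. -/
noncomputable def bergSum (f : Fin n → (Fin n → ℂ) → ℂ) :
    List (Fin n) → List (Fin n) → (Fin n → ℂ) → ℂ
  | [], p => (polydisc n).indicator (dbarIter f p)
  | i :: l, p => fun z => bergSum f l p z - discOp i canKernel (bergSum f l (i :: p)) z

/-- The canonical solution built from the variables in `l`. -/
noncomputable def canSol (f : Fin n → (Fin n → ℂ) → ℂ) : List (Fin n) → (Fin n → ℂ) → ℂ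
  | [] => fun _ => 0
  | i :: l => fun z => canSol f l z + discOp i canKernel (bergSum f l [i]) z

theorem discOp_zero (i : Fin n) (κ : ℂ → ℂ → ℂ) : discOp i κ (fun _ => 0) = fun _ => 0 := by
  ext z; simp [discOp]

namespace IsSmoothClosed

variable {f : Fin n → (Fin n → ℂ) → ℂ}

theorem isBddMeas_bergSum (hf : IsSmoothClosed f) (l p : List (Fin n)) :
    IsBddMeas (bergSum f l p) := by
  obtain ⟨A, hA⟩ := exists_isDiscKernel_canKernel
  induction l generalizing p with
  | nil => exact isBddMeas_indicator (hf.contDiff_dbarIter p).continuous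
  | cons i l ih => exact (ih p).sub ((ih (i :: p)).discOp i hA)

theorem isBddMeas_canSol (hf : IsSmoothClosed f) (l : List (Fin n)) : IsBddMeas (canSol f l) := by
  obtain ⟨A, hA⟩ := exists_isDiscKernel_canKernel
  induction l with
  | nil => exact .zero
  | cons i l ih => exact ih.add ((hf.isBddMeas_bergSum l [i]).discOp i hA)

theorem bergSum_perm (hf : IsSmoothClosed f) (l : List (Fin n)) {p p' : List (Fin n)}
    (h : p.Perm p') : bergSum f l p = bergSum f l p' := by
  induction l generalizing p p' with
  | nil => exact indicator_congr (hf.dbarIter_perm h)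
  | cons i l ih => simp only [bergSum, ih h, ih (h.cons i)]

/-- The derivative passes through every Tᵢ with i ≠ k, and symmetry of the iterated derivative
brings the new index to the front. -/
theorem hasSliceDbar_bergSum_of_notMem (hf : IsSmoothClosed f) {k : Fin n} {l : List (Fin n)}
    (hk : k ∉ l) {p : List (Fin n)} (hp : p ≠ []) :
    HasSliceDbar k (bergSum f l p) (bergSum f l (k :: p)) := by
  obtain ⟨A, hA⟩ := exists_isDiscKernel_canKernel
  induction l generalizing p with
  | nil =>
    simp only [bergSum, dbarIter_cons f k hp]
    exact .of_contDiff k (hf.contDiff_dbarIter p)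
  | cons i l ih =>
    rw [List.mem_cons, not_or] at hk
    simp only [bergSum]
    rw [hf.bergSum_perm l (List.Perm.swap k i p)]
    exact (ih hk.2 hp).sub ((ih hk.2 (List.cons_ne_nil i p)).discOp_of_ne (Ne.symm hk.1) hA
      (hf.isBddMeas_bergSum _ _) (hf.isBddMeas_bergSum _ _)) (hf.isBddMeas_bergSum _ _)
      (hf.isBddMeas_bergSum _ _) ((hf.isBddMeas_bergSum _ _).discOp i hA)
      ((hf.isBddMeas_bergSum _ _).discOp i hA)

/-- Since ∂̄ₖTₖ = 1, the derivative ∂̄ₖ annihilates the factor 1 - Tₖ∂̄ₖ, and operators in other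
variables preserve this. -/
theorem hasSliceDbar_bergSum_of_mem (hf : IsSmoothClosed f) {k : Fin n} {l : List (Fin n)}
    (hk : k ∈ l) (hl : l.Nodup) {p : List (Fin n)} (hp : p ≠ []) :
    HasSliceDbar k (bergSum f l p) fun _ => 0 := by
  obtain ⟨A, hA⟩ := exists_isDiscKernel_canKernel
  induction l generalizing p with
  | nil => simp at hk
  | cons i l ih =>
    rw [List.nodup_cons] at hl
    simp only [bergSum]
    rcases List.mem_cons.1 hk with rfl | hkl
    · have h := (hf.hasSliceDbar_bergSum_of_notMem hl.1 hp).sub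
        (HasSliceDbar.discOp_self k hA (hf.isBddMeas_bergSum l (k :: p)))
        (hf.isBddMeas_bergSum _ _) (hf.isBddMeas_bergSum _ _)
        ((hf.isBddMeas_bergSum _ _).discOp k hA) (hf.isBddMeas_bergSum _ _)
      simpa [canKernel] using h
    · have hik : i ≠ k := fun h => hl.1 (h ▸ hkl)
      have h := (ih hkl hl.2 hp).sub ((ih hkl hl.2 (List.cons_ne_nil i p)).discOp_of_ne hik hA
        (hf.isBddMeas_bergSum _ _) .zero) (hf.isBddMeas_bergSum _ _) .zero
        ((hf.isBddMeas_bergSum _ _).discOp i hA) (IsBddMeas.zero.discOp i hA)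
      simpa [discOp_zero] using h

/-- Telescoping: adding variable i contributes Tᵢ∂̄ₖ∏(1 - T∂̄)fᵢ, and closedness rewrites ∂̄ₖfᵢ as
∂̄ᵢfₖ, which is the change in ∏(1 - T∂̄)fₖ. The subtracted term is the defect left until variable k
is treated. -/
theorem hasSliceDbar_canSol_of_notMem (hf : IsSmoothClosed f) {k : Fin n} {l : List (Fin n)}
    (hk : k ∉ l) :
    HasSliceDbar k (canSol f l) fun z => bergSum f [] [k] z - bergSum f l [k] z := by
  obtain ⟨A, hA⟩ := exists_isDiscKernel_canKernel
  induction l with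
  | nil => simpa [canSol] using HasSliceDbar.zero k
  | cons i l ih =>
    rw [List.mem_cons, not_or] at hk
    have h := (ih hk.2).add ((hf.hasSliceDbar_bergSum_of_notMem hk.2
      (List.cons_ne_nil i [])).discOp_of_ne (Ne.symm hk.1) hA
      (hf.isBddMeas_bergSum _ _) (hf.isBddMeas_bergSum _ _)) (hf.isBddMeas_canSol _)
      ((hf.isBddMeas_bergSum _ _).sub (hf.isBddMeas_bergSum _ _))
      ((hf.isBddMeas_bergSum _ _).discOp i hA) ((hf.isBddMeas_bergSum _ _).discOp i hA)
    rw [hf.bergSum_perm l (List.Perm.swap i k [])] at h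
    have e : (fun z => bergSum f [] [k] z - bergSum f (i :: l) [k] z) = fun z =>
        bergSum f [] [k] z - bergSum f l [k] z + discOp i canKernel (bergSum f l [i, k]) z :=
      funext fun z => sub_sub_eq_add_sub _ _ _ |>.trans (by ring)
    rw [e]
    exact h

/-- Adding variable k supplies precisely the missing defect, again by ∂̄ₖTₖ = 1. Variables added
afterwards apply Tᵢ to functions already annihilated by ∂̄ₖ, so they do no damage. -/
theorem hasSliceDbar_canSol_of_mem (hf : IsSmoothClosed f) {k : Fin n} {l : List (Fin n)}
    (hk : k ∈ l) (hl : l.Nodup) : HasSliceDbar k (canSol f l) (bergSum f [] [k]) := by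
  obtain ⟨A, hA⟩ := exists_isDiscKernel_canKernel
  induction l with
  | nil => simp at hk
  | cons i l ih =>
    rw [List.nodup_cons] at hl
    rcases List.mem_cons.1 hk with rfl | hkl
    · have h := (hf.hasSliceDbar_canSol_of_notMem hl.1).add
        (HasSliceDbar.discOp_self k hA (hf.isBddMeas_bergSum l [k]))
        (hf.isBddMeas_canSol _) ((hf.isBddMeas_bergSum _ _).sub (hf.isBddMeas_bergSum _ _))
        ((hf.isBddMeas_bergSum _ _).discOp k hA) (hf.isBddMeas_bergSum _ _)
      simpa [canKernel, canSol] using h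
    · have hik : i ≠ k := fun h => hl.1 (h ▸ hkl)
      have h := (ih hkl hl.2).add ((hf.hasSliceDbar_bergSum_of_mem hkl hl.2
        (List.cons_ne_nil i [])).discOp_of_ne hik hA (hf.isBddMeas_bergSum _ _) .zero)
        (hf.isBddMeas_canSol _) (hf.isBddMeas_bergSum _ _)
        ((hf.isBddMeas_bergSum _ _).discOp i hA) (IsBddMeas.zero.discOp i hA)
      simpa [discOp_zero, canSol] using h

theorem integral_canSol_mul_conj_eq_zero (hf : IsSmoothClosed f) (l : List (Fin n))
    {g : (Fin n → ℂ) → ℂ} (hg : DifferentiableOn ℂ g (polydisc n))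
    (hgi : IntegrableOn g (polydisc n)) :
    ∫ z in polydisc n, canSol f l z * conj (g z) = 0 := by
  obtain ⟨A, hA⟩ := exists_isDiscKernel_canKernel
  have hgc : IntegrableOn (fun z => conj (g z)) (polydisc n) :=
    (Complex.conjCLE : ℂ →L[ℝ] ℂ).integrable_comp hgi
  have hint : ∀ a : (Fin n → ℂ) → ℂ, IsBddMeas a →
      IntegrableOn (fun z => a z * conj (g z)) (polydisc n) := fun a ha => by
    simp only [mul_comm _ (conj (g _))]
    exact ha.integrable_mul hgc measurable_id
  induction l with
  | nil => simp [canSol]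
  | cons i l ih =>
    simp only [canSol, add_mul]
    rw [integral_add (hint _ (hf.isBddMeas_canSol l))
      (hint _ ((hf.isBddMeas_bergSum _ _).discOp i hA)), ih, zero_add]
    exact integral_discOp_mul_conj_eq_zero i hA (hf.isBddMeas_bergSum l [i]) hg hgi

/-- Existence of the canonical solution for smooth data. -/
theorem isCanonicalSolution (hf : IsSmoothClosed f)
    {F : (Fin n → ℂ) → EuclideanSpace ℂ (Fin n)} (hF : ∀ z ∈ polydisc n, ∀ j, F z j = f j z) :
    IsCanonicalSolution (polydisc n) F (canSol f (List.finRange n)) := by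
  have hbm := hf.isBddMeas_canSol (List.finRange n)
  refine ⟨?_, fun j φ hφ => ?_, fun g hg hg2 => ?_⟩
  · obtain ⟨C, hC⟩ := hbm.2
    exact MemLp.of_bound hbm.1.aestronglyMeasurable C (.of_forall hC)
  · rw [(hf.hasSliceDbar_canSol_of_mem (List.mem_finRange j)
      (List.nodup_finRange n)).integral_mul_wirtingerBar hbm (hf.isBddMeas_bergSum _ _) hφ]
    congr 1
    refine setIntegral_congr_fun (measurableSet_polydisc n) fun z hz => ?_
    simp only [bergSum, dbarIter]
    rw [indicator_of_mem hz, hF z hz]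
  · exact hf.integral_canSol_mul_conj_eq_zero _ hg (hg2.integrable (by norm_num))

end IsSmoothClosed

/-! ### The a priori estimate -/

/-- A seminorm-like functional for which Schur kernels act boundedly in every variable. -/
structure IsOpNorm (N : ((Fin n → ℂ) → ℂ) → ℝ≥0∞) : Prop where
  zero : N (fun _ => 0) = 0
  add_le : ∀ a b, Measurable a → Measurable b → N (fun z => a z + b z) ≤ N a + N b
  sub_le : ∀ a b, Measurable a → Measurable b → N (fun z => a z - b z) ≤ N a + N b
  op : ∀ (i : Fin n) (A : ℝ≥0) (κ : ℂ → ℂ → ℂ) (a : (Fin n → ℂ) → ℂ), IsDiscKernel A κ →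
    Measurable a → N (discOp i κ a) ≤ A * N a
  lt_top : ∀ a, IsBddMeas a → N a < ⊤

theorem isOpNorm_iSup : IsOpNorm (n := n) fun a => ⨆ z, ‖a z‖ₑ where
  zero := by simp
  add_le a b _ _ := iSup_le fun z => (enorm_add_le _ _).trans
    (add_le_add (le_iSup (fun z => ‖a z‖ₑ) z) (le_iSup (fun z => ‖b z‖ₑ) z))
  sub_le a b _ _ := iSup_le fun z => enorm_sub_le.trans
    (add_le_add (le_iSup (fun z => ‖a z‖ₑ) z) (le_iSup (fun z => ‖b z‖ₑ) z))
  op i _ _ a hκ _ := iSup_enorm_discOp_le i hκ a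
  lt_top a ha := by
    obtain ⟨C, hC⟩ := ha.2
    refine lt_of_le_of_lt (iSup_le fun z => ?_) (ENNReal.ofReal_lt_top (r := C))
    rw [← ofReal_norm]; exact ENNReal.ofReal_le_ofReal (hC z)

theorem isOpNorm_lintegral : IsOpNorm (n := n) fun a => ∫⁻ z in polydisc n, ‖a z‖ₑ where
  zero := by simp
  add_le a b ha _ := by
    rw [← lintegral_add_left ha.enorm]
    exact lintegral_mono fun z => enorm_add_le _ _
  sub_le a b ha _ := by
    rw [← lintegral_add_left ha.enorm]
    exact lintegral_mono fun z => enorm_sub_le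
  op i _ _ _ hκ ha := lintegral_enorm_discOp_le i hκ ha
  lt_top _ ha := ha.integrableOn.2

/-! ### Products of one-variable operators -/

/-- The product of the operators with kernels `κ i`, for `i` in a list. -/
noncomputable def opList (κ : Fin n → ℂ → ℂ → ℂ) :
    List (Fin n) → ((Fin n → ℂ) → ℂ) → (Fin n → ℂ) → ℂ
  | [], a => a
  | i :: p, a => opList κ p (discOp i (κ i) a)

theorem IsBddMeas.opList {κ : Fin n → ℂ → ℂ → ℂ} (hκ : ∀ i, ∃ A, IsDiscKernel A (κ i))
    (p : List (Fin n)) {a : (Fin n → ℂ) → ℂ} (ha : IsBddMeas a) : IsBddMeas (opList κ p a) := by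
  induction p generalizing a with
  | nil => exact ha
  | cons i p ih =>
    obtain ⟨A, hA⟩ := hκ i
    exact ih (ha.discOp i hA)

theorem opList_congr {κ κ' : Fin n → ℂ → ℂ → ℂ} {p : List (Fin n)} (h : ∀ i ∈ p, κ i = κ' i)
    (a : (Fin n → ℂ) → ℂ) : opList κ p a = opList κ' p a := by
  induction p generalizing a with
  | nil => rfl
  | cons i p ih =>
    rw [opList, opList, h i List.mem_cons_self, ih fun j hj => h j (List.mem_cons_of_mem i hj)]

theorem opList_sub {κ : Fin n → ℂ → ℂ → ℂ} (hκ : ∀ i, ∃ A, IsDiscKernel A (κ i))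
    (p : List (Fin n)) {a b : (Fin n → ℂ) → ℂ} (ha : IsBddMeas a) (hb : IsBddMeas b) :
    opList κ p (fun z => a z - b z) = fun z => opList κ p a z - opList κ p b z := by
  induction p generalizing a b with
  | nil => rfl
  | cons i p ih =>
    obtain ⟨A, hA⟩ := hκ i
    simp only [opList]
    rw [discOp_sub i hA ha hb, ih (ha.discOp i hA) (hb.discOp i hA)]

theorem opList_discOp_comm {κ : Fin n → ℂ → ℂ → ℂ} (hκ : ∀ i, ∃ A, IsDiscKernel A (κ i))
    {p : List (Fin n)} {i : Fin n} (hi : i ∉ p) {A : ℝ≥0} {κ' : ℂ → ℂ → ℂ}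
    (hκ' : IsDiscKernel A κ') {a : (Fin n → ℂ) → ℂ} (ha : IsBddMeas a) :
    opList κ p (discOp i κ' a) = discOp i κ' (opList κ p a) := by
  induction p generalizing a with
  | nil => rfl
  | cons k p ih =>
    rw [List.mem_cons, not_or] at hi
    obtain ⟨B, hB⟩ := hκ k
    rw [opList, opList, discOp_comm (Ne.symm hi.1) hB hκ' ha, ih hi.2 (ha.discOp k hB)]

theorem opList_perm {κ : Fin n → ℂ → ℂ → ℂ} (hκ : ∀ i, ∃ A, IsDiscKernel A (κ i))
    {p p' : List (Fin n)} (h : p.Perm p') (hp : p.Nodup) {a : (Fin n → ℂ) → ℂ}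
    (ha : IsBddMeas a) : opList κ p a = opList κ p' a := by
  induction h generalizing a with
  | nil => rfl
  | cons i _ ih =>
    obtain ⟨A, hA⟩ := hκ i
    exact ih (List.nodup_cons.1 hp).2 (ha.discOp i hA)
  | swap i k l =>
    obtain ⟨A, hA⟩ := hκ i
    obtain ⟨B, hB⟩ := hκ k
    have hne : i ≠ k := by
      rintro rfl
      exact (List.nodup_cons.1 hp).1 List.mem_cons_self
    rw [opList, opList, opList, opList, discOp_comm hne hA hB ha]
  | trans h1 _ ih1 ih2 => rw [ih1 hp ha, ih2 (h1.nodup_iff.1 hp) ha]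

/-- A product of operators over distinct variables is linear in each kernel separately. -/
theorem opList_sub_of_eq_off {κ κ' δ : Fin n → ℂ → ℂ → ℂ}
    (hκ : ∀ i, ∃ A, IsDiscKernel A (κ i)) (hκ' : ∀ i, ∃ A, IsDiscKernel A (κ' i))
    (hδ : ∀ i, ∃ A, IsDiscKernel A (δ i)) {j : Fin n} (h : ∀ i, i ≠ j → κ i = κ' i ∧ κ i = δ i)
    (hj : δ j = fun z w => κ j z w - κ' j z w) {p : List (Fin n)} (hp : p.Nodup) (hjp : j ∈ p)
    {a : (Fin n → ℂ) → ℂ} (ha : IsBddMeas a) :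
    (fun z => opList κ p a z - opList κ' p a z) = opList δ p a := by
  induction p generalizing a with
  | nil => simp at hjp
  | cons i p ih =>
    rw [List.nodup_cons] at hp
    obtain ⟨A, hA⟩ := hκ i
    obtain ⟨A', hA'⟩ := hκ' i
    simp only [opList]
    rcases eq_or_ne i j with rfl | hij
    · have hne : ∀ k ∈ p, k ≠ i := fun k hk hki => hp.1 (hki ▸ hk)
      rw [opList_congr (κ := κ) (κ' := δ) fun k hk => (h k (hne k hk)).2,
        opList_congr (κ := κ') (κ' := δ) fun k hk =>
          (h k (hne k hk)).1.symm.trans (h k (hne k hk)).2,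
        ← opList_sub hδ p (ha.discOp i hA) (ha.discOp i hA'), hj, discOp_kernel_sub i hA hA' ha]
    · rw [← (h i hij).1, ← (h i hij).2]
      refine ih hp.2 ?_ (ha.discOp i hA)
      rcases List.mem_cons.1 hjp with h' | h'
      · exact absurd h'.symm hij
      · exact h'

namespace IsOpNorm

variable {N : ((Fin n → ℂ) → ℂ) → ℝ≥0∞}

theorem opList_le (hN : IsOpNorm N) {κ : Fin n → ℂ → ℂ → ℂ} {A : Fin n → ℝ≥0}
    (hκ : ∀ i, IsDiscKernel (A i) (κ i)) (p : List (Fin n)) {a : (Fin n → ℂ) → ℂ}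
    (ha : IsBddMeas a) : N (opList κ p a) ≤ (p.map A).prod * N a := by
  induction p generalizing a with
  | nil => simp [opList]
  | cons i p ih =>
    calc N (opList κ p (discOp i (κ i) a)) ≤ (p.map A).prod * N (discOp i (κ i) a) :=
          ih (ha.discOp i (hκ i))
      _ ≤ (p.map A).prod * (A i * N a) := by gcongr; exact hN.op i _ _ _ (hκ i) ha.1
      _ = _ := by rw [List.map_cons, List.prod_cons, ENNReal.coe_mul]; ring

/-- Replacing one kernel after the other in a product of operators. -/
theorem opList_sub_le (hN : IsOpNorm N) {κ κ' : ℂ → ℂ → ℂ} {A A' D : ℝ≥0}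
    (hκ : IsDiscKernel A κ) (hκ' : IsDiscKernel A' κ')
    (hd : IsDiscKernel D fun z w => κ z w - κ' z w) {p : List (Fin n)} (hp : p.Nodup)
    {a : (Fin n → ℂ) → ℂ} (ha : IsBddMeas a) (β : Fin n → ℝ≥0∞)
    (hβ : ∀ j ∈ p, ∀ δ : Fin n → ℂ → ℂ → ℂ, (∀ i, i ≠ j → δ i = κ ∨ δ i = κ') →
      (δ j = fun z w => κ z w - κ' z w) → N (opList δ p a) ≤ β j) :
    N (fun z => opList (fun _ => κ) p a z - opList (fun _ => κ') p a z) ≤ ∑ j, β j := by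
  classical
  -- Telescoping over the set s of variables that carry κ, the others carrying κ'. Enlarging s by j
  -- changes one kernel, so each step is a product with κ - κ' in position j.
  have key : ∀ s : Finset (Fin n), N (fun z => opList (fun i => if i ∈ s then κ else κ') p a z -
      opList (fun _ => κ') p a z) ≤ ∑ j ∈ s, β j := by
    intro s
    have hmix : ∀ (s : Finset (Fin n)) (i : Fin n),
        ∃ B, IsDiscKernel B (if i ∈ s then κ else κ') := fun s i => by
      split_ifs
      exacts [⟨A, hκ⟩, ⟨A', hκ'⟩]
    have hκ'' : ∀ _ : Fin n, ∃ B, IsDiscKernel B κ' := fun _ => ⟨A', hκ'⟩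
    induction s using Finset.induction_on with
    | empty => simp [hN.zero]
    | insert j s hj ih =>
      rw [Finset.sum_insert hj]
      have hb := fun s => IsBddMeas.opList (hmix s) p ha
      have hb' := IsBddMeas.opList hκ'' p ha
      have hstep : N (fun z => opList (fun i => if i ∈ insert j s then κ else κ') p a z -
          opList (fun i => if i ∈ s then κ else κ') p a z) ≤ β j := by
        by_cases hjp : j ∈ p
        · set δ : Fin n → ℂ → ℂ → ℂ := fun i => if i = j then fun z w => κ z w - κ' z w else
            if i ∈ s then κ else κ' with hδ
          have hδj : δ j = fun z w => κ z w - κ' z w := by simp [hδ]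
          have hδk : ∀ i, ∃ B, IsDiscKernel B (δ i) := fun i => by
            simp only [hδ]
            split_ifs
            exacts [⟨D, hd⟩, ⟨A, hκ⟩, ⟨A', hκ'⟩]
          rw [opList_sub_of_eq_off (hmix _) (hmix s) hδk (j := j) (fun i hi => by simp [hδ, hi])
            (by simp [hδ, hj]) hp hjp ha]
          refine hβ j hjp δ (fun i hi => ?_) hδj
          simp only [hδ, if_neg hi]
          split_ifs <;> simp
        · have : opList (fun i => if i ∈ insert j s then κ else κ') p a =
              opList (fun i => if i ∈ s then κ else κ') p a := by
            refine opList_congr (fun i hi => ?_) a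
            have : i ≠ j := fun h => hjp (h ▸ hi)
            simp [this]
          rw [this]
          simp [hN.zero]
      refine le_trans (le_of_eq ?_) ((hN.add_le _ _ ((hb (insert j s)).sub (hb s)).1
        ((hb s).sub hb').1).trans (add_le_add hstep ih))
      congr 1
      ext z
      ring
  simpa using key Finset.univ

end IsOpNorm

namespace IsSmoothClosed

variable {f : Fin n → (Fin n → ℂ) → ℂ} {N : ((Fin n → ℂ) → ℂ) → ℝ≥0∞}

theorem isBddMeas_indicator_dbarIter (hf : IsSmoothClosed f) (p : List (Fin n)) :
    IsBddMeas ((polydisc n).indicator (dbarIter f p)) :=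
  isBddMeas_indicator (hf.contDiff_dbarIter p).continuous

/-- Integrating by parts in all variables but one. -/
theorem opList_concat_le (hf : IsSmoothClosed f) (hN : IsOpNorm N) {κ : Fin n → ℂ → ℂ → ℂ}
    (hκ : ∀ i, ∃ A, IsDiscKernel A (κ i)) {j : Fin n} {D R : ℝ≥0} (hj : IsDiscKernel D (κ j))
    {q : List (Fin n)} (hq : (q ++ [j]).Nodup)
    (hreg : ∀ i ∈ q, ∃ ε : ℝ, 0 < ε ∧ κ i = discKernel (regKernel ε) ∧
      IsDiscKernel R (discKernel (regKernelDeriv ε))) :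
    N (opList κ (q ++ [j]) ((polydisc n).indicator (dbarIter f (q ++ [j])))) ≤
      R ^ q.length * D * N ((polydisc n).indicator (f j)) := by
  induction q with
  | nil =>
    simpa [opList, dbarIter] using hN.op j D (κ j) _ hj (hf.isBddMeas_indicator_dbarIter [j]).1
  | cons i q ih =>
    obtain ⟨ε, hε, hκi, hR⟩ := hreg i List.mem_cons_self
    rw [List.cons_append, List.nodup_cons] at hq
    have hne : q ++ [j] ≠ [] := by simp
    have hb := hf.isBddMeas_indicator_dbarIter (q ++ [j])
    rw [List.cons_append, opList, hκi, dbarIter_cons f i hne,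
      discOp_regKernel_wirtingerBar i hε (hf.contDiff_dbarIter _),
      opList_discOp_comm hκ hq.1 hR hb]
    calc _ ≤ R * N (opList κ (q ++ [j]) ((polydisc n).indicator (dbarIter f (q ++ [j])))) :=
          hN.op i R _ _ hR (hb.opList hκ _).1
      _ ≤ R * (R ^ q.length * D * N ((polydisc n).indicator (f j))) := by
          gcongr
          exact ih hq.2 fun k hk => hreg k (List.mem_cons_of_mem i hk)
      _ = _ := by rw [List.length_cons, pow_succ]; ring

/-- Both the operators and the iterated derivative are symmetric in p, so j may be moved to the end;
then fⱼ is the coefficient left undifferentiated, and the kernel in position j, here possibly a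
difference of two scales, is never differentiated. The assumption 1 ≤ R makes the exponent uniform
in the length of p. -/
theorem opList_le_of_mem (hf : IsSmoothClosed f) (hN : IsOpNorm N) {κ : Fin n → ℂ → ℂ → ℂ}
    (hκ : ∀ i, ∃ A, IsDiscKernel A (κ i)) {j : Fin n} {D R : ℝ≥0} (hR : 1 ≤ R)
    (hj : IsDiscKernel D (κ j)) {p : List (Fin n)} (hp : p.Nodup) (hjp : j ∈ p)
    (hreg : ∀ i, i ≠ j → ∃ ε : ℝ, 0 < ε ∧ κ i = discKernel (regKernel ε) ∧
      IsDiscKernel R (discKernel (regKernelDeriv ε))) :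
    N (opList κ p ((polydisc n).indicator (dbarIter f p))) ≤
      R ^ (n - 1) * D * N ((polydisc n).indicator (f j)) := by
  have hperm : p.Perm (p.erase j ++ [j]) :=
    (List.perm_cons_erase hjp).trans (List.perm_append_singleton j _).symm
  have hnd : (p.erase j ++ [j]).Nodup := hperm.nodup_iff.1 hp
  rw [opList_perm hκ hperm hp (hf.isBddMeas_indicator_dbarIter p),
    indicator_congr (hf.dbarIter_perm hperm)]
  refine (hf.opList_concat_le hN hκ hj hnd fun i hi => hreg i ?_).trans ?_
  · rintro rfl
    rw [List.nodup_append] at hnd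
    exact hnd.2.2 i hi i (by simp) rfl
  · gcongr
    · exact_mod_cast hR
    · have := hnd.length_le_card
      simp only [List.length_append, List.length_singleton, Fintype.card_fin] at this
      omega

end IsSmoothClosed

/-! ### The geometric sequence of regularizations -/

theorem IsDiscKernel.mono {A A' : ℝ≥0} {κ : ℂ → ℂ → ℂ} (h : IsDiscKernel A κ) (h' : A ≤ A') :
    IsDiscKernel A' κ :=
  ⟨h.1, fun w => (h.2 w).trans (by exact_mod_cast h'), fun w => (h.3 w).trans (by exact_mod_cast h')⟩

/-- A crude bound without integration by parts. Its right side involves derivatives of the data, so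
it only serves to show that the regularized products converge, not to estimate the limit. -/
theorem IsOpNorm.opList_le_of_mem {N : ((Fin n → ℂ) → ℂ) → ℝ≥0∞} (hN : IsOpNorm N)
    {κ : Fin n → ℂ → ℂ → ℂ} {B D : ℝ≥0} {j : Fin n} (hj : IsDiscKernel D (κ j))
    (hκ : ∀ i, i ≠ j → IsDiscKernel B (κ i)) {p : List (Fin n)} (hp : p.Nodup) (hjp : j ∈ p)
    {a : (Fin n → ℂ) → ℂ} (ha : IsBddMeas a) :
    N (opList κ p a) ≤ D * B ^ (p.length - 1) * N a := by
  classical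
  have h := hN.opList_le (A := fun i => if i = j then D else B) (κ := κ) (fun i => by
    split_ifs with h
    · exact h ▸ hj
    · exact hκ i h) p ha
  refine h.trans ?_
  gcongr
  rw [← List.prod_map_erase _ hjp, if_pos rfl]
  have h1 : ((p.erase j).map fun i => if i = j then D else B) = (p.erase j).map fun _ => B := by
    refine List.map_congr_left fun i hi => if_neg ?_
    rintro rfl
    exact (hp.not_mem_erase hi).elim
  rw [h1, List.map_const', List.prod_replicate, List.length_erase_of_mem hjp]
  push_cast
  exact le_rfl

/-- The choice is τ = 1/(2n) and ε m = 2^(-2nm). Then the loss ε^(-τ) is 2^m per integrated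
variable, and the gain ε^(1/2) from changing scale is 2^(-nm). -/
theorem exists_regKernel_sequence (hn : 0 < n) : ∃ B : ℝ≥0, 1 ≤ B ∧ ∃ ε : ℕ → ℝ, (∀ m, 0 < ε m) ∧
    IsDiscKernel B canKernel ∧
    (∀ m, IsDiscKernel B (discKernel (regKernel (ε m)))) ∧
    (∀ m, IsDiscKernel (B * 2 ^ m) (discKernel (regKernelDeriv (ε m)))) ∧
    (∀ m, IsDiscKernel (B * (1 / 2) ^ (n * m)) fun z w =>
      discKernel (regKernel (ε m)) z w - discKernel (regKernel (ε (m + 1))) z w) ∧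
    (∀ m, IsDiscKernel (B * (1 / 2) ^ (n * m)) fun z w =>
      discKernel (regKernel (ε m)) z w - canKernel z w) := by
  have hn' : (1 : ℝ) ≤ n := by exact_mod_cast hn
  obtain ⟨B, h1, h2, h3⟩ := exists_isDiscKernel_regKernel (τ := 1 / (2 * n)) (by positivity) (by
    rw [div_le_div_iff₀ (by positivity) (by norm_num)]; linarith)
  set ε : ℕ → ℝ≥0 := fun m => (1 / 2) ^ (2 * n * m) with hε
  have hpos : ∀ m, 0 < ε m := fun m => by positivity
  have hhalf : ∀ m, ε m ^ (1 / 2 : ℝ) = (1 / 2) ^ (n * m) := fun m => by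
    change ((1 / 2 : ℝ≥0) ^ (2 * n * m)) ^ (1 / 2 : ℝ) = _
    rw [← NNReal.rpow_natCast, ← NNReal.rpow_natCast, ← NNReal.rpow_mul]
    congr 1
    push_cast; ring
  have htau : ∀ m, ε m ^ (-(1 / (2 * n)) : ℝ) = 2 ^ m := fun m => by
    change ((1 / 2 : ℝ≥0) ^ (2 * n * m)) ^ (-(1 / (2 * n)) : ℝ) = _
    rw [← NNReal.rpow_natCast, ← NNReal.rpow_mul, one_div, NNReal.inv_rpow,
      ← NNReal.rpow_neg, ← NNReal.rpow_natCast]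
    congr 1
    push_cast; field_simp
  have hanti : ∀ m, ε (m + 1) ≤ ε m := fun m =>
    pow_le_pow_of_le_one (by positivity) (by
      rw [div_le_one (by norm_num)]; norm_num) (by gcongr; omega)
  refine ⟨max B 1, le_max_right _ _, fun m => ε m, fun m => by exact_mod_cast hpos m,
    (h1 0).mono (le_max_left _ _), fun m => (h1 _).mono (le_max_left _ _), fun m => ?_,
    fun m => ?_, fun m => ?_⟩
  · have := h3 (ε m) (hpos m)
    rw [htau] at this
    exact this.mono (by gcongr; exact le_max_left _ _)
  · have := h2 (ε m) (ε (m + 1)) (hanti m)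
    rw [hhalf] at this
    exact this.mono (by gcongr; exact le_max_left _ _)
  · have := h2 (ε m) 0 zero_le
    rw [hhalf] at this
    exact this.mono (by gcongr; exact le_max_left _ _)

/-- At most n - 1 losses of 2^(m+1) against one gain of 2^(-nm) leave a factor 2^(-m), up to a
constant. -/
theorem geometric_weight_le (B : ℝ≥0) (hn : 0 < n) (m : ℕ) :
    (B * 2 ^ (m + 1)) ^ (n - 1) * (B * (1 / 2) ^ (n * m)) ≤ (2 * B) ^ n * (1 / 2) ^ m := by
  obtain ⟨k, rfl⟩ : ∃ k, n = k + 1 := ⟨n - 1, by omega⟩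
  have h : (2 : ℝ≥0) ^ (m * k) * (1 / 2) ^ (m * k) = 1 := by
    rw [← mul_pow]; norm_num
  calc (B * 2 ^ (m + 1)) ^ (k + 1 - 1) * (B * (1 / 2) ^ ((k + 1) * m))
      = B ^ (k + 1) * 2 ^ k * (1 / 2) ^ m * (2 ^ (m * k) * (1 / 2) ^ (m * k)) := by
        rw [Nat.add_sub_cancel, mul_pow, ← pow_mul, show (m + 1) * k = m * k + k by ring,
          show (k + 1) * m = m * k + m by ring, pow_add, pow_add, pow_add]
        ring
    _ = B ^ (k + 1) * 2 ^ k * (1 / 2) ^ m := by rw [h, mul_one]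
    _ ≤ B ^ (k + 1) * 2 ^ (k + 1) * (1 / 2) ^ m := by
        gcongr
        · norm_num
        · omega
    _ = _ := by rw [mul_pow]; ring

/-- The a priori estimate for `∏_{i ∈ p} Tᵢ` applied to the iterated derivative indexed by `p`. -/
theorem exists_opList_canKernel_le (n : ℕ) : ∃ C : ℝ≥0, ∀ f : Fin n → (Fin n → ℂ) → ℂ,
    IsSmoothClosed f → ∀ N, IsOpNorm N → ∀ p : List (Fin n), p.Nodup → p ≠ [] →
      N (opList (fun _ => canKernel) p ((polydisc n).indicator (dbarIter f p))) ≤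
        C * ∑ j, N ((polydisc n).indicator (f j)) := by
  rcases Nat.eq_zero_or_pos n with rfl | hn
  · refine ⟨0, fun f _ N _ p _ hp => ?_⟩
    cases p with
    | nil => exact absurd rfl hp
    | cons i p => exact i.elim0
  obtain ⟨B, hB1, ε, hε, hK, hKε, hR, hd, hd0⟩ := exists_regKernel_sequence hn
  refine ⟨B ^ n + (2 * B) ^ n * 2, fun f hf N hN p hp hne => ?_⟩
  set G := (polydisc n).indicator (dbarIter f p) with hG
  have hGb : IsBddMeas G := hf.isBddMeas_indicator_dbarIter p
  set S := ∑ j, N ((polydisc n).indicator (f j)) with hS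
  set T : ℕ → (Fin n → ℂ) → ℂ := fun m => opList (fun _ => discKernel (regKernel (ε m))) p G with hT
  have hTb : ∀ m, IsBddMeas (T m) := fun m => hGb.opList (fun _ => ⟨B, hKε m⟩) p
  have hT'b : IsBddMeas (opList (fun _ => canKernel) p G) := hGb.opList (fun _ => ⟨B, hK⟩) p
  have hB2 : ∀ m, 1 ≤ B * 2 ^ m := fun m => one_le_mul hB1 (one_le_pow₀ (by norm_num))
  have hR' : ∀ m m', m ≤ m' → IsDiscKernel (B * 2 ^ m') (discKernel (regKernelDeriv (ε m))) :=
    fun m m' h => (hR m).mono (by gcongr; norm_num)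
  -- At the coarsest scale ε 0 = 1 the loss factor is 1, so all variables but one are integrated by
  -- parts at bounded cost.
  have hstart : N (T 0) ≤ B ^ n * S := by
    obtain ⟨j, hj⟩ := List.exists_mem_of_ne_nil p hne
    refine (hf.opList_le_of_mem hN (fun _ => ⟨B, hKε 0⟩) (hB2 0) (hKε 0) hp hj
      fun i _ => ⟨ε 0, hε 0, rfl, hR 0⟩).trans ?_
    rw [pow_zero, mul_one, ← pow_succ, Nat.sub_add_cancel hn]
    gcongr
    exact Finset.single_le_sum (f := fun j => N ((polydisc n).indicator (f j)))
      (fun _ _ => zero_le) (Finset.mem_univ j)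
  -- In each mixed product the variable j carries the difference of scales, and the others carry
  -- scale m or m + 1. The loss 2^(m+1) at the finer scale covers both.
  have hstep : ∀ m, N (fun z => T m z - T (m + 1) z) ≤ ((2 * B) ^ n * (1 / 2) ^ m : ℝ≥0) * S := by
    intro m
    refine (hN.opList_sub_le (hKε m) (hKε (m + 1)) (hd m) hp hGb (fun j =>
      ((B * 2 ^ (m + 1)) ^ (n - 1) * (B * (1 / 2) ^ (n * m)) : ℝ≥0) *
        N ((polydisc n).indicator (f j))) fun j hj δ hδ hδj => ?_).trans ?_
    · have hδk : ∀ i, ∃ A, IsDiscKernel A (δ i) := by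
        intro i
        rcases eq_or_ne i j with rfl | h
        · exact ⟨_, hδj ▸ hd m⟩
        · rcases hδ i h with h' | h'
          · exact ⟨B, h' ▸ hKε m⟩
          · exact ⟨B, h' ▸ hKε (m + 1)⟩
      refine (hf.opList_le_of_mem hN hδk (hB2 (m + 1)) (hδj ▸ hd m) hp hj fun i hi => ?_).trans ?_
      · rcases hδ i hi with h' | h'
        · exact ⟨ε m, hε m, h', hR' m (m + 1) (by omega)⟩
        · exact ⟨ε (m + 1), hε (m + 1), h', hR (m + 1)⟩
      · push_cast
        exact le_rfl
    · rw [← Finset.mul_sum]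
      exact mul_le_mul' (by exact_mod_cast geometric_weight_le B hn m) le_rfl
  have hsum : ∀ M, N (T M) ≤ (B ^ n + (2 * B) ^ n * ∑ m ∈ Finset.range M, (1 / 2) ^ m : ℝ≥0) * S := by
    intro M
    induction M with
    | zero => simpa using hstart
    | succ M ih =>
      have e : T (M + 1) = fun z => T M z - (T M z - T (M + 1) z) := by ext z; ring
      rw [e]
      refine (hN.sub_le _ _ (hTb M).1 ((hTb M).sub (hTb (M + 1))).1).trans
        ((add_le_add ih (hstep M)).trans_eq ?_)
      rw [Finset.sum_range_succ, ← add_mul, ← ENNReal.coe_add]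
      congr 2
      ring
  have hgeom : ∀ M, ∑ m ∈ Finset.range M, (1 / 2 : ℝ≥0) ^ m ≤ 2 := by
    intro M
    rw [← NNReal.coe_le_coe]
    push_cast
    exact sum_geometric_two_le M
  -- Convergence to the true kernels. The constant involves N G, which is finite but not controlled
  -- by f; it drops out in the limit.
  have hlim : ∀ M, N (fun z => T M z - opList (fun _ => canKernel) p G z) ≤
      (n * (B ^ (p.length - 1) * N G) * B) * ((1 / 2) ^ M : ℝ≥0) := by
    intro M
    refine (hN.opList_sub_le (hKε M) hK (hd0 M) hp hGb (fun j =>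
      (B * (1 / 2) ^ (n * M) : ℝ≥0) * B ^ (p.length - 1) * N G) fun j hj δ hδ hδj => ?_).trans ?_
    · refine hN.opList_le_of_mem (hδj ▸ hd0 M) (fun i hi => ?_) hp hj hGb
      rcases hδ i hi with h' | h'
      · exact h' ▸ hKε M
      · exact h' ▸ hK
    · rw [Finset.sum_const, Finset.card_univ, Fintype.card_fin, nsmul_eq_mul, ENNReal.coe_mul]
      have : ((1 / 2) ^ (n * M) : ℝ≥0) ≤ (1 / 2) ^ M := pow_le_pow_of_le_one (by positivity) (by
        rw [div_le_one (by norm_num)]; norm_num) (Nat.le_mul_of_pos_left M hn)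
      calc _ ≤ n * (B * ((1 / 2) ^ M : ℝ≥0) * B ^ (p.length - 1) * N G) := by gcongr
        _ = _ := by ring
  have hfinal : ∀ M, N (opList (fun _ => canKernel) p G) ≤ (B ^ n + (2 * B) ^ n * 2 : ℝ≥0) * S +
      (n * (B ^ (p.length - 1) * N G) * B) * ((1 / 2) ^ M : ℝ≥0) := by
    intro M
    have e : opList (fun _ => canKernel) p G = fun z => T M z -
        (T M z - opList (fun _ => canKernel) p G z) := by ext z; ring
    rw [e]
    refine (hN.sub_le _ _ (hTb M).1 ((hTb M).sub hT'b).1).trans (add_le_add ((hsum M).trans ?_)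
      (hlim M))
    gcongr
    exact hgeom M
  have htend : Filter.Tendsto (fun M : ℕ => (B ^ n + (2 * B) ^ n * 2 : ℝ≥0) * S +
      (n * (B ^ (p.length - 1) * N G) * B) * (((1 / 2) ^ M : ℝ≥0) : ℝ≥0∞)) Filter.atTop
      (nhds ((B ^ n + (2 * B) ^ n * 2 : ℝ≥0) * S + (n * (B ^ (p.length - 1) * N G) * B) * 0)) := by
    refine tendsto_const_nhds.add (ENNReal.Tendsto.const_mul ?_ (Or.inr ?_))
    · rw [← ENNReal.coe_zero, ENNReal.tendsto_coe]
      exact NNReal.tendsto_pow_atTop_nhds_zero_of_lt_one (by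
        rw [div_lt_one (by norm_num)]; norm_num)
    · have := (hN.lt_top G hGb).ne
      finiteness
  rw [mul_zero, add_zero] at htend
  exact ge_of_tendsto' htend hfinal

/-- Each factor 1 - Tₖ∂̄ₖ doubles the number of terms, and every term has the form estimated in
`exists_opList_canKernel_le`. -/
theorem exists_canSol_le (n : ℕ) : ∃ C : ℝ≥0, ∀ f : Fin n → (Fin n → ℂ) → ℂ,
    IsSmoothClosed f → ∀ N, IsOpNorm N →
      N (canSol f (List.finRange n)) ≤ C * ∑ j, N ((polydisc n).indicator (f j)) := by
  obtain ⟨C, hC⟩ := exists_opList_canKernel_le n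
  refine ⟨2 ^ n * C, fun f hf N hN => ?_⟩
  obtain ⟨A, hA⟩ := exists_isDiscKernel_canKernel
  set S := ∑ j, N ((polydisc n).indicator (f j)) with hS
  -- Keeping the product over p applied outside makes the induction close: expanding a factor for i
  -- ∈ l moves i into p, in the derivative and in the operators simultaneously.
  have hW : ∀ l p : List (Fin n), (l ++ p).Nodup → p ≠ [] →
      N (opList (fun _ => canKernel) p (bergSum f l p)) ≤ 2 ^ l.length * C * S := by
    intro l
    induction l with
    | nil =>
      intro p hp hne
      simpa [bergSum] using hC f hf N hN p hp hne
    | cons i l ih =>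
      intro p hp hne
      rw [List.cons_append] at hp
      have hb := hf.isBddMeas_bergSum l
      have hk : ∀ _ : Fin n, ∃ A, IsDiscKernel A canKernel := fun _ => ⟨A, hA⟩
      rw [bergSum, opList_sub hk p (hb p) ((hb _).discOp i hA)]
      refine (hN.sub_le _ _ ((hb p).opList hk p).1 (((hb _).discOp i hA).opList hk p).1).trans ?_
      calc _ ≤ 2 ^ l.length * C * S + 2 ^ l.length * C * S :=
            add_le_add (ih p (List.nodup_cons.1 hp).2 hne)
              (ih (i :: p) (List.nodup_middle.2 hp) (List.cons_ne_nil i p))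
        _ = _ := by rw [List.length_cons, pow_succ]; ring
  have hV : ∀ l : List (Fin n), l.Nodup → N (canSol f l) ≤ 2 ^ l.length * C * S := by
    intro l
    induction l with
    | nil =>
      intro _
      rw [canSol, hN.zero]
      exact zero_le
    | cons i l ih =>
      intro hl
      have hb := hf.isBddMeas_bergSum l [i]
      refine (hN.add_le _ _ (hf.isBddMeas_canSol l).1 (hb.discOp i hA).1).trans ?_
      calc _ ≤ 2 ^ l.length * C * S + 2 ^ l.length * C * S := by
            refine add_le_add (ih (List.nodup_cons.1 hl).2) (hW l [i] ?_ (List.cons_ne_nil i []))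
            exact List.nodup_middle.2 (by simpa using hl)
        _ = _ := by rw [List.length_cons, pow_succ]; ring
  simpa using hV _ (List.nodup_finRange n)

/-! ### Smooth approximation on the polydisc -/

/-- The convolution of `b` with the normalized bump function `φ`, composed with a dilation. -/
noncomputable def mollify (φ : ContDiffBump (0 : Fin n → ℂ)) (r : ℝ) (b : (Fin n → ℂ) → ℂ)
    (z : Fin n → ℂ) : ℂ :=
  convolution (φ.normed volume) b (ContinuousLinearMap.lsmul ℝ ℝ) volume (r • z)

theorem mollify_apply (φ : ContDiffBump (0 : Fin n → ℂ)) (r : ℝ) (b : (Fin n → ℂ) → ℂ)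
    (z : Fin n → ℂ) : mollify φ r b z = ∫ w, φ.normed volume (r • z - w) • b w :=
  convolution_lsmul_swap

theorem mollify_apply' (φ : ContDiffBump (0 : Fin n → ℂ)) (r : ℝ) (b : (Fin n → ℂ) → ℂ)
    (z : Fin n → ℂ) : mollify φ r b z = ∫ w, φ.normed volume w • b (r • z - w) :=
  convolution_def _

theorem contDiff_mollify (φ : ContDiffBump (0 : Fin n → ℂ)) (r : ℝ) {b : (Fin n → ℂ) → ℂ}
    (hb : LocallyIntegrable b) : ContDiff ℝ ∞ (mollify φ r b) :=
  (φ.hasCompactSupport_normed.contDiff_convolution_left _ φ.contDiff_normed hb).comp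
    (contDiff_const_smul r)

theorem integrable_normed_smul (φ : ContDiffBump (0 : Fin n → ℂ)) {b : (Fin n → ℂ) → ℂ}
    (hb : LocallyIntegrable b) (x : Fin n → ℂ) :
    Integrable fun w => φ.normed volume (x - w) • b w :=
  (φ.hasCompactSupport_normed.convolutionExists_left (ContinuousLinearMap.lsmul ℝ ℝ)
    φ.continuous_normed hb x).integrable_swap

theorem mollify_sub (φ : ContDiffBump (0 : Fin n → ℂ)) (r : ℝ) {a b : (Fin n → ℂ) → ℂ}
    (ha : LocallyIntegrable a) (hb : LocallyIntegrable b) (z : Fin n → ℂ) :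
    mollify φ r (fun z => a z - b z) z = mollify φ r a z - mollify φ r b z := by
  simp only [mollify_apply, smul_sub]
  exact integral_sub (integrable_normed_smul φ ha _) (integrable_normed_smul φ hb _)

/-- The derivative is written in terms of the w-derivative of w ↦ ρ(rz - w), so that distributional
hypotheses apply with this function as test function. The chain rule accounts for the sign and the
factor r. -/
theorem fderiv_mollify (φ : ContDiffBump (0 : Fin n → ℂ)) (r : ℝ) {b : (Fin n → ℂ) → ℂ}
    (hb : LocallyIntegrable b) (z v : Fin n → ℂ) :
    Integrable (fun w => b w * fderiv ℝ (fun w => (φ.normed volume (r • z - w) : ℂ)) w v) ∧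
    fderiv ℝ (mollify φ r b) z v =
      -(r * ∫ w, b w * fderiv ℝ (fun w => (φ.normed volume (r • z - w) : ℂ)) w v) := by
  set ρ := φ.normed volume with hρ
  have hρs : ContDiff ℝ 1 ρ := φ.contDiff_normed
  have h1 := φ.hasCompactSupport_normed.hasFDerivAt_convolution_left
    (ContinuousLinearMap.lsmul ℝ ℝ) (μ := volume) hρs hb (r • z)
  have h2 : HasFDerivAt (fun z : Fin n → ℂ => r • z) (r • ContinuousLinearMap.id ℝ (Fin n → ℂ)) z :=
    (hasFDerivAt_id z).const_smul r
  have h3 : HasFDerivAt (mollify φ r b) _ z := HasFDerivAt.comp z h1 h2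
  have hd : ∀ w, fderiv ℝ (fun w => (ρ (r • z - w) : ℂ)) w v = -(fderiv ℝ ρ (r • z - w) v : ℂ) := by
    intro w
    have e1 : HasFDerivAt ρ (fderiv ℝ ρ (r • z - w)) (r • z - w) :=
      (hρs.differentiable one_ne_zero _).hasFDerivAt
    have e2 : HasFDerivAt (fun w => r • z - w) (-ContinuousLinearMap.id ℝ (Fin n → ℂ)) w :=
      (hasFDerivAt_id w).const_sub _
    have e3 := (Complex.ofRealCLM.hasFDerivAt (x := ρ (r • z - w))).comp w (e1.comp w e2)
    have e4 : HasFDerivAt (fun w => (ρ (r • z - w) : ℂ)) _ w := e3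
    rw [e4.fderiv]
    simp
  have hint : Integrable fun w =>
      (((ContinuousLinearMap.lsmul ℝ ℝ).precompL (Fin n → ℂ)) (fderiv ℝ ρ (r • z - w))) (b w) :=
    ((φ.hasCompactSupport_normed.fderiv (𝕜 := ℝ)).convolutionExists_left
      (((ContinuousLinearMap.lsmul ℝ ℝ).precompL (Fin n → ℂ)))
      (hρs.continuous_fderiv one_ne_zero) hb (r • z)).integrable_swap
  have hval : ∀ w, ((((ContinuousLinearMap.lsmul ℝ ℝ).precompL (Fin n → ℂ))
      (fderiv ℝ ρ (r • z - w))) (b w)) v =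
      -(b w * fderiv ℝ (fun w => (ρ (r • z - w) : ℂ)) w v) := by
    intro w
    rw [hd, ContinuousLinearMap.precompL_apply]
    simp [mul_comm]
  refine ⟨?_, ?_⟩
  · have := (hint.apply_continuousLinearMap v).neg
    refine this.congr (Filter.Eventually.of_forall fun w => ?_)
    simp only [Pi.neg_apply, hval, neg_neg]
  · rw [h3.fderiv, ContinuousLinearMap.comp_apply, convolution_eq_swap]
    simp only [smul_apply, ContinuousLinearMap.id_apply, map_smul]
    rw [ContinuousLinearMap.integral_apply hint]
    simp only [hval]
    rw [integral_neg]
    simp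

theorem wirtingerBar_mollify (φ : ContDiffBump (0 : Fin n → ℂ)) (r : ℝ) {b : (Fin n → ℂ) → ℂ}
    (hb : LocallyIntegrable b) (k : Fin n) (z : Fin n → ℂ) :
    wirtingerBar k (mollify φ r b) z =
      -(r * ∫ w, b w * wirtingerBar k (fun w => (φ.normed volume (r • z - w) : ℂ)) w) := by
  obtain ⟨i1, e1⟩ := fderiv_mollify φ r hb z (Pi.single k 1)
  obtain ⟨i2, e2⟩ := fderiv_mollify φ r hb z (Pi.single k Complex.I)
  have : ∀ w, b w * wirtingerBar k (fun w => (φ.normed volume (r • z - w) : ℂ)) w =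
      1 / 2 * (b w * fderiv ℝ (fun w => (φ.normed volume (r • z - w) : ℂ)) w (Pi.single k 1)) +
      1 / 2 * Complex.I *
        (b w * fderiv ℝ (fun w => (φ.normed volume (r • z - w) : ℂ)) w (Pi.single k Complex.I)) := by
    intro w; rw [wirtingerBar]; ring
  simp only [this]
  rw [integral_add (i1.const_mul _) (i2.const_mul _), integral_const_mul, integral_const_mul,
    wirtingerBar, e1, e2]
  ring

/-- The dilation leaves room for the bump: the support around rz has radius at most 1 - r, and |zⱼ|
< 1 keeps it strictly inside. -/
theorem isTestFunction_normed (φ : ContDiffBump (0 : Fin n → ℂ)) {r : ℝ} (hr : 0 < r)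
    (hφ : r + φ.rOut ≤ 1) {z : Fin n → ℂ} (hz : z ∈ polydisc n) :
    IsTestFunction (polydisc n) fun w => (φ.normed volume (r • z - w) : ℂ) := by
  have hsub : (Function.support fun w => (φ.normed volume (r • z - w) : ℂ)) ⊆
      Metric.closedBall (r • z) φ.rOut := by
    intro w hw
    have : r • z - w ∈ Function.support (φ.normed volume) := by
      simpa using hw
    rw [φ.support_normed_eq, mem_ball_zero_iff] at this
    rw [Metric.mem_closedBall, dist_eq_norm, norm_sub_rev]
    exact this.le
  have hts : tsupport (fun w => (φ.normed volume (r • z - w) : ℂ)) ⊆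
      Metric.closedBall (r • z) φ.rOut := closure_minimal hsub Metric.isClosed_closedBall
  refine ⟨?_, ?_, hts.trans fun w hw j => ?_⟩
  · have h : ContDiff ℝ ∞ (φ.normed volume : (Fin n → ℂ) → ℝ) := φ.contDiff_normed
    exact Complex.ofRealCLM.contDiff.comp (h.comp (contDiff_const.sub contDiff_id))
  · exact HasCompactSupport.of_support_subset_isCompact (isCompact_closedBall _ _) hsub
  · rw [Metric.mem_closedBall, dist_eq_norm] at hw
    have h1 := (norm_le_pi_norm (w - r • z) j).trans hw
    have h2 : w j = (w - r • z) j + r * z j := by simp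
    rw [h2]
    refine (norm_add_le _ _).trans_lt ?_
    rw [norm_mul, Complex.norm_real, Real.norm_of_nonneg hr.le]
    nlinarith [hz j]

theorem norm_mollify_le (φ : ContDiffBump (0 : Fin n → ℂ)) (r : ℝ) {b : (Fin n → ℂ) → ℂ}
    {M : ℝ} (hM : ∀ᵐ z, ‖b z‖ ≤ M) (z : Fin n → ℂ) : ‖mollify φ r b z‖ ≤ M := by
  rw [mollify_apply]
  have hi : Integrable fun w => φ.normed volume (r • z - w) * M :=
    (φ.integrable_normed.comp_sub_left (r • z)).mul_const M
  refine (norm_integral_le_of_norm_le hi ?_).trans_eq ?_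
  · filter_upwards [hM] with w hw
    rw [norm_smul, Real.norm_of_nonneg (φ.nonneg_normed _)]
    exact mul_le_mul_of_nonneg_left hw (φ.nonneg_normed _)
  · rw [integral_mul_const, integral_sub_left_eq_self (fun w => φ.normed volume w),
      φ.integral_normed, one_mul]

theorem lintegral_normed (φ : ContDiffBump (0 : Fin n → ℂ)) :
    ∫⁻ w, ENNReal.ofReal (φ.normed volume w) = 1 := by
  rw [← ofReal_integral_eq_lintegral_ofReal φ.integrable_normed
    (Filter.Eventually.of_forall φ.nonneg_normed), φ.integral_normed, ENNReal.ofReal_one]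

/-- Jensen's inequality for the probability measure with density the normalized bump. -/
theorem enorm_mollify_sq_le (φ : ContDiffBump (0 : Fin n → ℂ)) (r : ℝ) {b : (Fin n → ℂ) → ℂ}
    (hb : Measurable b) (z : Fin n → ℂ) : ‖mollify φ r b z‖ₑ ^ 2 ≤
      ∫⁻ w, ENNReal.ofReal (φ.normed volume w) * ‖b (r • z - w)‖ₑ ^ 2 := by
  set ν := volume.withDensity fun w => ENNReal.ofReal (φ.normed volume w) with hν
  have hm : Measurable fun w => ENNReal.ofReal (φ.normed volume w) :=
    φ.continuous_normed.measurable.ennreal_ofReal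
  have : IsProbabilityMeasure ν := ⟨by
    rw [hν, withDensity_apply _ MeasurableSet.univ, Measure.restrict_univ, lintegral_normed]⟩
  have hbm : Measurable fun w => b (r • z - w) := hb.comp (measurable_const.sub measurable_id)
  have h1 : ‖mollify φ r b z‖ₑ ≤ eLpNorm (fun w => b (r • z - w)) 1 ν := by
    rw [mollify_apply', eLpNorm_one_eq_lintegral_enorm, hν,
      lintegral_withDensity_eq_lintegral_mul _ hm hbm.enorm]
    refine (enorm_integral_le_lintegral_enorm _).trans_eq (lintegral_congr fun w => ?_)
    rw [enorm_smul, Real.enorm_of_nonneg (φ.nonneg_normed _)]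
    rfl
  have h2 := h1.trans (eLpNorm_le_eLpNorm_of_exponent_le (p := 1) (q := 2) (by norm_num)
    hbm.aestronglyMeasurable)
  refine (pow_le_pow_left' h2 2).trans_eq ?_
  have h3 := eLpNorm_nnreal_pow_eq_lintegral (p := 2) (f := fun w => b (r • z - w)) (μ := ν)
    two_ne_zero
  norm_num at h3
  rw [h3, hν, lintegral_withDensity_eq_lintegral_mul _ hm (hbm.enorm.pow_const 2)]
  rfl

/-- By Tonelli only the dilation matters; its Jacobian r^(-2n) is at most (2^n)² because r ≥ 1/2.
What counts is uniformity in the mollification parameter. -/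
theorem eLpNorm_mollify_le (φ : ContDiffBump (0 : Fin n → ℂ)) {r : ℝ} (hr : 1 / 2 ≤ r)
    {b : (Fin n → ℂ) → ℂ} (hb : Measurable b) :
    eLpNorm (mollify φ r b) 2 volume ≤ 2 ^ n * eLpNorm b 2 volume := by
  have hsq : ∀ F : (Fin n → ℂ) → ℂ, eLpNorm F 2 volume ^ 2 = ∫⁻ z, ‖F z‖ₑ ^ 2 := by
    intro F
    have h3 := eLpNorm_nnreal_pow_eq_lintegral (p := 2) (f := F) (μ := volume) two_ne_zero
    norm_num at h3
    exact h3
  have hr0 : 0 < r := by linarith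
  rw [← ENNReal.pow_le_pow_left_iff two_ne_zero, mul_pow, hsq, hsq]
  have hG : Measurable fun w => ‖b w‖ₑ ^ 2 := hb.enorm.pow_const 2
  have hscale : ∀ w : Fin n → ℂ, ∫⁻ z : Fin n → ℂ, ‖b (r • z - w)‖ₑ ^ 2 ≤
      (2 ^ n) ^ 2 * ∫⁻ z, ‖b z‖ₑ ^ 2 := by
    intro w
    have e1 : ∫⁻ z : Fin n → ℂ, ‖b (r • z - w)‖ₑ ^ 2 =
        ∫⁻ z, ‖b (z - w)‖ₑ ^ 2 ∂(Measure.map (fun z : Fin n → ℂ => r • z) volume) := by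
      have hGw : Measurable fun z => ‖b (z - w)‖ₑ ^ 2 := hG.comp (measurable_id.sub_const w)
      rw [lintegral_map hGw (measurable_const_smul r)]
    rw [e1, Measure.map_addHaar_smul _ hr0.ne', lintegral_smul_measure,
      lintegral_sub_right_eq_self (fun z => ‖b z‖ₑ ^ 2), smul_eq_mul]
    refine mul_le_mul' ?_ le_rfl
    have : Module.finrank ℝ (Fin n → ℂ) = n * 2 := by
      rw [Module.finrank_pi_fintype]; simp
    rw [this, ← pow_mul, abs_of_pos (by positivity)]
    refine (ENNReal.ofReal_le_ofReal (q := 2 ^ (n * 2)) ?_).trans_eq ?_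
    · rw [← inv_pow]
      gcongr
      rw [inv_le_comm₀ hr0 two_pos]; linarith
    · rw [ENNReal.ofReal_pow (by norm_num)]; norm_num
  calc ∫⁻ z, ‖mollify φ r b z‖ₑ ^ 2
      ≤ ∫⁻ z, ∫⁻ w, ENNReal.ofReal (φ.normed volume w) * ‖b (r • z - w)‖ₑ ^ 2 :=
        lintegral_mono fun z => enorm_mollify_sq_le φ r hb z
    _ = ∫⁻ w, ∫⁻ z, ENNReal.ofReal (φ.normed volume w) * ‖b (r • z - w)‖ₑ ^ 2 := by
        refine lintegral_lintegral_swap (Measurable.aemeasurable ?_)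
        exact Measurable.mul (f := fun p : (Fin n → ℂ) × (Fin n → ℂ) =>
          ENNReal.ofReal (φ.normed volume p.2))
          (φ.continuous_normed.measurable.comp measurable_snd).ennreal_ofReal
          (hG.comp ((measurable_fst.const_smul r).sub measurable_snd))
    _ ≤ ∫⁻ w, ENNReal.ofReal (φ.normed volume w) * ((2 ^ n) ^ 2 * ∫⁻ z, ‖b z‖ₑ ^ 2) := by
        refine lintegral_mono fun w => ?_
        rw [lintegral_const_mul' _ _ ENNReal.ofReal_ne_top]
        gcongr
        exact hscale w
    _ = (2 ^ n) ^ 2 * ∫⁻ z, ‖b z‖ₑ ^ 2 := by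
        rw [lintegral_mul_const _ φ.continuous_normed.measurable.ennreal_ofReal,
          lintegral_normed, one_mul]

/-- Bump functions whose supports shrink to the origin. -/
noncomputable def bumpSeq (n m : ℕ) : ContDiffBump (0 : Fin n → ℂ) where
  rIn := 1 / (m + 2) / 2
  rOut := 1 / (m + 2)
  rIn_pos := by positivity
  rIn_lt_rOut := half_lt_self (by positivity)

/-- Approximation of `b` on the polydisc by smooth functions on `ℂⁿ`. -/
noncomputable def approx (m : ℕ) (b : (Fin n → ℂ) → ℂ) : (Fin n → ℂ) → ℂ :=
  mollify (bumpSeq n m) (1 - 1 / (m + 2)) b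

theorem half_le_one_sub (m : ℕ) : (1 / 2 : ℝ) ≤ 1 - 1 / (m + 2) := by
  have : (1 : ℝ) / (m + 2) ≤ 1 / 2 := by
    apply one_div_le_one_div_of_le <;> linarith [(Nat.cast_nonneg m : (0 : ℝ) ≤ m)]
  linarith

theorem dist_approx_le {g : (Fin n → ℂ) → ℂ} (hg : Continuous g) {δ η : ℝ}
    (hδ : ∀ x y, dist x y < δ → dist (g x) (g y) < η) {m : ℕ} (hm : 1 / ((m : ℝ) + 2) < δ)
    {z : Fin n → ℂ} (hz : z ∈ polydisc n) : ‖approx m g z - g z‖ ≤ 2 * η := by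
  have h1 : dist (approx m g z) (g (((1 : ℝ) - 1 / (m + 2)) • z)) ≤ η :=
    (bumpSeq n m).dist_normed_convolution_le hg.aestronglyMeasurable fun x hx =>
      (hδ _ _ (lt_trans (Metric.mem_ball.1 hx) hm)).le
  have h2 : dist (g (((1 : ℝ) - 1 / (m + 2)) • z)) (g z) < η := by
    refine hδ _ _ (lt_of_le_of_lt ?_ hm)
    have hz1 : ‖z‖ ≤ 1 := (pi_norm_le_iff_of_nonneg zero_le_one).2 fun j => (hz j).le
    rw [dist_eq_norm, sub_smul, one_smul, sub_sub_cancel_left, norm_neg, norm_smul,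
      Real.norm_of_nonneg (by positivity)]
    exact mul_le_of_le_one_right (by positivity) hz1
  rw [← dist_eq_norm]
  linarith [dist_triangle (approx m g z) (g (((1 : ℝ) - 1 / (m + 2)) • z)) (g z)]

/-- Density of compactly supported continuous functions together with the uniform L² bound. For
continuous g, uniform continuity handles both the averaging and the dilation. -/
theorem tendsto_eLpNorm_approx_sub {b : (Fin n → ℂ) → ℂ} (hb : Measurable b)
    (hb2 : MemLp b 2 volume) : Filter.Tendsto
      (fun m => eLpNorm (approx m b - b) 2 (volume.restrict (polydisc n)))
      Filter.atTop (nhds 0) := by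
  set c : ℝ≥0∞ := volume.restrict (polydisc n) univ ^ (2 : ℝ≥0∞).toReal⁻¹ with hc
  have hc' : c ≠ ⊤ := ENNReal.rpow_ne_top_of_nonneg (by simp) (measure_ne_top _ _)
  rw [ENNReal.tendsto_atTop_zero]
  intro ε hε
  -- The three errors are 2^n η from mollifying b - g, 2cη from g, and η from g - b.
  obtain ⟨η, hη, hηε⟩ := ENNReal.exists_nnreal_pos_mul_lt (a := 2 ^ n + 1 + c * 2) (b := ε)
    (by finiteness) hε.ne'
  obtain ⟨g, hgc, hbg, hg, hg2⟩ := hb2.exists_hasCompactSupport_eLpNorm_sub_le (by norm_num)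
    (ε := η) (by exact_mod_cast hη.ne')
  obtain ⟨δ, hδ, hgδ⟩ := Metric.uniformContinuous_iff.1
    (hg.uniformContinuous_of_tendsto_cocompact hgc.is_zero_at_infty) η hη
  obtain ⟨N, hN⟩ := exists_nat_one_div_lt hδ
  refine ⟨N, fun m hm => ?_⟩
  have hmδ : 1 / ((m : ℝ) + 2) < δ := by
    refine lt_of_le_of_lt (one_div_le_one_div_of_le (by positivity) ?_) hN
    have : (N : ℝ) ≤ m := by exact_mod_cast hm
    linarith
  have hli : ∀ {a : (Fin n → ℂ) → ℂ}, MemLp a 2 volume → LocallyIntegrable a := fun h =>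
    h.locallyIntegrable (by norm_num)
  have e : approx m b - b = (approx m (b - g) + (approx m g - g)) + (g - b) := by
    ext z
    have : approx m (b - g) z = approx m b z - approx m g z :=
      mollify_sub _ _ (hli hb2) (hli hg2) z
    simp only [Pi.add_apply, Pi.sub_apply, this]
    ring
  have c1 : Continuous (approx m (b - g)) :=
    (contDiff_mollify _ _ (hli (hb2.sub hg2))).continuous
  have c2 : Continuous (approx m g) := (contDiff_mollify _ _ (hli hg2)).continuous
  have t1 : eLpNorm (approx m (b - g)) 2 (volume.restrict (polydisc n)) ≤ 2 ^ n * η :=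
    (eLpNorm_mono_measure _ Measure.restrict_le_self).trans
      ((eLpNorm_mollify_le _ (half_le_one_sub m) (hb.sub hg.measurable)).trans (by gcongr))
  have t2 : eLpNorm (approx m g - g) 2 (volume.restrict (polydisc n)) ≤ c * (2 * η) := by
    refine (eLpNorm_le_of_ae_bound (C := 2 * η) ?_).trans_eq ?_
    · rw [ae_restrict_iff' (measurableSet_polydisc n)]
      exact Filter.Eventually.of_forall fun z hz => dist_approx_le hg (fun x y h => hgδ h) hmδ hz
    · rw [ENNReal.ofReal_mul zero_le_two]
      simp [hc]
  have t3 : eLpNorm (g - b) 2 (volume.restrict (polydisc n)) ≤ η := by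
    rw [eLpNorm_sub_comm]
    exact (eLpNorm_mono_measure _ Measure.restrict_le_self).trans hbg
  rw [e]
  refine (eLpNorm_add_le (c1.add (c2.sub hg)).aestronglyMeasurable
    (hg.measurable.sub hb).aestronglyMeasurable (by norm_num)).trans ?_
  refine (add_le_add (eLpNorm_add_le c1.aestronglyMeasurable
    (c2.sub hg).aestronglyMeasurable (by norm_num)) le_rfl).trans ?_
  refine (add_le_add (add_le_add t1 t2) t3).trans ?_
  refine le_of_eq_of_le ?_ hηε.le
  ring

/-! ### Uniqueness and existence of canonical solutions -/

/-- The Cauchy–Riemann equations in each variable say that the real derivative commutes with i on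
every coordinate axis, hence is complex linear. -/
theorem differentiableAt_of_wirtingerBar_eq_zero {f : (Fin n → ℂ) → ℂ} {z : Fin n → ℂ}
    (hf : DifferentiableAt ℝ f z) (h : ∀ k, wirtingerBar k f z = 0) : DifferentiableAt ℂ f z := by
  rw [differentiableAt_iff_restrictScalars ℝ hf]
  set L := fderiv ℝ f z with hL
  have hI : ∀ k, L (Pi.single k Complex.I) = Complex.I * L (Pi.single k 1) := by
    intro k
    have h1 := h k
    rw [wirtingerBar, ← hL] at h1
    linear_combination (-2 * Complex.I) * h1 + L (Pi.single k Complex.I) * Complex.I_sq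
  have hs : ∀ k (x : ℂ), L (Pi.single k x) = L (Pi.single k 1) * x := by
    intro k x
    have e : (Pi.single k x : Fin n → ℂ) =
        x.re • (Pi.single k (1 : ℂ) : Fin n → ℂ) + x.im • (Pi.single k Complex.I : Fin n → ℂ) := by
      rw [← Pi.single_smul, ← Pi.single_smul, ← Pi.single_add]
      congr 1
      simp [Complex.re_add_im]
    rw [e, map_add, map_smul, map_smul, hI, Complex.real_smul, Complex.real_smul]
    linear_combination L (Pi.single k 1) * Complex.re_add_im x
  refine ⟨∑ k, L (Pi.single k 1) • ContinuousLinearMap.proj k, ?_⟩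
  ext v
  rw [ContinuousLinearMap.coe_restrictScalars']
  conv_rhs => rw [← Finset.univ_sum_single v, map_sum, Finset.sum_congr rfl fun k _ => hs k (v k)]
  simp

theorem integrable_mul_of_hasCompactSupport {μ : Measure (Fin n → ℂ)} {u h : (Fin n → ℂ) → ℂ}
    (hu : Integrable u μ) (hh : Continuous h) (hc : HasCompactSupport h) :
    Integrable (fun z => u z * h z) μ := by
  obtain ⟨C, hC⟩ := hc.exists_bound_of_continuous hh
  exact hu.mul_bdd hh.aestronglyMeasurable (Filter.Eventually.of_forall hC)

theorem IsTestFunction.hasCompactSupport_wirtingerBar {Ω : Set (Fin n → ℂ)}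
    {φ : (Fin n → ℂ) → ℂ} (hφ : IsTestFunction Ω φ) (k : Fin n) :
    HasCompactSupport (wirtingerBar k φ) :=
  hφ.compactSupport.mono' ((subset_tsupport _).trans (tsupport_wirtingerBar_subset φ k))

theorem integral_indicator_mul {Ω : Set (Fin n → ℂ)} (hΩ : MeasurableSet Ω)
    (a h : (Fin n → ℂ) → ℂ) : ∫ w, Ω.indicator a w * h w = ∫ w in Ω, a w * h w := by
  rw [← integral_indicator hΩ]
  congr 1
  ext w
  by_cases hw : w ∈ Ω <;> simp [hw]

theorem one_sub_add_bumpSeq_rOut (n m : ℕ) :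
    (1 - 1 / ((m : ℝ) + 2)) + (bumpSeq n m).rOut ≤ 1 := by
  simp [bumpSeq]

theorem wirtingerBar_approx {a : (Fin n → ℂ) → ℂ}
    (ha : LocallyIntegrable ((polydisc n).indicator a)) (k : Fin n) (m : ℕ) (z : Fin n → ℂ) :
    wirtingerBar k (approx m ((polydisc n).indicator a)) z = -((1 - 1 / ((m : ℝ) + 2) : ℝ) *
      ∫ w in polydisc n, a w * wirtingerBar k (fun w => ((bumpSeq n m).normed volume
        (((1 : ℝ) - 1 / (m + 2)) • z - w) : ℂ)) w) := by
  rw [approx, wirtingerBar_mollify _ _ ha, integral_indicator_mul (measurableSet_polydisc n)]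

theorem isTestFunction_bumpSeq (m : ℕ) {z : Fin n → ℂ} (hz : z ∈ polydisc n) :
    IsTestFunction (polydisc n) fun w => ((bumpSeq n m).normed volume
        (((1 : ℝ) - 1 / (m + 2)) • z - w) : ℂ) :=
  isTestFunction_normed _ (by linarith [half_le_one_sub m]) (one_sub_add_bumpSeq_rOut n m) hz

/-- At a point of the polydisc, the derivatives of the approximants are pairings of F with
derivatives of a test function, so distributional closedness becomes pointwise closedness. -/
theorem IsDbarClosed.isSmoothClosed_approx {F : (Fin n → ℂ) → EuclideanSpace ℂ (Fin n)}
    (hF : IsDbarClosed (polydisc n) F)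
    (hi : ∀ j, LocallyIntegrable ((polydisc n).indicator fun z => F z j)) (m : ℕ) :
    IsSmoothClosed fun j => approx m ((polydisc n).indicator fun z => F z j) where
  smooth j := contDiff_mollify _ _ (hi j)
  closed j k z hz := by
    rw [wirtingerBar_approx (hi j), wirtingerBar_approx (hi k), hF j k _ (isTestFunction_bumpSeq m hz)]

theorem enorm_integral_mul_le {μ : Measure (Fin n → ℂ)} {f g : (Fin n → ℂ) → ℂ}
    (hf : AEStronglyMeasurable f μ) (hg : AEStronglyMeasurable g μ) :
    ‖∫ z, f z * g z ∂μ‖ₑ ≤ eLpNorm f 2 μ * eLpNorm g 2 μ := by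
  refine (enorm_integral_le_lintegral_enorm _).trans ?_
  have := eLpNorm_smul_le_mul_eLpNorm (p := 2) (q := 2) (r := 1) hg hf
  rwa [eLpNorm_one_eq_lintegral_enorm] at this

/-- A square-integrable function orthogonal to `A²` that is annihilated weakly by all `∂/∂z̄ⱼ`
vanishes. -/
theorem ae_eq_zero_of_weak_holomorphic {d : (Fin n → ℂ) → ℂ} (hdm : Measurable d)
    (hd : MemLp d 2 (volume.restrict (polydisc n)))
    (hsol : ∀ j : Fin n, ∀ φ : (Fin n → ℂ) → ℂ, IsTestFunction (polydisc n) φ →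
      ∫ z in polydisc n, d z * wirtingerBar j φ z = 0)
    (horth : ∀ g : (Fin n → ℂ) → ℂ, DifferentiableOn ℂ g (polydisc n) →
      MemLp g 2 (volume.restrict (polydisc n)) → ∫ z in polydisc n, d z * conj (g z) = 0) :
    d =ᵐ[volume.restrict (polydisc n)] 0 := by
  set b := (polydisc n).indicator d with hb
  have hbm : Measurable b := hdm.indicator (measurableSet_polydisc n)
  have hb2 : MemLp b 2 volume := (memLp_indicator_iff_restrict (measurableSet_polydisc n)).2 hd
  have hli : LocallyIntegrable b := hb2.locallyIntegrable (by norm_num)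
  have hsm : ∀ m, ContDiff ℝ ∞ (approx m b) := fun m => contDiff_mollify _ _ hli
  have hm2 : ∀ m, MemLp (approx m b) 2 (volume.restrict (polydisc n)) := fun m => by
    refine ⟨(hsm m).continuous.aestronglyMeasurable, ?_⟩
    refine (eLpNorm_mono_measure _ Measure.restrict_le_self).trans_lt
      ((eLpNorm_mollify_le _ (half_le_one_sub m) hbm).trans_lt ?_)
    exact ENNReal.mul_lt_top (by finiteness) hb2.2
  -- The weak equations make the approximants holomorphic on the polydisc, so they are admissible in
  -- the orthogonality hypothesis.
  have hzero : ∀ m, ∫ z in polydisc n, d z * conj (approx m b z) = 0 := fun m => by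
    refine horth _ (fun z hz => ?_) (hm2 m)
    · refine (differentiableAt_of_wirtingerBar_eq_zero
        ((hsm m).differentiable (by simp) z) fun k => ?_).differentiableWithinAt
      rw [wirtingerBar_approx hli, hsol k _ (isTestFunction_bumpSeq m hz), mul_zero, neg_zero]
  have hint : Integrable (fun z => d z * conj (d z)) (volume.restrict (polydisc n)) :=
    hd.integrable_mul hd.star
  have hdb : b =ᵐ[volume.restrict (polydisc n)] d := indicator_ae_eq_restrict (measurableSet_polydisc n)
  have hle : ∀ m, ‖∫ z in polydisc n, d z * conj (d z)‖ₑ ≤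
      eLpNorm d 2 (volume.restrict (polydisc n)) *
        eLpNorm (approx m b - b) 2 (volume.restrict (polydisc n)) := by
    intro m
    have e : ∫ z in polydisc n, d z * conj (d z) =
        -∫ z in polydisc n, d z * conj (approx m b z - b z) := by
      have e1 : ∫ z in polydisc n, d z * conj (approx m b z - b z) =
          ∫ z in polydisc n, (d z * conj (approx m b z) - d z * conj (d z)) := by
        refine integral_congr_ae ?_
        filter_upwards [hdb] with z hz
        rw [hz, map_sub, mul_sub]
      have e2 : Integrable (fun z => d z * conj (approx m b z)) (volume.restrict (polydisc n)) :=
        hd.integrable_mul (hm2 m).star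
      rw [e1, integral_sub e2 hint, hzero, zero_sub, neg_neg]
    rw [e, enorm_neg]
    refine (enorm_integral_mul_le hd.1 (((hsm m).continuous.measurable.sub
      hbm).aestronglyMeasurable.star)).trans_eq ?_
    congr 1
    refine eLpNorm_congr_norm_ae (Filter.Eventually.of_forall fun z => ?_)
    exact RCLike.norm_conj _
  have h0 : ∫ z in polydisc n, d z * conj (d z) = 0 := by
    have ht := ENNReal.Tendsto.const_mul (a := eLpNorm d 2 (volume.restrict (polydisc n)))
      (tendsto_eLpNorm_approx_sub hbm hb2) (Or.inr hd.2.ne)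
    rw [mul_zero] at ht
    simpa using ge_of_tendsto' ht hle
  have h1 : ∀ z, d z * conj (d z) = ((‖d z‖ ^ 2 : ℝ) : ℂ) := fun z => by
    rw [Complex.mul_conj, Complex.normSq_eq_norm_sq]
  simp only [h1] at h0 hint
  have hint' : Integrable (fun z => ‖d z‖ ^ 2) (volume.restrict (polydisc n)) := hint.re
  rw [integral_complex_ofReal, Complex.ofReal_eq_zero, integral_eq_zero_iff_of_nonneg
    (fun z => by positivity) hint'] at h0
  filter_upwards [h0] with z hz
  simpa using hz

theorem IsCanonicalSolution.ae_eq {F : (Fin n → ℂ) → EuclideanSpace ℂ (Fin n)}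
    {u v : (Fin n → ℂ) → ℂ} (hu : IsCanonicalSolution (polydisc n) F u)
    (hv : IsCanonicalSolution (polydisc n) F v) : u =ᵐ[volume.restrict (polydisc n)] v := by
  have hd := hu.memLp.sub hv.memLp
  have hui := hu.memLp.integrable (by norm_num : (1 : ℝ≥0∞) ≤ 2)
  have hvi := hv.memLp.integrable (by norm_num : (1 : ℝ≥0∞) ≤ 2)
  have hae := hd.1.ae_eq_mk
  have h := ae_eq_zero_of_weak_holomorphic hd.1.stronglyMeasurable_mk.measurable
    ((memLp_congr_ae hae).1 hd) (fun j φ hφ => ?_) fun g hg hg2 => ?_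
  · filter_upwards [hae, h] with z h1 h2
    rw [h2] at h1
    simpa [sub_eq_zero] using h1
  · rw [← integral_congr_ae (hae.mono fun z hz => by
      show (u - v) z * wirtingerBar j φ z = _; rw [hz])]
    simp only [Pi.sub_apply, sub_mul]
    rw [integral_sub (integrable_mul_of_hasCompactSupport hui (hφ.continuous_wirtingerBar j)
      (hφ.hasCompactSupport_wirtingerBar j)) (integrable_mul_of_hasCompactSupport hvi
      (hφ.continuous_wirtingerBar j) (hφ.hasCompactSupport_wirtingerBar j)),
      hu.solution j φ hφ, hv.solution j φ hφ, sub_self]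
  · rw [← integral_congr_ae (hae.mono fun z hz => by
      show (u - v) z * conj (g z) = _; rw [hz])]
    simp only [Pi.sub_apply, sub_mul]
    have i1 : Integrable (fun z => u z * conj (g z)) (volume.restrict (polydisc n)) :=
      hu.memLp.integrable_mul hg2.star
    have i2 : Integrable (fun z => v z * conj (g z)) (volume.restrict (polydisc n)) :=
      hv.memLp.integrable_mul hg2.star
    rw [integral_sub i1 i2, hu.orthogonal g hg hg2, hv.orthogonal g hg hg2, sub_self]

theorem IsSmoothClosed.sub {f g : Fin n → (Fin n → ℂ) → ℂ} (hf : IsSmoothClosed f)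
    (hg : IsSmoothClosed g) : IsSmoothClosed fun j z => f j z - g j z where
  smooth j := (hf.smooth j).sub (hg.smooth j)
  closed j k z hz := by
    have h : ∀ i l, wirtingerBar l (fun z => f i z - g i z) z =
        wirtingerBar l (f i) z - wirtingerBar l (g i) z := fun i l => by
      simp only [wirtingerBar]
      rw [fderiv_fun_sub ((hf.smooth i).differentiable (by simp) z)
        ((hg.smooth i).differentiable (by simp) z)]
      simp only [sub_apply]
      ring
    rw [h, h, hf.closed j k z hz, hg.closed j k z hz]

theorem IsCanonicalSolution.sub {F G : (Fin n → ℂ) → EuclideanSpace ℂ (Fin n)}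
    {u v : (Fin n → ℂ) → ℂ} (hu : IsCanonicalSolution (polydisc n) F u)
    (hv : IsCanonicalSolution (polydisc n) G v)
    (hF : ∀ j, Integrable (fun z => F z j) (volume.restrict (polydisc n)))
    (hG : ∀ j, Integrable (fun z => G z j) (volume.restrict (polydisc n))) :
    IsCanonicalSolution (polydisc n) (fun z => F z - G z) fun z => u z - v z where
  memLp := hu.memLp.sub hv.memLp
  solution j φ hφ := by
    have hui := hu.memLp.integrable (by norm_num : (1 : ℝ≥0∞) ≤ 2)
    have hvi := hv.memLp.integrable (by norm_num : (1 : ℝ≥0∞) ≤ 2)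
    simp only [sub_mul, PiLp.sub_apply]
    rw [integral_sub (integrable_mul_of_hasCompactSupport hui (hφ.continuous_wirtingerBar j)
      (hφ.hasCompactSupport_wirtingerBar j)) (integrable_mul_of_hasCompactSupport hvi
      (hφ.continuous_wirtingerBar j) (hφ.hasCompactSupport_wirtingerBar j)),
      integral_sub (integrable_mul_of_hasCompactSupport (hF j) hφ.smooth.continuous
        hφ.compactSupport) (integrable_mul_of_hasCompactSupport (hG j) hφ.smooth.continuous
        hφ.compactSupport),
      hu.solution j φ hφ, hv.solution j φ hφ]
    ring
  orthogonal g hg hg2 := by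
    have i1 : Integrable (fun z => u z * conj (g z)) (volume.restrict (polydisc n)) :=
      hu.memLp.integrable_mul hg2.star
    have i2 : Integrable (fun z => v z * conj (g z)) (volume.restrict (polydisc n)) :=
      hv.memLp.integrable_mul hg2.star
    simp only [sub_mul]
    rw [integral_sub i1 i2, hu.orthogonal g hg hg2, hv.orthogonal g hg hg2, sub_self]

theorem IsCanonicalSolution.congr {F G : (Fin n → ℂ) → EuclideanSpace ℂ (Fin n)}
    {u : (Fin n → ℂ) → ℂ} (hu : IsCanonicalSolution (polydisc n) F u)
    (h : F =ᵐ[volume.restrict (polydisc n)] G) : IsCanonicalSolution (polydisc n) G u where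
  memLp := hu.memLp
  solution j φ hφ := by
    rw [hu.solution j φ hφ]
    congr 1
    exact integral_congr_ae (h.mono fun z hz => by simp only [hz])
  orthogonal := hu.orthogonal

theorem IsDbarClosed.congr {F G : (Fin n → ℂ) → EuclideanSpace ℂ (Fin n)}
    (hF : IsDbarClosed (polydisc n) F) (h : F =ᵐ[volume.restrict (polydisc n)] G) :
    IsDbarClosed (polydisc n) G := fun j k φ hφ => by
  have e : ∀ i l, ∫ z in polydisc n, G z i * wirtingerBar l φ z =
      ∫ z in polydisc n, F z i * wirtingerBar l φ z := fun i l =>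
    integral_congr_ae (h.mono fun z hz => by simp only [hz])
  rw [e, e]
  exact hF j k φ hφ

/-! ### Passage to the limit -/

/-- Bounded a.e. convergence implies weak convergence. -/
theorem tendsto_integral_mul_of_bound {μ : Measure (Fin n → ℂ)} {a : ℕ → (Fin n → ℂ) → ℂ}
    {b h : (Fin n → ℂ) → ℂ} {K : ℝ} (ha : ∀ m, AEStronglyMeasurable (a m) μ)
    (hK : ∀ m, ∀ᵐ z ∂μ, ‖a m z‖ ≤ K) (hh : Integrable h μ)
    (hab : ∀ᵐ z ∂μ, Filter.Tendsto (fun m => a m z) Filter.atTop (nhds (b z))) :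
    Filter.Tendsto (fun m => ∫ z, a m z * h z ∂μ) Filter.atTop (nhds (∫ z, b z * h z ∂μ)) := by
  refine tendsto_integral_of_dominated_convergence (fun z => K * ‖h z‖)
    (fun m => (ha m).mul hh.1) (hh.norm.const_mul K) (fun m => ?_) ?_
  · filter_upwards [hK m] with z hz
    rw [norm_mul]
    gcongr
  · filter_upwards [hab] with z hz
    exact hz.mul_const _

theorem exists_tendsto_eLpNorm_one {μ : Measure (Fin n → ℂ)} {u : ℕ → (Fin n → ℂ) → ℂ}
    (hu : ∀ m, MemLp (u m) 1 μ) {e : ℕ → ℝ≥0∞} (he : Filter.Tendsto e Filter.atTop (nhds 0))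
    (hue : ∀ m l, eLpNorm (u m - u l) 1 μ ≤ e m + e l) :
    ∃ v, MemLp v 1 μ ∧
      Filter.Tendsto (fun m => eLpNorm (u m - v) 1 μ) Filter.atTop (nhds 0) := by
  have hc : CauchySeq fun m => (hu m).toLp (u m) := by
    rw [EMetric.cauchySeq_iff]
    intro ε hε
    obtain ⟨N, hN⟩ := Filter.eventually_atTop.1
      (he.eventually (gt_mem_nhds (ENNReal.half_pos hε.ne')))
    refine ⟨N, fun m hm l hl => ?_⟩
    rw [Lp.edist_toLp_toLp]
    refine (hue m l).trans_lt ?_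
    rw [← ENNReal.add_halves ε]
    exact ENNReal.add_lt_add (hN m hm) (hN l hl)
  obtain ⟨v, hv⟩ := cauchySeq_tendsto_of_complete hc
  refine ⟨v, Lp.memLp v, ?_⟩
  rw [Lp.tendsto_Lp_iff_tendsto_eLpNorm'] at hv
  refine hv.congr fun m => eLpNorm_congr_ae ?_
  filter_upwards [(hu m).coeFn_toLp] with z hz
  simp [hz]

theorem exists_seq_tendsto_ae_of_eLpNorm {μ : Measure (Fin n → ℂ)} {u : ℕ → (Fin n → ℂ) → ℂ}
    {v : (Fin n → ℂ) → ℂ} (hu : ∀ m, AEStronglyMeasurable (u m) μ)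
    (hv : AEStronglyMeasurable v μ)
    (h : Filter.Tendsto (fun m => eLpNorm (u m - v) 1 μ) Filter.atTop (nhds 0)) :
    ∃ s : ℕ → ℕ, StrictMono s ∧
      ∀ᵐ z ∂μ, Filter.Tendsto (fun m => u (s m) z) Filter.atTop (nhds (v z)) :=
  (tendstoInMeasure_of_tendsto_eLpNorm one_ne_zero hu hv h).exists_seq_tendsto_ae

/-- A sequence of canonical solutions converging boundedly in `L¹`, with the right hand sides. -/
theorem IsCanonicalSolution.of_tendsto {G : ℕ → (Fin n → ℂ) → EuclideanSpace ℂ (Fin n)}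
    {F : (Fin n → ℂ) → EuclideanSpace ℂ (Fin n)} {u : ℕ → (Fin n → ℂ) → ℂ}
    {v : (Fin n → ℂ) → ℂ} {M K : ℝ}
    (hu : ∀ m, IsCanonicalSolution (polydisc n) (G m) (u m))
    (hG : ∀ m j, AEStronglyMeasurable (fun z => G m z j) (volume.restrict (polydisc n)))
    (hF : ∀ j, AEStronglyMeasurable (fun z => F z j) (volume.restrict (polydisc n)))
    (hM : ∀ m j z, ‖G m z j‖ ≤ M) (hK : ∀ m z, ‖u m z‖ ≤ K)
    (hGF : ∀ j, Filter.Tendsto (fun m => eLpNorm ((fun z => G m z j) - fun z => F z j) 1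
      (volume.restrict (polydisc n))) Filter.atTop (nhds 0))
    (hv : AEStronglyMeasurable v (volume.restrict (polydisc n)))
    (huv : Filter.Tendsto (fun m => eLpNorm (u m - v) 1 (volume.restrict (polydisc n)))
      Filter.atTop (nhds 0)) :
    IsCanonicalSolution (polydisc n) F v ∧
      ∀ᵐ z ∂volume.restrict (polydisc n), ‖v z‖ ≤ K := by
  have hum := fun m => (hu m).memLp.1
  obtain ⟨s, hs, hsv⟩ := exists_seq_tendsto_ae_of_eLpNorm hum hv huv
  have hvK : ∀ᵐ z ∂volume.restrict (polydisc n), ‖v z‖ ≤ K := by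
    filter_upwards [hsv] with z hz
    exact le_of_tendsto' hz.norm fun m => hK _ z
  refine ⟨⟨MemLp.of_bound hv K hvK, fun j φ hφ => ?_, fun g hg hg2 => ?_⟩, hvK⟩
  -- A further subsequence makes the right hand sides converge almost everywhere along with the
  -- solutions, so dominated convergence applies to both sides.
  · obtain ⟨t, ht, htF⟩ := exists_seq_tendsto_ae_of_eLpNorm (u := fun m z => G (s m) z j)
      (fun m => hG (s m) j) (hF j) ((hGF j).comp hs.tendsto_atTop)
    have l1 := tendsto_integral_mul_of_bound (fun m => hum (s (t m)))
      (fun m => Filter.Eventually.of_forall (hK (s (t m))))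
      (((hφ.continuous_wirtingerBar j).integrable_of_hasCompactSupport
        (hφ.hasCompactSupport_wirtingerBar j)).restrict (s := polydisc n))
      (hsv.mono fun z hz => hz.comp ht.tendsto_atTop)
    have l2 := tendsto_integral_mul_of_bound (fun m => hG (s (t m)) j)
      (fun m => Filter.Eventually.of_forall (hM (s (t m)) j))
      ((hφ.smooth.continuous.integrable_of_hasCompactSupport hφ.compactSupport).restrict
        (s := polydisc n)) htF
    exact tendsto_nhds_unique l1 (l2.neg.congr fun m => ((hu _).solution j φ hφ).symm)
  · have l1 := tendsto_integral_mul_of_bound (fun m => hum (s m))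
      (fun m => Filter.Eventually.of_forall (hK (s m)))
      (h := fun z => conj (g z)) (hg2.star.integrable (by norm_num)) hsv
    exact tendsto_nhds_unique l1 (tendsto_const_nhds.congr fun m =>
      ((hu _).orthogonal g hg hg2).symm)

/-- Convergence of the approximations in `L¹` of the polydisc. -/
theorem tendsto_eLpNorm_one_approx_sub {a : (Fin n → ℂ) → ℂ} (ha : Measurable a)
    (ha2 : MemLp a 2 (volume.restrict (polydisc n))) : Filter.Tendsto
      (fun m => eLpNorm (approx m ((polydisc n).indicator a) - a) 1
        (volume.restrict (polydisc n))) Filter.atTop (nhds 0) := by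
  have hb2 := (memLp_indicator_iff_restrict (measurableSet_polydisc n)).2 ha2
  have ht := tendsto_eLpNorm_approx_sub (ha.indicator (measurableSet_polydisc n)) hb2
  have hc : volume.restrict (polydisc n) univ ^
      (1 / (1 : ℝ≥0∞).toReal - 1 / (2 : ℝ≥0∞).toReal) ≠ ⊤ :=
    ENNReal.rpow_ne_top_of_nonneg (by norm_num) (measure_ne_top _ _)
  have ht' := ENNReal.Tendsto.mul_const ht (Or.inr hc)
  rw [zero_mul] at ht'
  refine tendsto_of_tendsto_of_tendsto_of_le_of_le tendsto_const_nhds ht'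
    (fun _ => zero_le) fun m => ?_
  have hcont : Continuous (approx m ((polydisc n).indicator a)) :=
    (contDiff_mollify _ _ (hb2.locallyIntegrable (by norm_num))).continuous
  refine le_of_eq_of_le (eLpNorm_congr_ae ?_) (eLpNorm_le_eLpNorm_mul_rpow_measure_univ
    (by norm_num) (hcont.measurable.sub (ha.indicator
      (measurableSet_polydisc n))).aestronglyMeasurable)
  filter_upwards [indicator_ae_eq_restrict (f := a) (measurableSet_polydisc n)] with z hz
  simp only [Pi.sub_apply, hz]

/-- The a priori estimate is used twice: in the sup norm for a uniform bound on the approximate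
solutions, and in L¹ for their convergence. -/
theorem exists_isCanonicalSolution_le (n : ℕ) : ∃ C : ℝ≥0,
    ∀ F : (Fin n → ℂ) → EuclideanSpace ℂ (Fin n), Measurable F → IsDbarClosed (polydisc n) F →
      ∀ M : ℝ≥0, (∀ᵐ z ∂volume.restrict (polydisc n), ‖F z‖ ≤ M) →
        ∃ u, IsCanonicalSolution (polydisc n) F u ∧
          ∀ᵐ z ∂volume.restrict (polydisc n), ‖u z‖ ≤ C * M := by
  obtain ⟨C, hC⟩ := exists_canSol_le n
  -- The factor n comes from summing the bounds of the n coefficients, each at most M.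
  refine ⟨C * n, fun F hFm hF M hM => ?_⟩
  have hm : ∀ j, Measurable fun z => F z j := fun j =>
    (EuclideanSpace.proj (𝕜 := ℂ) j).continuous.measurable.comp hFm
  have hMj : ∀ j, ∀ᵐ z ∂volume.restrict (polydisc n), ‖F z j‖ ≤ M := fun j =>
    hM.mono fun z hz => (PiLp.norm_apply_le (F z) j).trans hz
  have h2 : ∀ j, MemLp (fun z => F z j) 2 (volume.restrict (polydisc n)) := fun j =>
    MemLp.of_bound (hm j).aestronglyMeasurable M (hMj j)
  have hli : ∀ j, LocallyIntegrable ((polydisc n).indicator fun z => F z j) := fun j =>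
    ((memLp_indicator_iff_restrict (measurableSet_polydisc n)).2 (h2 j)).locallyIntegrable
      (by norm_num)
  set g : ℕ → Fin n → (Fin n → ℂ) → ℂ :=
    fun m j => approx m ((polydisc n).indicator fun z => F z j) with hg
  have hgM : ∀ m j z, ‖g m j z‖ ≤ M := fun m j z => norm_mollify_le _ _ (by
    have := (ae_restrict_iff' (measurableSet_polydisc n)).1 (hMj j)
    filter_upwards [this] with w hw
    by_cases h : w ∈ polydisc n
    · simpa [h] using hw h
    · simp [h]) z
  have hgs : ∀ m, IsSmoothClosed (g m) := fun m => hF.isSmoothClosed_approx hli m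
  set u : ℕ → (Fin n → ℂ) → ℂ := fun m => canSol (g m) (List.finRange n) with hu
  set G : ℕ → (Fin n → ℂ) → EuclideanSpace ℂ (Fin n) :=
    fun m z => WithLp.toLp 2 fun j => g m j z with hG
  have huG : ∀ m, IsCanonicalSolution (polydisc n) (G m) (u m) := fun m =>
    (hgs m).isCanonicalSolution fun z _ j => rfl
  have hgi : ∀ m j, Integrable (g m j) (volume.restrict (polydisc n)) := fun m j =>
    Integrable.of_bound ((hgs m).smooth j).continuous.aestronglyMeasurable M
      (Filter.Eventually.of_forall (hgM m j))
  have huK : ∀ m z, ‖u m z‖ ≤ C * n * M := by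
    intro m z
    have h1 := hC (g m) (hgs m) _ isOpNorm_iSup
    have h3 : ∀ j, ⨆ z, ‖(polydisc n).indicator (g m j) z‖ₑ ≤ (M : ℝ≥0∞) := fun j =>
      iSup_le fun z => (enorm_indicator_le_enorm_self _ _).trans
        (enorm_le_coe.2 (by exact_mod_cast hgM m j z))
    have h4 : ‖u m z‖ₑ ≤ (C * n * M : ℝ≥0) := by
      refine (le_iSup (fun z => ‖u m z‖ₑ) z).trans (h1.trans ?_)
      refine (mul_le_mul' le_rfl (Finset.sum_le_sum fun j _ => h3 j)).trans_eq ?_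
      rw [Finset.sum_const, Finset.card_univ, Fintype.card_fin, nsmul_eq_mul]
      push_cast
      ring
    exact_mod_cast enorm_le_coe.1 h4
  set e : ℕ → ℝ≥0∞ := fun m => C * ∑ j, eLpNorm (g m j - fun z => F z j) 1
    (volume.restrict (polydisc n)) with he
  have he0 : Filter.Tendsto e Filter.atTop (nhds 0) := by
    have := ENNReal.Tendsto.const_mul (a := (C : ℝ≥0∞)) (tendsto_finsetSum Finset.univ fun j _ =>
      tendsto_eLpNorm_one_approx_sub (hm j) (h2 j)) (Or.inr ENNReal.coe_ne_top)
    simpa using this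
  have hue : ∀ m l, eLpNorm (u m - u l) 1 (volume.restrict (polydisc n)) ≤ e m + e l := by
    intro m l
    have hs := (hgs m).sub (hgs l)
    -- By uniqueness, the difference of two approximate solutions agrees almost everywhere with
    -- `canSol` of the difference of the data, to which the L¹ estimate applies.
    have hae := ((huG m).sub (huG l) (hgi m) (hgi l)).ae_eq
      (hs.isCanonicalSolution fun z _ j => rfl)
    change eLpNorm (fun z => u m z - u l z) 1 _ ≤ _
    rw [eLpNorm_congr_ae hae, eLpNorm_one_eq_lintegral_enorm]
    refine (hC _ hs _ isOpNorm_lintegral).trans ?_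
    rw [he, ← mul_add, ← Finset.sum_add_distrib]
    refine mul_le_mul' le_rfl (Finset.sum_le_sum fun j _ => ?_)
    have hFj := (hm j).aestronglyMeasurable (μ := volume.restrict (polydisc n))
    calc ∫⁻ z in polydisc n, ‖(polydisc n).indicator (fun z => g m j z - g l j z) z‖ₑ
        ≤ eLpNorm ((g m j - fun z => F z j) - (g l j - fun z => F z j)) 1
          (volume.restrict (polydisc n)) := by
          rw [eLpNorm_one_eq_lintegral_enorm]
          refine lintegral_mono fun z => (enorm_indicator_le_enorm_self _ _).trans_eq ?_
          simp
      _ ≤ _ := eLpNorm_sub_le ((hgi m j).1.sub hFj) ((hgi l j).1.sub hFj) le_rfl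
  obtain ⟨v, hv, huv⟩ := exists_tendsto_eLpNorm_one (fun m => MemLp.of_bound (huG m).memLp.1 _
    (Filter.Eventually.of_forall (huK m))) he0 hue
  obtain ⟨hcan, hle⟩ := IsCanonicalSolution.of_tendsto huG (fun m j => (hgi m j).1)
    (fun j => (hm j).aestronglyMeasurable) (fun m j z => hgM m j z) huK
    (fun j => tendsto_eLpNorm_one_approx_sub (hm j) (h2 j)) hv.1 huv
  exact ⟨v, hcan, by exact_mod_cast hle⟩

end

theorem corollary1p2 (n : ℕ) (hn : 1 ≤ n) :
    ∃ C : ℝ≥0, 0 < C ∧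
      ∀ f : (Fin n → ℂ) → EuclideanSpace ℂ (Fin n),
        MemLp f ∞ (volume.restrict (polydisc n)) →
        IsDbarClosed (polydisc n) f →
        ∃ u : (Fin n → ℂ) → ℂ,
          IsCanonicalSolution (polydisc n) f u ∧
          (∀ v : (Fin n → ℂ) → ℂ, IsCanonicalSolution (polydisc n) f v →
            v =ᵐ[volume.restrict (polydisc n)] u) ∧
          eLpNorm u ∞ (volume.restrict (polydisc n)) ≤
            (C : ℝ≥0∞) * eLpNorm f ∞ (volume.restrict (polydisc n)) := by
  obtain ⟨C, hC⟩ := exists_isCanonicalSolution_le n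
  -- Adding 1 makes the constant positive.
  refine ⟨C + 1, by positivity, fun f hf hcl => ?_⟩
  have hae := hf.1.ae_eq_mk
  obtain ⟨M, hM⟩ : ∃ M : ℝ≥0, (M : ℝ≥0∞) = eLpNorm f ⊤ (volume.restrict (polydisc n)) :=
    ⟨_, ENNReal.coe_toNNReal hf.2.ne⟩
  have hfM : ∀ᵐ z ∂volume.restrict (polydisc n), ‖f z‖ ≤ M := by
    rw [eLpNorm_exponent_top] at hM
    filter_upwards [ae_le_eLpNormEssSup (f := f) (μ := volume.restrict (polydisc n))] with z hz
    rw [← hM] at hz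
    exact_mod_cast enorm_le_coe.1 hz
  obtain ⟨u, hu, huC⟩ := hC (hf.1.mk f) hf.1.stronglyMeasurable_mk.measurable (hcl.congr hae) M
    (by filter_upwards [hae, hfM] with z h1 h2; rwa [← h1])
  have hcan := hu.congr hae.symm
  refine ⟨u, hcan, fun v hv => hv.ae_eq hcan, ?_⟩
  rw [← hM, ← ENNReal.coe_mul, eLpNorm_exponent_top]
  refine essSup_le_of_ae_le _ (huC.mono fun z hz => ?_)
  refine enorm_le_coe.2 ((NNReal.coe_le_coe.1 (by exact_mod_cast hz) : ‖u z‖₊ ≤ C * M).trans ?_)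
  gcongr
  exact le_self_add
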